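/- Theorem 3.2 (unicyclic graphs with $\ell=4$). All graphs are finite and simple. A path in a totally colored graph (all vertices and edges are colored) is total-rainbow if its edges and internal vertices have pairwise distinct colors, and $trc(G)$ is the minimum number of colors in a total-coloring of the connected graph $G$ for which any two distinct vertices are joined by a total-rainbow path. Let $G$ be a connected unicyclic graph of order $n$ that is not a cycle and whose cycle $u_1u_2u_3u_4u_1$ has length $4$. For $1\le i\le 4$ let $T_i$ be the component containing $u_i$ after the four cycle edges are deleted, a tree rooted at $u_i$; it is nontrivial if it has at least one edge, and $T_i,T_j$ are adjacent if $u_i,u_j$ are. The leaves of $T_i$ are the vertices of degree one of $G$ that lie in $T_i$. Up to relabelling of the cycle, let $\mathcal H_1,\dots,\mathcal H_5$ be the classes of those $G$ for which, respectively, exactly $T_1$; exactly $T_1,T_2$; exactly $T_1,T_3$; exactly $T_1,T_2,T_3$; all of $T_1,\dots,T_4$ are nontrivial, and let $\mathcal H_i^j$ consist of the graphs in $\mathcal H_i$ with exactly $j$ leaves. Let $B_4$ denote any graph in $\mathcal H_1$ in which $T_1$ is a path with end $u_1$. Say that $T_i$ is of type I if it has exactly two leaves and consists of a path from $u_i$ to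 a vertex $v$ (possibly $v=u_i$), one pendent edge at $v$, and a path of length at least one from $v$ to the other leaf. Say that $T_i$ is of type II if it has exactly three leaves and consists of a path from $u_i$ to a vertex $v$ (possibly $v=u_i$), two pendent edges at $v$, and one pendent edge at a vertex $v'$ of that path (possibly $v'=u_i$ or $v'=v$). Up to relabelling of the cycle, put - ${\mathcal H_1^2}'$: graphs in $\mathcal H_1^2$ with $T_1$ of type I; ${\mathcal H_1^2}''=\mathcal H_1^2\setminus{\mathcal H_1^2}'$; - ${\mathcal H_1^3}'$: graphs in $\mathcal H_1^3$ with $T_1$ of type II; - ${\mathcal H_3^3}'$: graphs in $\mathcal H_3^3$ with $T_1$ of type I; ${\mathcal H_3^3}''=\mathcal H_3^3\setminus{\mathcal H_3^3}'$; - ${\mathcal H_3^4}'$: graphs in $\mathcal H_3^4$ with $T_1$ of type II; ${\mathcal H_3^4}''$: graphs in $\mathcal H_3^4$ with both $T_1$ and $T_3$ of type I; - ${\mathcal H_4^4}'$: graphs in $\mathcal H_4^4$ (with $T_4$ trivial) in which $T_1$ has exactly two leaves. Then - $trc(G)=2n-5$ if $G\in\{B_4\}\cup\mathcal H_3^2$;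 - $trc(G)=2n-7$ if $G\in{\mathcal H_1^2}'\cup\mathcal H_2^2\cup{\mathcal H_3^3}'\cup\mathcal H_4^3\cup\mathcal H_5^4$; - $trc(G)=2n-8$ if $G\in{\mathcal H_1^2}''\cup{\mathcal H_1^3}'\cup\mathcal H_2^3\cup{\mathcal H_3^3}''\cup{\mathcal H_3^4}'\cup{\mathcal H_3^4}''\cup{\mathcal H_4^4}'$; - $trc(G)\le 2n-9$ otherwise. -/

import Mathlib

namespace TRC

variable {V : Type*}

/-! ### Total-rainbow connection -/

/-- A walk is a total-rainbow path with respect to the vertex coloring `cV` and the edge coloring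
`cE` if it is a path and all its edges and internal vertices have pairwise distinct colors.
The internal vertices are those of the support with the first and the last one removed. -/
def IsTotalRainbowPath {G : SimpleGraph V} {C : Type*} (cV : V → C) (cE : Sym2 V → C)
    {x y : V} (p : G.Walk x y) : Prop :=
  p.IsPath ∧ (p.support.tail.dropLast.map cV ++ p.edges.map cE).Nodup

/-- `G` has a total-coloring with (at most) `k` colors that makes it total-rainbow connected.
Only the values of `cE` on the edges of `G` play a role. -/
def HasTRCColoring (G : SimpleGraph V) (k : ℕ) : Prop :=
  ∃ (cV : V → Fin k) (cE : Sym2 V → Fin k),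
    ∀ x y : V, x ≠ y → ∃ p : G.Walk x y, IsTotalRainbowPath cV cE p

/-- The total-rainbow connection number: the minimum number of colors in a total-coloring that
makes `G` total-rainbow connected. -/
noncomputable def trc (G : SimpleGraph V) : ℕ :=
  sInf {k : ℕ | HasTRCColoring G k}

/-! ### Unicyclic graphs, circumference, leaves -/

/-- `G` contains exactly one cycle (cycles are identified with their edge sets). -/
def IsUnicyclic (G : SimpleGraph V) : Prop :=
  ∃ (x : V) (p : G.Walk x x), p.IsCycle ∧
    ∀ (y : V) (q : G.Walk y y), q.IsCycle → ∀ e : Sym2 V, e ∈ q.edges ↔ e ∈ p.edges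

/-- The length of a longest cycle. -/
noncomputable def circumference (G : SimpleGraph V) : ℕ :=
  sSup {m : ℕ | ∃ (x : V) (p : G.Walk x x), p.IsCycle ∧ p.length = m}

/-- `G` is a connected unicyclic graph whose cycle has length `4`. -/
def IsConnectedUnicyclicFour (G : SimpleGraph V) : Prop :=
  G.Connected ∧ IsUnicyclic G ∧ circumference G = 4

/-- `w` is a pendent vertex (leaf) of `G`: it has exactly one neighbor. -/
def IsLeaf (G : SimpleGraph V) (w : V) : Prop :=
  ∃! x : V, G.Adj w x

/-- The number of leaves of `G`. -/
noncomputable def numLeaves (G : SimpleGraph V) : ℕ :=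
  {w : V | IsLeaf G w}.ncard

/-! ### The cycle `u₁u₂u₃u₄u₁` and the trees hanging from it

The vertices of the cycle are `u 0, u 1, u 2, u 3`, and the tree at `u i` is the component of `u i`
once the edges of the cycle are deleted. -/

/-- `u 0, u 1, u 2, u 3` are the consecutive vertices of a cycle of length `4` in `G`
(addition in `Fin 4` is modulo `4`). -/
def IsFourCycle (G : SimpleGraph V) (u : Fin 4 → V) : Prop :=
  Function.Injective u ∧ ∀ i : Fin 4, G.Adj (u i) (u (i + 1))

/-- `G` with the edges of the cycle deleted. -/
def offCycle (G : SimpleGraph V) (u : Fin 4 → V) : SimpleGraph V :=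
  G.deleteEdges (Set.range fun i : Fin 4 => s(u i, u (i + 1)))

/-- The vertex set of the tree at `u i`. -/
def tree (G : SimpleGraph V) (u : Fin 4 → V) (i : Fin 4) : Set V :=
  {w : V | (offCycle G u).Reachable (u i) w}

/-- The tree at `u i` contains at least one edge. -/
def TreeNontrivial (G : SimpleGraph V) (u : Fin 4 → V) (i : Fin 4) : Prop :=
  ∃ x ∈ tree G u i, ∃ y ∈ tree G u i, (offCycle G u).Adj x y

/-- The leaves of `G` that belong to the tree at `u i`. -/
def treeLeaves (G : SimpleGraph V) (u : Fin 4 → V) (i : Fin 4) : Set V :=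
  {w : V | w ∈ tree G u i ∧ IsLeaf G w}

/-- `x` lies on the path from `u i` to `w` inside the tree at `u i`. -/
def OnRootPath (G : SimpleGraph V) (u : Fin 4 → V) (i : Fin 4) (x w : V) : Prop :=
  ∃ p : (offCycle G u).Walk (u i) w, p.IsPath ∧ x ∈ p.support

/-- `G` is a connected unicyclic graph with a cycle of length `4`, the cycle is `u`, and the
nontrivial trees are exactly those at `u i` with `i ∈ S`. -/
def HasPattern (G : SimpleGraph V) (u : Fin 4 → V) (S : Set (Fin 4)) : Prop :=
  IsConnectedUnicyclicFour G ∧ IsFourCycle G u ∧ ∀ i : Fin 4, TreeNontrivial G u i ↔ i ∈ S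

/-! ### The graph classes -/

/-- `B₄`: the only nontrivial tree is a path of which the cycle vertex `u 0` is an end. -/
def IsB4 (G : SimpleGraph V) : Prop :=
  ∃ u : Fin 4 → V, HasPattern G u {0} ∧
    ∃ (v : V) (p : (offCycle G u).Walk (u 0) v), p.IsPath ∧
      (∀ x ∈ tree G u 0, x ∈ p.support) ∧
      (∀ x ∈ tree G u 0, ∀ y ∈ tree G u 0, (offCycle G u).Adj x y → s(x, y) ∈ p.edges)

/-- `ℋ₁ʲ`: exactly one nontrivial tree; `j` leaves. -/
def H1 (j : ℕ) (G : SimpleGraph V) : Prop :=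
  (∃ u : Fin 4 → V, HasPattern G u {0}) ∧ numLeaves G = j

/-- `ℋ₂ʲ`: exactly two trivial trees, and they are adjacent; `j` leaves. -/
def H2 (j : ℕ) (G : SimpleGraph V) : Prop :=
  (∃ u : Fin 4 → V, HasPattern G u {0, 1}) ∧ numLeaves G = j

/-- `ℋ₃ʲ`: exactly two trivial trees, and they are nonadjacent; `j` leaves. -/
def H3 (j : ℕ) (G : SimpleGraph V) : Prop :=
  (∃ u : Fin 4 → V, HasPattern G u {0, 2}) ∧ numLeaves G = j

/-- `ℋ₄ʲ`: exactly one trivial tree; `j` leaves. -/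
def H4 (j : ℕ) (G : SimpleGraph V) : Prop :=
  (∃ u : Fin 4 → V, HasPattern G u {0, 1, 2}) ∧ numLeaves G = j

/-- `ℋ₅ʲ`: all four trees are nontrivial; `j` leaves. -/
def H5 (j : ℕ) (G : SimpleGraph V) : Prop :=
  (∃ u : Fin 4 → V, HasPattern G u Set.univ) ∧ numLeaves G = j

/-- The tree at `u i` has exactly two leaves `v₁, v₂`: it consists of a path from `u i` to the
branch vertex `v` (possibly `v = u i`), a pendent edge `v v₁`, and a path from `v` to `v₂`. -/
def TwoLeafShape (G : SimpleGraph V) (u : Fin 4 → V) (i : Fin 4) : Prop :=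
  ∃ v v₁ v₂ : V, v₁ ≠ v₂ ∧ treeLeaves G u i = {v₁, v₂} ∧
    G.Adj v v₁ ∧ OnRootPath G u i v v₂

/-- The tree at `u i` has exactly three leaves `v₁, v₂, v₃`: it consists of a path from `u i` to a
vertex `v`, two pendent edges `v v₁`, `v v₂`, and one pendent edge `v' v₃` at a vertex `v'` of that
path (`v' = u i` and `v' = v` are allowed). -/
def ThreeLeafShape (G : SimpleGraph V) (u : Fin 4 → V) (i : Fin 4) : Prop :=
  ∃ v v' v₁ v₂ v₃ : V, v₁ ≠ v₂ ∧ v₁ ≠ v₃ ∧ v₂ ≠ v₃ ∧ treeLeaves G u i = {v₁, v₂, v₃} ∧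
    G.Adj v v₁ ∧ G.Adj v v₂ ∧ G.Adj v' v₃ ∧ OnRootPath G u i v' v

/-- `ℋ₁²′`. -/
def H1_2' (G : SimpleGraph V) : Prop :=
  H1 2 G ∧ ∃ u : Fin 4 → V, HasPattern G u {0} ∧ TwoLeafShape G u 0

/-- `ℋ₁²″ = ℋ₁² \ ℋ₁²′`. -/
def H1_2'' (G : SimpleGraph V) : Prop :=
  H1 2 G ∧ ¬ H1_2' G

/-- `ℋ₁³′`. -/
def H1_3' (G : SimpleGraph V) : Prop :=
  H1 3 G ∧ ∃ u : Fin 4 → V, HasPattern G u {0} ∧ ThreeLeafShape G u 0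

/-- `ℋ₃³′`: the tree with two leaves has the shape `TwoLeafShape`. -/
def H3_3' (G : SimpleGraph V) : Prop :=
  H3 3 G ∧ ∃ u : Fin 4 → V, HasPattern G u {0, 2} ∧ TwoLeafShape G u 0

/-- `ℋ₃³″ = ℋ₃³ \ ℋ₃³′`. -/
def H3_3'' (G : SimpleGraph V) : Prop :=
  H3 3 G ∧ ¬ H3_3' G

/-- `ℋ₃⁴′`: one of the two nontrivial trees has three leaves and the shape `ThreeLeafShape`. -/
def H3_4' (G : SimpleGraph V) : Prop :=
  H3 4 G ∧ ∃ u : Fin 4 → V, HasPattern G u {0, 2} ∧ ThreeLeafShape G u 0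

/-- `ℋ₃⁴″`: both nontrivial trees have two leaves and the shape `TwoLeafShape`. -/
def H3_4'' (G : SimpleGraph V) : Prop :=
  H3 4 G ∧ ∃ u : Fin 4 → V, HasPattern G u {0, 2} ∧ TwoLeafShape G u 0 ∧ TwoLeafShape G u 2

/-- `ℋ₄⁴′`: the trivial tree is the one at `u 3`, and the tree at `u 0`, which is adjacent to it,
has two leaves. -/
def H4_4' (G : SimpleGraph V) : Prop :=
  H4 4 G ∧ ∃ u : Fin 4 → V, HasPattern G u {0, 1, 2} ∧ (treeLeaves G u 0).ncard = 2

/-! ### The three families of the classification -/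

/-- `{B₄} ∪ ℋ₃²`. -/
def Family5 (G : SimpleGraph V) : Prop :=
  IsB4 G ∨ H3 2 G

/-- `ℋ₁²′ ∪ ℋ₂² ∪ ℋ₃³′ ∪ ℋ₄³ ∪ ℋ₅⁴`. -/
def Family7 (G : SimpleGraph V) : Prop :=
  H1_2' G ∨ H2 2 G ∨ H3_3' G ∨ H4 3 G ∨ H5 4 G

/-- `ℋ₁²″ ∪ ℋ₁³′ ∪ ℋ₂³ ∪ ℋ₃³″ ∪ ℋ₃⁴′ ∪ ℋ₃⁴″ ∪ ℋ₄⁴′`. -/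
def Family8 (G : SimpleGraph V) : Prop :=
  H1_2'' G ∨ H1_3' G ∨ H2 3 G ∨ H3_3'' G ∨ H3_4' G ∨ H3_4'' G ∨ H4_4' G

end TRC

/-! ### Rooted trees on a four-cycle: bridges, cut vertices and their number. -/

namespace TRC

variable {V : Type*}

/-! Delete the cycle edges and root each remaining tree at its cycle vertex. Let F (`Forced`) be the
set of bridges and cut vertices. There are n - 4 bridges, and the cut vertices are the vertices with
a child, so |F| = 2n - 4 - (number of leaves) - (number of trivial trees); this is `ncard_forced`.
Any two elements of F lie on every path between two suitably chosen vertices, hence a total-rainbow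
connecting coloring is injective on F and trc(G) ≥ |F|. What remains is to find how many new colors,
from 0 to 3, the cycle requires.

A path between vertices x, y of different trees uses the root paths R x and R y and one of the two
arcs of the cycle. So one arc must carry distinct colors, none of them occurring on R x or R y
(`exists_of_hasTRCColoring`). Conversely, an assignment of colors to the cycle with this property
for the childless vertices x, y extends to a coloring of G, with F colored injectively
(`hasTRCColoring_of_cycle`).

A color of F can be reused on an arc only for pairs whose root paths miss it, so everything depends
on the private colors of the leaves. Between opposite trees each arc has three elements, two edges
and a vertex. If one leaf in each tree covers F, nothing can be reused and three new colors are
needed. With two leaves in one tree, the pendent edge of each serves the other, and two new colors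
suffice. One new color suffices once suitable pairs of private colors exist, for instance the
pendent edges of two leaves and, for a third leaf, its pendent edge and its neighbor. Types I and
II, and two opposite trees of type I, are the cases where such pairs are missing; a pigeonhole on
the two arcs proves the lower bounds (`forced_add_two_le`, `forced_add_two_le_of_three`,
`forced_add_two_le_of_two_two`).

If two adjacent trees are nontrivial, colors of one tree serve the pairs that avoid it, and one new
color is always enough (`hasTRCColoring_of_adjacent`, `hasTRCColoring_of_three_trees`). No new color
is needed when three consecutive trees are nontrivial and the middle one has two leaves. The lemmas
`forced_add_one_le_of_*` show when the one new color is unavoidable. Adding |F| in each class gives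
the stated values. -/

/-- `G` is the cycle `u` together with rooted trees hanging from its vertices: `idx` is the index of
the tree of a vertex, `par` its parent (a root is its own parent). -/
structure Rooting (G : SimpleGraph V) (u : Fin 4 → V) where
  idx : V → Fin 4
  par : V → V
  dep : V → ℕ
  inj : Function.Injective u
  idx_root : ∀ i, idx (u i) = i
  par_root : ∀ i, par (u i) = u i
  dep_par : ∀ w, w ∉ Set.range u → dep (par w) < dep w
  idx_par : ∀ w, idx (par w) = idx w
  adj_iff : ∀ x y, G.Adj x y ↔ (∃ i, s(x, y) = s(u i, u (i + 1))) ∨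
    (x ∉ Set.range u ∧ par x = y) ∨ (y ∉ Set.range u ∧ par y = x)

namespace Rooting

variable {G : SimpleGraph V} {u : Fin 4 → V} {i : Fin 4} (ρ : Rooting G u)

/-- `a` is an ancestor of `x` (possibly `x` itself). -/
def Anc (a x : V) : Prop := ∃ k : ℕ, ρ.par^[k] x = a

/-- `x` has no children. -/
def IsEnd (x : V) : Prop := ∀ w, w ∉ Set.range u → ρ.par w ≠ x

/-- The edge from `w` to its parent. -/
def bridge (w : V) : V ⊕ Sym2 V := Sum.inr s(w, ρ.par w)

/-- The bridges and cut vertices used by every path from `x` to another tree. -/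
def R (x : V) : Set (V ⊕ Sym2 V) :=
  {f | (∃ w, ρ.Anc w x ∧ w ≠ x ∧ f = Sum.inl w) ∨
    ∃ w, w ∉ Set.range u ∧ ρ.Anc w x ∧ f = ρ.bridge w}

/-- All bridges and cut vertices. -/
def Forced : Set (V ⊕ Sym2 V) := {f | ∃ x, f ∈ ρ.R x}

theorem anc_refl (x : V) : ρ.Anc x x := ⟨0, rfl⟩

theorem anc_par (x : V) : ρ.Anc (ρ.par x) x := ⟨1, rfl⟩

variable {ρ}

theorem Anc.trans {a b c : V} (h : ρ.Anc a b) (h' : ρ.Anc b c) : ρ.Anc a c := by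
  obtain ⟨k, rfl⟩ := h
  obtain ⟨l, rfl⟩ := h'
  exact ⟨k + l, Function.iterate_add_apply _ _ _ _⟩

theorem anc_root {a : V} {i : Fin 4} (h : ρ.Anc a (u i)) : a = u i := by
  obtain ⟨k, rfl⟩ := h
  exact Function.iterate_fixed (ρ.par_root i) k

theorem Anc.eq_or {a x : V} (h : ρ.Anc a x) : a = x ∨ (x ∉ Set.range u ∧ ρ.Anc a (ρ.par x)) := by
  by_cases hx : x ∈ Set.range u
  · obtain ⟨i, rfl⟩ := hx
    exact Or.inl (anc_root h)
  · obtain ⟨k, rfl⟩ := h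
    cases k with
    | zero => exact Or.inl rfl
    | succ k => exact Or.inr ⟨hx, k, rfl⟩

theorem Anc.idx {a x : V} (h : ρ.Anc a x) : ρ.idx a = ρ.idx x := by
  obtain ⟨k, rfl⟩ := h
  induction k with
  | zero => rfl
  | succ k ih => rw [Function.iterate_succ_apply', ρ.idx_par, ih]

theorem dep_par_le (x : V) : ρ.dep (ρ.par x) ≤ ρ.dep x := by
  by_cases hx : x ∈ Set.range u
  · obtain ⟨i, rfl⟩ := hx
    rw [ρ.par_root]
  · exact (ρ.dep_par x hx).le

theorem Anc.dep_le {a x : V} (h : ρ.Anc a x) : ρ.dep a ≤ ρ.dep x := by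
  obtain ⟨k, rfl⟩ := h
  induction k with
  | zero => rfl
  | succ k ih => rw [Function.iterate_succ_apply']; exact (dep_par_le _).trans ih

theorem Anc.dep_lt {a x : V} (h : ρ.Anc a x) (hne : a ≠ x) : ρ.dep a < ρ.dep x := by
  rcases h.eq_or with h | ⟨hx, h⟩
  · exact absurd h hne
  · exact h.dep_le.trans_lt (ρ.dep_par x hx)

theorem Anc.antisymm {a x : V} (h : ρ.Anc a x) (h' : ρ.Anc x a) : a = x := by
  by_contra hne
  exact absurd (h.dep_lt hne) (not_lt.mpr h'.dep_le)

theorem par_ne {w : V} (hw : w ∉ Set.range u) : ρ.par w ≠ w := fun h => by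
  have := ρ.dep_par w hw
  rw [h] at this
  exact lt_irrefl _ this

theorem Anc.exists_child {a x : V} (h : ρ.Anc a x) (hne : a ≠ x) :
    ∃ w, w ∉ Set.range u ∧ ρ.par w = a ∧ ρ.Anc w x := by
  obtain ⟨k, rfl⟩ := h
  induction k with
  | zero => exact absurd rfl hne
  | succ k ih =>
    rw [Function.iterate_succ_apply'] at hne ⊢
    -- A root is its own parent, so the iterates may have become stationary before step `k`; in that
    -- case the previous iterate already equals `a`.
    by_cases hk : ρ.par^[k] x ∈ Set.range u
    · obtain ⟨i, hi⟩ := hk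
      rw [← hi, ρ.par_root, hi] at hne ⊢
      exact ih hne
    · exact ⟨_, hk, rfl, k, rfl⟩

theorem IsEnd.eq_of_anc {x y : V} (hx : ρ.IsEnd x) (h : ρ.Anc x y) : x = y := by
  by_contra hne
  obtain ⟨w, hw, h1, -⟩ := h.exists_child hne
  exact hx w hw h1

theorem root_anc (x : V) : ρ.Anc (u (ρ.idx x)) x := by
  induction h : ρ.dep x using Nat.strong_induction_on generalizing x with
  | _ d ih =>
    by_cases hx : x ∈ Set.range u
    · obtain ⟨i, rfl⟩ := hx
      rw [ρ.idx_root]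
      exact ρ.anc_refl _
    · have := ih _ (h ▸ ρ.dep_par x hx) (ρ.par x) rfl
      rw [ρ.idx_par] at this
      exact this.trans (ρ.anc_par x)

theorem anc_mem_root {a x : V} (h : ρ.Anc a x) (ha : a ∈ Set.range u) : a = u (ρ.idx x) := by
  obtain ⟨i, rfl⟩ := ha
  rw [← h.idx, ρ.idx_root]

theorem exists_end [Fintype V] (x : V) : ∃ y, ρ.IsEnd y ∧ ρ.Anc x y := by
  classical
  obtain ⟨y, hy, hmax⟩ := (Finset.univ.filter fun y => ρ.Anc x y).exists_max_image ρ.dep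
    ⟨x, by simpa using ρ.anc_refl x⟩
  refine ⟨y, fun w hw h => ?_, by simpa using hy⟩
  have h1 : ρ.Anc x w := (by simpa using hy : ρ.Anc x y).trans (h ▸ ρ.anc_par w)
  have := hmax w (by simpa using h1)
  have := ρ.dep_par w hw
  rw [h] at this
  omega

theorem bridge_inj {w z : V} (hw : w ∉ Set.range u) (hz : z ∉ Set.range u)
    (h : ρ.bridge w = ρ.bridge z) : w = z := by
  have h' : s(w, ρ.par w) = s(z, ρ.par z) := Sum.inr.inj h
  rw [Sym2.eq_iff] at h'
  rcases h' with ⟨h1, -⟩ | ⟨h1, h2⟩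
  · exact h1
  -- Equality with the ends exchanged would make each vertex the parent of the other, against the
  -- depths.
  · have a := ρ.dep_par w hw
    have b := ρ.dep_par z hz
    rw [h2] at a
    rw [← h1] at b
    omega

theorem inl_mem_R {w x : V} : Sum.inl w ∈ ρ.R x ↔ ρ.Anc w x ∧ w ≠ x := by
  constructor
  · rintro (⟨w', h1, h2, h3⟩ | ⟨w', -, -, h3⟩)
    · cases h3
      exact ⟨h1, h2⟩
    · cases h3
  · rintro ⟨h1, h2⟩
    exact Or.inl ⟨w, h1, h2, rfl⟩

theorem bridge_mem_R {w x : V} (hw : w ∉ Set.range u) : ρ.bridge w ∈ ρ.R x ↔ ρ.Anc w x := by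
  constructor
  · rintro (⟨w', h1, h2, h3⟩ | ⟨w', h1, h2, h3⟩)
    · cases h3
    · rwa [bridge_inj hw h1 h3]
  · exact fun h => Or.inr ⟨w, hw, h, rfl⟩

/-- The edge of the cycle from `u k` to `u (k + 1)`. -/
def _root_.TRC.cyc (u : Fin 4 → V) (k : Fin 4) : V ⊕ Sym2 V := Sum.inr s(u k, u (k + 1))

theorem cyc_ne_bridge {k : Fin 4} {w : V} (hw : w ∉ Set.range u) : cyc u k ≠ ρ.bridge w := by
  intro h
  have h' : s(u k, u (k + 1)) = s(w, ρ.par w) := Sum.inr.inj h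
  rw [Sym2.eq_iff] at h'
  rcases h' with ⟨h1, -⟩ | ⟨-, h1⟩
  · exact hw ⟨_, h1⟩
  · exact hw ⟨_, h1⟩

theorem cyc_notMem_R {k : Fin 4} {x : V} : cyc u k ∉ ρ.R x := by
  rintro (⟨w', h1, h2, h3⟩ | ⟨w', h1, h2, h3⟩)
  · cases h3
  · exact cyc_ne_bridge h1 h3

theorem cyc_notMem_Forced {k : Fin 4} : cyc u k ∉ ρ.Forced := fun ⟨_, h⟩ => cyc_notMem_R h

theorem R_subset_Forced (x : V) : ρ.R x ⊆ ρ.Forced := fun _ h => ⟨x, h⟩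

theorem R_root (i : Fin 4) : ρ.R (u i) = ∅ := by
  ext f
  simp only [Set.mem_empty_iff_false, iff_false]
  rintro (⟨w, h1, h2, -⟩ | ⟨w, h1, h2, -⟩)
  · exact h2 (anc_root h1)
  · exact h1 ⟨i, (anc_root h2).symm⟩

theorem Anc.R_subset {a x : V} (h : ρ.Anc a x) : ρ.R a ⊆ ρ.R x := by
  rintro f (⟨w, h1, h2, rfl⟩ | ⟨w, h1, h2, rfl⟩)
  · refine inl_mem_R.mpr ⟨h1.trans h, ?_⟩
    rintro rfl
    exact h2 (h1.antisymm h)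
  · exact (bridge_mem_R h1).mpr (h2.trans h)

theorem idx_eq_of_mem {f : V ⊕ Sym2 V} {x y : V} (hx : f ∈ ρ.R x) (hy : f ∈ ρ.R y) :
    ρ.idx x = ρ.idx y := by
  rcases hx with ⟨w, h1, h2, rfl⟩ | ⟨w, h1, h2, rfl⟩
  · rw [← h1.idx, (inl_mem_R.mp hy).1.idx]
  · rw [← h2.idx, ((bridge_mem_R h1).mp hy).idx]

theorem R_subset_insert {x : V} :
    ρ.R x ⊆ insert (ρ.bridge x) (insert (Sum.inl (ρ.par x)) (ρ.R (ρ.par x))) := by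
  rintro f (⟨w, h1, h2, rfl⟩ | ⟨w, h1, h2, rfl⟩)
  · rcases h1.eq_or with h | ⟨-, h⟩
    · exact absurd h h2
    · by_cases hw : w = ρ.par x
      · exact Or.inr (Or.inl (by rw [hw]))
      · exact Or.inr (Or.inr (inl_mem_R.mpr ⟨h, hw⟩))
  · rcases h2.eq_or with h | ⟨-, h⟩
    · exact Or.inl (by rw [h])
    · exact Or.inr (Or.inr ((bridge_mem_R h1).mpr h))

/-- A leaf whose neighbour lies on the root path of `y` contributes only its pendent edge. -/
theorem R_subset_of_anc_par {x y : V} (h : ρ.Anc (ρ.par x) y)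
    (hne : ρ.par x ≠ y) : ρ.R x ⊆ insert (ρ.bridge x) (ρ.R y) := by
  intro f hf
  rcases R_subset_insert hf with h1 | h1 | h1
  · exact Or.inl h1
  · exact Or.inr (h1 ▸ inl_mem_R.mpr ⟨h, hne⟩)
  · exact Or.inr (h.R_subset h1)

theorem exists_end_of_mem_Forced [Fintype V] {f : V ⊕ Sym2 V} (hf : f ∈ ρ.Forced) :
    ∃ x, ρ.IsEnd x ∧ f ∈ ρ.R x := by
  obtain ⟨x, hx⟩ := hf
  obtain ⟨y, hy, h⟩ := ρ.exists_end x
  exact ⟨y, hy, h.R_subset hx⟩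

theorem isEnd_root_iff {i : Fin 4} : ρ.IsEnd (u i) ↔ ∀ x, ρ.idx x = i → x = u i := by
  constructor
  · intro h x hx
    have := h.eq_of_anc (y := x) (hx ▸ root_anc x)
    exact this.symm
  · intro h w hw hp
    have := h w (by rw [← ρ.idx_par, hp, ρ.idx_root])
    exact hw ⟨i, this.symm⟩

theorem offCycle_adj {x y : V} : (offCycle G u).Adj x y ↔
    (x ∉ Set.range u ∧ ρ.par x = y) ∨ (y ∉ Set.range u ∧ ρ.par y = x) := by
  rw [offCycle, SimpleGraph.deleteEdges_adj, ρ.adj_iff]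
  constructor
  · rintro ⟨⟨i, hi⟩ | h, h'⟩
    · exact absurd ⟨i, hi.symm⟩ h'
    · exact h
  · intro h
    refine ⟨Or.inr h, ?_⟩
    rintro ⟨i, hi⟩
    rcases Sym2.eq_iff.mp hi with ⟨rfl, rfl⟩ | ⟨rfl, rfl⟩
    · rcases h with h | h <;> exact h.1 ⟨_, rfl⟩
    · rcases h with h | h <;> exact h.1 ⟨_, rfl⟩

theorem offCycle_adj_par {x : V} (hx : x ∉ Set.range u) : (offCycle G u).Adj x (ρ.par x) :=
  offCycle_adj.mpr (Or.inl ⟨hx, rfl⟩)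

variable (ρ) in
/-- There is a walk from a vertex up to its root through its ancestors. -/
theorem exists_climb (x : V) : ∃ p : (offCycle G u).Walk (u (ρ.idx x)) x,
    (∀ w ∈ p.support, ρ.Anc w x) ∧
    ∀ e ∈ p.edges, ∃ w, w ∉ Set.range u ∧ ρ.Anc w x ∧ e = s(w, ρ.par w) := by
  induction h : ρ.dep x using Nat.strong_induction_on generalizing x with
  | _ d ih =>
    by_cases hx : x ∈ Set.range u
    · obtain ⟨i, rfl⟩ := hx
      rw [ρ.idx_root]
      refine ⟨SimpleGraph.Walk.nil, ?_, ?_⟩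
      · intro w hw
        rw [SimpleGraph.Walk.support_nil, List.mem_singleton] at hw
        exact hw ▸ ρ.anc_refl _
      · simp
    · have hp := ih _ (h ▸ ρ.dep_par x hx) (ρ.par x) rfl
      rw [ρ.idx_par] at hp
      obtain ⟨p, h1, h2⟩ := hp
      refine ⟨p.concat (offCycle_adj_par hx).symm, ?_, ?_⟩
      · intro w hw
        rw [SimpleGraph.Walk.support_concat, List.mem_append,
          List.mem_singleton] at hw
        rcases hw with hw | rfl
        · exact (h1 w hw).trans (ρ.anc_par x)
        · exact ρ.anc_refl _
      · intro e he
        rw [SimpleGraph.Walk.edges_concat, List.concat_eq_append, List.mem_append,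
          List.mem_singleton] at he
        rcases he with he | rfl
        · obtain ⟨w, hw, h3, h4⟩ := h2 e he
          exact ⟨w, hw, h3.trans (ρ.anc_par x), h4⟩
        · exact ⟨x, hx, ρ.anc_refl _, Sym2.eq_swap⟩

theorem mem_tree_iff {w : V} {i : Fin 4} : w ∈ tree G u i ↔ ρ.idx w = i := by
  constructor
  · rintro ⟨p⟩
    have key : ∀ (a b : V) (p : (offCycle G u).Walk a b), ρ.idx a = ρ.idx b := by
      intro a b p
      induction p with
      | nil => rfl
      | cons h _ ih =>
        rw [← ih]
        rcases (offCycle_adj (ρ := ρ)).mp h with ⟨-, h⟩ | ⟨-, h⟩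
        · rw [← h, ρ.idx_par]
        · rw [← h, ρ.idx_par]
    rw [← key _ _ p, ρ.idx_root]
  · rintro rfl
    exact ⟨(ρ.exists_climb w).choose⟩

theorem treeNontrivial_iff {i : Fin 4} : TreeNontrivial G u i ↔ ¬ ρ.IsEnd (u i) := by
  constructor
  · rintro ⟨x, hx, y, hy, h⟩ he
    rw [mem_tree_iff (ρ := ρ)] at hx hy
    rw [isEnd_root_iff] at he
    rw [he x hx, he y hy] at h
    exact h.ne rfl
  · intro h
    rw [IsEnd] at h
    push Not at h
    obtain ⟨w, hw, h⟩ := h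
    have hi : ρ.idx w = i := by rw [← ρ.idx_par, h, ρ.idx_root]
    refine ⟨w, mem_tree_iff.mpr hi, u i, mem_tree_iff.mpr (ρ.idx_root i), ?_⟩
    rw [← h]
    exact offCycle_adj_par hw

theorem adj_root (ρ : Rooting G u) (i : Fin 4) : G.Adj (u i) (u (i + 1)) := (ρ.adj_iff _ _).mpr (Or.inl ⟨i, rfl⟩)

theorem adj_par {x : V} (hx : x ∉ Set.range u) : G.Adj x (ρ.par x) :=
  (ρ.adj_iff _ _).mpr (Or.inr (Or.inl ⟨hx, rfl⟩))

theorem isLeaf_iff {w : V} : IsLeaf G w ↔ w ∉ Set.range u ∧ ρ.IsEnd w := by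
  constructor
  · rintro ⟨x, hx, huniq⟩
    have hw : w ∉ Set.range u := by
      rintro ⟨i, rfl⟩
      have h1 := huniq _ (ρ.adj_root i)
      have h2 := huniq _ (by simpa using (ρ.adj_root (i - 1)).symm)
      have h3 := ρ.inj (h1.trans h2.symm)
      revert h3
      clear * -
      revert i
      decide
    refine ⟨hw, fun z hz h => ?_⟩
    have h1 := huniq _ (adj_par (ρ := ρ) hw)
    have h2 := huniq z (by rw [← h]; exact (adj_par (ρ := ρ) hz).symm)
    have h3 := ρ.dep_par w hw
    have h4 := ρ.dep_par z hz
    rw [h1, ← h2] at h3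
    rw [h] at h4
    omega
  · rintro ⟨hw, he⟩
    refine ⟨ρ.par w, adj_par hw, fun y hy => ?_⟩
    rcases (ρ.adj_iff _ _).mp hy with ⟨i, hi⟩ | ⟨-, h⟩ | ⟨h1, h2⟩
    · rcases Sym2.eq_iff.mp hi with ⟨h, -⟩ | ⟨h, -⟩ <;> exact absurd ⟨_, h.symm⟩ hw
    · exact h.symm
    · exact absurd h2 (he y h1)

theorem IsEnd.leaf_or {x : V} (h : ρ.IsEnd x) : IsLeaf G x ∨ x = u (ρ.idx x) := by
  by_cases hx : x ∈ Set.range u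
  · obtain ⟨i, rfl⟩ := hx
    rw [ρ.idx_root]
    exact Or.inr rfl
  · exact Or.inl (isLeaf_iff.mpr ⟨hx, h⟩)

theorem mem_treeLeaves_iff {w : V} {i : Fin 4} :
    w ∈ treeLeaves G u i ↔ ρ.idx w = i ∧ w ∉ Set.range u ∧ ρ.IsEnd w := by
  rw [treeLeaves, Set.mem_ofPred_eq, mem_tree_iff (ρ := ρ), isLeaf_iff (ρ := ρ)]

theorem adj_leaf {v w : V} (hw : IsLeaf G w) (h : G.Adj v w) : v = ρ.par w :=
  hw.unique h.symm (adj_par (isLeaf_iff (ρ := ρ).mp hw).1)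

theorem forced_eq : ρ.Forced = Sum.inl '' {w | ¬ ρ.IsEnd w} ∪ ρ.bridge '' (Set.range u)ᶜ := by
  ext f
  constructor
  · rintro ⟨x, ⟨w, h1, h2, rfl⟩ | ⟨w, h1, h2, rfl⟩⟩
    · refine Or.inl ⟨w, fun h => h2 (h.eq_of_anc h1), rfl⟩
    · exact Or.inr ⟨w, h1, rfl⟩
  · rintro (⟨w, h, rfl⟩ | ⟨w, h, rfl⟩)
    · simp only [IsEnd, Set.mem_ofPred_eq] at h
      push Not at h
      obtain ⟨z, hz, rfl⟩ := h
      exact ⟨z, inl_mem_R.mpr ⟨ρ.anc_par z, par_ne hz⟩⟩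
    · exact ⟨w, (bridge_mem_R h).mpr (ρ.anc_refl w)⟩

-- The bridges correspond to the n - 4 vertices off the cycle, and the cut vertices are all vertices
-- except the leaves and the roots of trivial trees. Written additively to avoid truncated
-- subtraction.
variable (ρ) in
theorem ncard_forced [Fintype V] : ρ.Forced.ncard + numLeaves G + {i | ρ.IsEnd (u i)}.ncard + 4 =
    2 * Fintype.card V := by
  have h1 : ρ.Forced.ncard = {w | ¬ ρ.IsEnd w}.ncard + ((Set.range u)ᶜ).ncard := by
    rw [forced_eq, Set.ncard_union_eq, Set.ncard_image_of_injective _ Sum.inl_injective,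
      Set.InjOn.ncard_image]
    · exact fun w hw z hz h => bridge_inj hw hz h
    · rw [Set.disjoint_left]
      rintro _ ⟨w, -, rfl⟩ ⟨z, -, h⟩
      cases h
  have h2 : (Set.range u).ncard + ((Set.range u)ᶜ).ncard = Fintype.card V := by
    rw [Set.ncard_add_ncard_compl, Nat.card_eq_fintype_card]
  have h3 : (Set.range u).ncard = 4 := by
    rw [← Set.image_univ, Set.ncard_image_of_injective _ ρ.inj, Set.ncard_univ]
    simp
  have h4 : {w | ρ.IsEnd w}.ncard + {w | ¬ ρ.IsEnd w}.ncard = Fintype.card V := by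
    rw [← Nat.card_eq_fintype_card, ← Set.ncard_add_ncard_compl {w | ρ.IsEnd w}]
    rfl
  have h5 : {w | ρ.IsEnd w}.ncard = numLeaves G + {i | ρ.IsEnd (u i)}.ncard := by
    have : {w | ρ.IsEnd w} = {w | IsLeaf G w} ∪ u '' {i | ρ.IsEnd (u i)} := by
      ext w
      constructor
      · intro h
        rcases IsEnd.leaf_or h with h' | h'
        · exact Or.inl h'
        · exact Or.inr ⟨ρ.idx w, by rw [Set.mem_ofPred_eq, ← h']; exact h, h'.symm⟩
      · rintro (h | ⟨i, h, rfl⟩)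
        · exact (isLeaf_iff.mp h).2
        · exact h
    rw [this, Set.ncard_union_eq, Set.ncard_image_of_injective _ ρ.inj, numLeaves]
    rw [Set.disjoint_left]
    rintro _ h ⟨i, -, rfl⟩
    exact (isLeaf_iff (ρ := ρ).mp h).1 ⟨i, rfl⟩
  omega

theorem numLeaves_eq_sum [Fintype V] (ρ : Rooting G u) :
    numLeaves G = ∑ i, (treeLeaves G u i).ncard := by
  classical
  rw [numLeaves, Set.ncard_eq_toFinset_card',
    Finset.card_eq_sum_card_fiberwise (f := ρ.idx) (t := Finset.univ) (by simp)]
  refine Finset.sum_congr rfl fun i _ => ?_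
  rw [Set.ncard_eq_toFinset_card']
  congr 1
  ext w
  rw [Set.mem_toFinset, treeLeaves, Set.mem_ofPred_eq, mem_tree_iff (ρ := ρ)]
  simp [and_comm]

theorem treeLeaves_eq_empty (h : ρ.IsEnd (u i)) : treeLeaves G u i = ∅ := by
  ext w
  simp only [mem_treeLeaves_iff (ρ := ρ), Set.mem_empty_iff_false, iff_false]
  rintro ⟨h1, h2, -⟩
  exact h2 ⟨i, (isEnd_root_iff.mp h w h1).symm⟩

theorem treeLeaves_nonempty [Fintype V] (h : ¬ ρ.IsEnd (u i)) : (treeLeaves G u i).Nonempty := by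
  obtain ⟨y, hy, h1⟩ := ρ.exists_end (u i)
  have hi : ρ.idx y = i := by rw [← h1.idx, ρ.idx_root]
  refine ⟨y, mem_treeLeaves_iff.mpr ⟨hi, ?_, hy⟩⟩
  rintro ⟨j, rfl⟩
  rw [ρ.idx_root] at hi
  exact h (hi ▸ hy)

end Rooting
end TRC

/-! ### Existence of the rooting, from the uniqueness of the cycle. -/

namespace TRC

variable {V : Type*}

theorem IsFourCycle.mem_edges {G : SimpleGraph V} {u : Fin 4 → V} (hu : IsFourCycle G u)
    (huni : IsUnicyclic G) {y : V} {q : G.Walk y y} (hq : q.IsCycle) (k : Fin 4) :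
    s(u k, u (k + 1)) ∈ q.edges := by
  obtain ⟨hinj, hadj⟩ := hu
  obtain ⟨x, p, -, h⟩ := huni
  rw [h _ q hq]
  have h0 : G.Adj (u 0) (u 1) := hadj 0
  have h1 : G.Adj (u 1) (u 2) := hadj 1
  have h2 : G.Adj (u 2) (u 3) := hadj 2
  have h3 : G.Adj (u 3) (u 0) := hadj 3
  have hc : (SimpleGraph.Walk.cons h0 (.cons h1 (.cons h2 (.cons h3 .nil)))).IsCycle := by
    rw [SimpleGraph.Walk.cons_isCycle_iff]
    simp [SimpleGraph.Walk.cons_isPath_iff, hinj.eq_iff]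
  rw [← h _ _ hc]
  fin_cases k <;> simp

/-- Every cycle of a subgraph is a cycle of `G`, and by uniqueness it uses all four edges of `u`. -/
theorem isAcyclic_of_le {G H : SimpleGraph V} {u : Fin 4 → V} (hu : IsFourCycle G u)
    (huni : IsUnicyclic G) (hle : H ≤ G) {k : Fin 4} (hk : ¬ H.Adj (u k) (u (k + 1))) :
    H.IsAcyclic := by
  intro v c hc
  have h := hu.mem_edges huni (hc.mapLe hle) k
  rw [SimpleGraph.Walk.edges_mapLe_eq_edges] at h
  exact hk (c.adj_of_mem_edges h)

theorem offCycle_le (G : SimpleGraph V) (u : Fin 4 → V) : offCycle G u ≤ G :=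
  SimpleGraph.deleteEdges_le _

/-- Deleting only edge `l` from `G` already leaves a forest, in which edge `k` is a bridge. The
graph `H` lies inside that forest with the bridge removed. -/
theorem not_reachable_of_avoids {G H : SimpleGraph V} {u : Fin 4 → V} (hu : IsFourCycle G u)
    (huni : IsUnicyclic G) (hle : H ≤ G) {k l : Fin 4} (hkl : k ≠ l)
    (hk : ¬ H.Adj (u k) (u (k + 1))) (hl : ¬ H.Adj (u l) (u (l + 1))) :
    ¬ H.Reachable (u k) (u (k + 1)) := by
  have hac : (G.deleteEdges {s(u l, u (l + 1))}).IsAcyclic :=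
    isAcyclic_of_le hu huni (SimpleGraph.deleteEdges_le _) (k := l)
      (by simp [SimpleGraph.deleteEdges_adj])
  rw [SimpleGraph.isAcyclic_iff_forall_adj_isBridge] at hac
  have hne : s(u k, u (k + 1)) ≠ s(u l, u (l + 1)) := by
    rw [Ne, Sym2.eq_iff, hu.1.eq_iff, hu.1.eq_iff, hu.1.eq_iff, hu.1.eq_iff]
    revert hkl
    clear * -
    revert k l
    decide
  have hb := @hac (u k) (u (k + 1))
    (by rw [SimpleGraph.deleteEdges_adj]; exact ⟨hu.2 k, by simpa using hne⟩)
  rw [SimpleGraph.isBridge_iff] at hb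
  refine fun h => hb (h.mono ?_)
  intro a b hab
  rw [SimpleGraph.deleteEdges_adj, SimpleGraph.deleteEdges_adj]
  refine ⟨⟨hle hab, ?_⟩, ?_⟩
  · intro h
    have h : s(a, b) = s(u l, u (l + 1)) := h
    rw [← SimpleGraph.mem_edgeSet, h] at hab
    exact hl hab
  · intro h
    have h : s(a, b) = s(u k, u (k + 1)) := h
    rw [← SimpleGraph.mem_edgeSet, h] at hab
    exact hk hab

theorem not_offCycle_adj (G : SimpleGraph V) (u : Fin 4 → V) (k : Fin 4) :
    ¬ (offCycle G u).Adj (u k) (u (k + 1)) := by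
  rw [offCycle, SimpleGraph.deleteEdges_adj]
  exact fun h => h.2 ⟨k, rfl⟩

theorem offCycle_not_reachable {G : SimpleGraph V} {u : Fin 4 → V} (hu : IsFourCycle G u)
    (huni : IsUnicyclic G) {i j : Fin 4} (hij : i ≠ j) :
    ¬ (offCycle G u).Reachable (u i) (u j) := by
  have hadj : ∀ k, ¬ (offCycle G u).Reachable (u k) (u (k + 1)) := fun k =>
    not_reachable_of_avoids hu huni (offCycle_le G u) (l := k + 1) (by simp)
      (not_offCycle_adj G u _) (not_offCycle_adj G u _)
  have hopp : ∀ k, ¬ (offCycle G u).Reachable (u k) (u (k + 2)) := by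
    intro k h
    -- For opposite roots, only the edges `k` and `k + 2` are deleted. A connection from `u k` to `u
    -- (k + 2)` off the cycle, followed by the surviving edge `k + 1`, would join the ends of edge
    -- `k`.
    have h1 : G.deleteEdges {s(u k, u (k + 1)), s(u (k + 2), u (k + 2 + 1))} ≤ G :=
      SimpleGraph.deleteEdges_le _
    refine not_reachable_of_avoids hu huni h1 (k := k) (l := k + 2) (by simp)
      (by simp [SimpleGraph.deleteEdges_adj]) (by simp [SimpleGraph.deleteEdges_adj]) ?_
    refine (h.mono ?_).trans (SimpleGraph.Adj.reachable ?_)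
    · intro a b hab
      rw [offCycle, SimpleGraph.deleteEdges_adj] at hab
      rw [SimpleGraph.deleteEdges_adj]
      refine ⟨hab.1, fun h => hab.2 ?_⟩
      rcases h with h | h
      · exact ⟨_, h.symm⟩
      · exact ⟨_, h.symm⟩
    · rw [SimpleGraph.deleteEdges_adj]
      have := (hu.2 (k + 1)).symm
      rw [show k + 1 + 1 = k + 2 by rw [add_assoc]; rfl] at this
      refine ⟨this, ?_⟩
      simp only [Set.mem_insert_iff, Set.mem_singleton_iff, Sym2.eq_iff, hu.1.eq_iff]
      clear * -
      revert k
      decide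
  have hcases : j = i + 1 ∨ i = j + 1 ∨ j = i + 2 := by
    revert hij
    clear * -
    revert i j
    decide
  rcases hcases with rfl | rfl | rfl
  · exact hadj i
  · exact fun h => hadj j h.symm
  · exact hopp i

theorem exists_reachable_root {G : SimpleGraph V} {u : Fin 4 → V} (hc : G.Connected) (w : V) :
    ∃ i, (offCycle G u).Reachable (u i) w := by
  have key : ∀ (a b : V) (_ : G.Walk a b), (∃ i, (offCycle G u).Reachable (u i) a) →
      ∃ i, (offCycle G u).Reachable (u i) b := by
    intro a b p
    induction p with
    | nil => exact id
    | @cons a b c h p ih =>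
      rintro ⟨i, hi⟩
      apply ih
      by_cases hb : (offCycle G u).Adj a b
      · exact ⟨i, hi.trans hb.reachable⟩
      · rw [offCycle, SimpleGraph.deleteEdges_adj] at hb
        push Not at hb
        obtain ⟨k, hk⟩ := hb h
        rcases Sym2.eq_iff.mp hk with ⟨-, rfl⟩ | ⟨rfl, -⟩
        · exact ⟨_, .rfl⟩
        · exact ⟨_, .rfl⟩
  obtain ⟨p⟩ := hc.preconnected (u 0) w
  exact key _ _ p ⟨0, .rfl⟩

/-- Paths in a forest are unique, so the path to `y` through its neighbor `x` is the path to `x`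
with one edge added. This identifies `x` as the parent of `y`. -/
theorem penultimate_of_mem_support {H : SimpleGraph V} (hH : H.IsAcyclic) {a b x y : V}
    (hab : a = b) {p : H.Walk a x} {q : H.Walk b y} (hp : p.IsPath) (hq : q.IsPath)
    (h : H.Adj x y) (hx : x ∈ q.support) : q.penultimate = x ∧ q.length = p.length + 1 := by
  subst hab
  rw [hH.path_concat hp hq h hx]
  simp

theorem penultimate_or {H : SimpleGraph V} (hH : H.IsAcyclic) {a b x y : V}
    (hab : a = b) {p : H.Walk a x} {q : H.Walk b y} (hp : p.IsPath) (hq : q.IsPath)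
    (h : H.Adj x y) : q.penultimate = x ∨ p.penultimate = y := by
  by_cases hx : x ∈ q.support
  · exact Or.inl (penultimate_of_mem_support hH hab hp hq h hx).1
  · subst hab
    exact Or.inr (penultimate_of_mem_support hH rfl hq hp h.symm
      (hH.mem_support_of_ne_mem_support_of_adj_of_isPath hp hq h hx)).1

/-- The parent of a vertex is the penultimate vertex of its path from the root in the forest
`offCycle G u`, and its depth is the length of that path. Distinct roots are not connected there,
which makes the index well defined. -/
theorem exists_rooting {G : SimpleGraph V} {u : Fin 4 → V} (hc : G.Connected)
    (huni : IsUnicyclic G) (hu : IsFourCycle G u) : Nonempty (Rooting G u) := by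
  classical
  have hac : (offCycle G u).IsAcyclic :=
    isAcyclic_of_le hu huni (offCycle_le G u) (not_offCycle_adj G u 0)
  have hex : ∀ w, ∃ (i : Fin 4) (p : (offCycle G u).Walk (u i) w), p.IsPath := fun w => by
    obtain ⟨i, ⟨p⟩⟩ := exists_reachable_root (u := u) hc w
    exact ⟨i, p.toPath, p.toPath.2⟩
  choose idx P hP using hex
  have huniq : ∀ {i j : Fin 4}, (offCycle G u).Reachable (u i) (u j) → i = j := fun h => by
    by_contra hne
    exact offCycle_not_reachable hu huni hne h
  have hroot : ∀ i, idx (u i) = i := fun i => huniq ⟨P (u i)⟩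
  have hidx : ∀ {x y}, (offCycle G u).Adj x y → idx x = idx y := fun {x y} h =>
    huniq ((P x).reachable.trans (h.reachable.trans (P y).reachable.symm))
  have hnil : ∀ w, w ∉ Set.range u → ¬ (P w).Nil := fun w hw h => hw ⟨_, h.eq⟩
  have hpadj : ∀ w, w ∉ Set.range u → (offCycle G u).Adj (P w).penultimate w := fun w hw =>
    (P w).adj_penultimate (hnil w hw)
  -- The penultimate vertex of an empty walk is its only vertex, which yields the convention that a
  -- root is its own parent.
  have hpr : ∀ i, (P (u i)).penultimate = u i := by
    have : ∀ {a b} (p : (offCycle G u).Walk a b), p.IsPath → a = b → p.penultimate = b := by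
      intro a b p hp hab
      subst hab
      rw [(SimpleGraph.Walk.isPath_iff_nil.mp hp).eq_nil]
      rfl
    exact fun i => this _ (hP _) (congrArg u (hroot i))
  refine ⟨{
    idx := idx
    par := fun w => (P w).penultimate
    dep := fun w => (P w).length
    inj := hu.1
    idx_root := hroot
    par_root := hpr
    dep_par := ?_
    idx_par := ?_
    adj_iff := ?_ }⟩
  · intro w hw
    have := (penultimate_of_mem_support hac (congrArg u (hidx (hpadj w hw))) (hP _) (hP w)
      (hpadj w hw) ((P w).getVert_mem_support _)).2
    omega
  · intro w
    by_cases hw : w ∈ Set.range u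
    · obtain ⟨i, rfl⟩ := hw
      rw [hpr]
    · exact hidx (hpadj w hw)
  · intro x y
    have hoff : ∀ w, w ∉ Set.range u → G.Adj (P w).penultimate w :=
      fun w hw => offCycle_le G u (hpadj w hw)
    constructor
    · intro h
      by_cases hcyc : ∃ i, s(x, y) = s(u i, u (i + 1))
      · exact Or.inl hcyc
      · right
        have h' : (offCycle G u).Adj x y := by
          rw [offCycle, SimpleGraph.deleteEdges_adj]
          exact ⟨h, fun ⟨i, hi⟩ => hcyc ⟨i, hi.symm⟩⟩
        have key : ∀ {a b}, (offCycle G u).Adj a b → (P b).penultimate = a → b ∉ Set.range u := by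
          rintro a _ hab h1 ⟨i, rfl⟩
          rw [hpr] at h1
          exact hab.ne h1.symm
        rcases penultimate_or hac (congrArg u (hidx h')) (hP x) (hP y) h' with h1 | h1
        · exact Or.inr ⟨key h' h1, h1⟩
        · exact Or.inl ⟨key h'.symm h1, h1⟩
    · rintro (⟨i, hi⟩ | ⟨hx, rfl⟩ | ⟨hy, rfl⟩)
      · rw [← SimpleGraph.mem_edgeSet, hi]
        exact hu.2 i
      · exact (hoff x hx).symm
      · exact hoff y hy

/-- A connected unicyclic graph of circumference four has a four-cycle. -/
theorem exists_isFourCycle {G : SimpleGraph V} (h : circumference G = 4) :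
    ∃ u : Fin 4 → V, IsFourCycle G u := by
  have hmem : 4 ∈ {m : ℕ | ∃ (x : V) (p : G.Walk x x), p.IsCycle ∧ p.length = m} := by
    rw [circumference] at h
    rw [← h]
    -- The supremum of an empty or unbounded set of naturals is 0 by convention, so the value 4 must
    -- be attained.
    apply Nat.sSup_mem
    · by_contra hne
      rw [Set.not_nonempty_iff_eq_empty] at hne
      rw [hne] at h
      simp at h
    · by_contra hb
      rw [Nat.sSup_of_not_bddAbove hb] at h
      omega
  obtain ⟨x, p, hp, hl⟩ := hmem
  refine ⟨fun i => p.getVert i, ?_, ?_⟩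
  · intro i j hij
    have := hp.getVert_injOn' (by simp; omega) (by simp; omega) hij
    exact Fin.ext this
  · intro i
    have h1 := p.adj_getVert_succ (i := i) (by omega)
    by_cases hi : i = 3
    · subst hi
      have h2 : p.getVert 4 = p.getVert 0 := by
        rw [← hl, p.getVert_length, p.getVert_zero]
      rw [show ((3 : Fin 4) : ℕ) + 1 = 4 from rfl, h2] at h1
      exact h1
    · have : ((i + 1 : Fin 4) : ℕ) = i + 1 := by omega
      rw [← this] at h1
      exact h1

end TRC

/-! ### Reduction of total-rainbow paths to the arcs of the cycle. -/

namespace TRC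

variable {V : Type*}

open SimpleGraph

/-- The edges and internal vertices of a walk. -/
def elems {G : SimpleGraph V} {x y : V} (p : G.Walk x y) : Set (V ⊕ Sym2 V) :=
  {f | (∃ w ∈ p.support, w ≠ x ∧ w ≠ y ∧ f = Sum.inl w) ∨ ∃ e ∈ p.edges, f = Sum.inr e}

theorem elems_reverse {G : SimpleGraph V} {x y : V} (p : G.Walk x y) :
    elems p.reverse = elems p := by
  ext f
  simp only [elems, Walk.support_reverse, Walk.edges_reverse, List.mem_reverse, Set.mem_ofPred_eq]
  constructor <;> rintro (⟨w, h1, h2, h3, h4⟩ | h)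
  · exact Or.inl ⟨w, h1, h3, h2, h4⟩
  · exact Or.inr h
  · exact Or.inl ⟨w, h1, h3, h2, h4⟩
  · exact Or.inr h

theorem mem_interior_iff {G : SimpleGraph V} {x y w : V} {p : G.Walk x y} (hp : p.IsPath) :
    w ∈ p.support.tail.dropLast ↔ w ∈ p.support ∧ w ≠ x ∧ w ≠ y := by
  cases p with
  | nil => simp
  | cons h q =>
    rw [Walk.cons_isPath_iff] at hp
    have hq : q.support = q.support.dropLast ++ [y] := by
      conv_lhs => rw [← List.dropLast_append_getLast q.support_ne_nil, q.getLast_support]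
    have hnd := hp.1.support_nodup
    rw [hq, List.nodup_append] at hnd
    rw [Walk.support_cons, List.tail_cons]
    constructor
    · intro hw
      have hwq := List.mem_of_mem_dropLast hw
      refine ⟨List.mem_cons_of_mem _ hwq, ?_, ?_⟩
      · rintro rfl
        exact hp.2 hwq
      · exact hnd.2.2 w hw y (by simp)
    · rintro ⟨h1, h2, h3⟩
      rcases List.mem_cons.mp h1 with h1 | h1
      · exact absurd h1 h2
      · rw [hq, List.mem_append, List.mem_singleton] at h1
        exact h1.resolve_right h3

/-- A path repeats neither vertices nor edges, so distinctness of the listed colors is injectivity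
on a set. In this form, forced elements enter through inclusions of sets. -/
theorem isTotalRainbowPath_iff {G : SimpleGraph V} {C : Type*} {c : V ⊕ Sym2 V → C} {x y : V}
    {p : G.Walk x y} : IsTotalRainbowPath (fun w => c (Sum.inl w)) (fun e => c (Sum.inr e)) p ↔
      p.IsPath ∧ Set.InjOn c (elems p) := by
  rw [IsTotalRainbowPath, and_congr_right_iff]
  intro hp
  set L : List (V ⊕ Sym2 V) := p.support.tail.dropLast.map Sum.inl ++ p.edges.map Sum.inr with hL
  have hnd : L.Nodup := by
    rw [hL, List.nodup_append]
    refine ⟨?_, ?_, ?_⟩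
    · exact ((hp.support_nodup.tail).sublist (List.dropLast_sublist _)).map Sum.inl_injective
    · exact hp.isTrail.edges_nodup.map Sum.inr_injective
    · intro a ha b hb
      obtain ⟨w, -, rfl⟩ := List.mem_map.mp ha
      obtain ⟨e, -, rfl⟩ := List.mem_map.mp hb
      exact Sum.inl_ne_inr
  have hmem : ∀ f, f ∈ L ↔ f ∈ elems p := by
    intro f
    simp only [hL, List.mem_append, List.mem_map, mem_interior_iff hp, elems, Set.mem_ofPred_eq]
    constructor <;> rintro (⟨w, h⟩ | ⟨w, h⟩)
    · exact Or.inl ⟨w, h.1.1, h.1.2.1, h.1.2.2, h.2.symm⟩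
    · exact Or.inr ⟨w, h.1, h.2.symm⟩
    · exact Or.inl ⟨w, ⟨h.1, h.2.1, h.2.2.1⟩, h.2.2.2.symm⟩
    · exact Or.inr ⟨w, h.1, h.2.symm⟩
  have hmap : p.support.tail.dropLast.map (fun w => c (Sum.inl w)) ++
      p.edges.map (fun e => c (Sum.inr e)) = L.map c := by
    rw [hL, List.map_append, List.map_map, List.map_map]
    rfl
  rw [hmap, List.nodup_map_iff_inj_on hnd]
  constructor
  · exact fun h a ha b hb hab => h a ((hmem a).mpr ha) b ((hmem b).mpr hb) hab
  · exact fun h a ha b hb hab => h ((hmem a).mp ha) ((hmem b).mp hb) hab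

/-- The values of `δ` on the edges and of `γ` on the internal vertices of the arc from `i` to `j`
of the four-cycle. -/
def arcL {C : Type*} (γ δ : Fin 4 → C) (i j : Fin 4) : List C :=
  ((List.finRange 4).filter fun k => k - i < j - i).map δ ++
    ((List.finRange 4).filter fun k => 0 < k - i ∧ k - i < j - i).map γ

theorem arcL_map {C D : Type*} (γ δ : Fin 4 → C) (i j : Fin 4) (c : C → D) :
    (arcL γ δ i j).map c = arcL (fun k => c (γ k)) (fun k => c (δ k)) i j := by
  rw [arcL, arcL, List.map_append, List.map_map, List.map_map]
  rfl

theorem mem_arcL {C : Type*} {γ δ : Fin 4 → C} {i j : Fin 4} {a : C} : a ∈ arcL γ δ i j ↔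
    (∃ k, k - i < j - i ∧ δ k = a) ∨ ∃ k, (0 < k - i ∧ k - i < j - i) ∧ γ k = a := by
  simp [arcL]

/-- The edges and internal vertices of the arc from `u i` to `u j`. -/
def arc (u : Fin 4 → V) (i j : Fin 4) : List (V ⊕ Sym2 V) :=
  arcL (fun k => Sum.inl (u k)) (cyc u) i j

theorem cyc_injective {u : Fin 4 → V} (hu : Function.Injective u) :
    Function.Injective (cyc u) := by
  intro k l h
  have h' : s(u k, u (k + 1)) = s(u l, u (l + 1)) := Sum.inr.inj h
  rw [Sym2.eq_iff, hu.eq_iff, hu.eq_iff, hu.eq_iff, hu.eq_iff] at h'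
  revert h'
  clear * -
  revert k l
  decide

theorem arc_nodup {u : Fin 4 → V} (hu : Function.Injective u) (i j : Fin 4) :
    (arc u i j).Nodup := by
  rw [arc, arcL, List.nodup_append]
  refine ⟨((List.nodup_finRange 4).filter _).map (cyc_injective hu),
    ((List.nodup_finRange 4).filter _).map (Sum.inl_injective.comp hu), ?_⟩
  simp [cyc]

namespace Rooting

variable {G : SimpleGraph V} {u : Fin 4 → V} {ρ : Rooting G u}

/-- The subtree below `w` is joined to the rest of the graph only by the bridge of `w`, and the walk
has to leave it. -/
theorem bridge_mem_edges {x y w : V} (p : G.Walk x y) (hw : w ∉ Set.range u)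
    (hx : ρ.Anc w x) (hy : ¬ ρ.Anc w y) : s(w, ρ.par w) ∈ p.edges := by
  obtain ⟨d, hd, h1, h2⟩ := p.exists_boundary_dart {z | ρ.Anc w z} hx hy
  have h1 : ρ.Anc w d.fst := h1
  have h2 : ¬ ρ.Anc w d.snd := h2
  have he : s(d.fst, d.snd) ∈ p.edges := List.mem_map_of_mem hd
  rcases (ρ.adj_iff _ _).mp d.adj with ⟨i, hi⟩ | ⟨h3, h4⟩ | ⟨h3, h4⟩
  · exfalso
    rcases Sym2.eq_iff.mp hi with ⟨h, -⟩ | ⟨h, -⟩ <;> rw [h] at h1 <;>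
      exact hw ⟨_, (anc_root h1).symm⟩
  · rcases h1.eq_or with h | ⟨-, h⟩
    · rw [h, h4]
      exact he
    · rw [h4] at h
      exact absurd h h2
  · exact absurd (h1.trans (h4 ▸ ρ.anc_par _)) h2

theorem mem_elems_of_mem_R {x y : V} (p : G.Walk x y) {f : V ⊕ Sym2 V} (hx : f ∈ ρ.R x)
    (hy : f ∉ ρ.R y) (hne : f ≠ Sum.inl y) : f ∈ elems p := by
  rcases hx with ⟨w, h1, h2, rfl⟩ | ⟨w, h1, h2, rfl⟩
  · have hwy : w ≠ y := fun h => hne (by rw [h])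
    -- A proper ancestor of `x` is an end of the bridge of its child towards `x`. If that bridge
    -- were not crossed, `y` would lie below the child and the vertex would belong to `R y`.
    obtain ⟨z, hz, rfl, hzx⟩ := h1.exists_child h2
    have hzy : ¬ ρ.Anc z y := fun h => hy (inl_mem_R.mpr ⟨(ρ.anc_par z).trans h, hwy⟩)
    exact Or.inl ⟨_, p.snd_mem_support_of_mem_edges (bridge_mem_edges p hz hzx hzy), h2, hwy, rfl⟩
  · refine Or.inr ⟨_, bridge_mem_edges p h1 h2 fun h => hy ((bridge_mem_R h1).mpr h), rfl⟩

theorem mem_elems_of_mem_R' {x y : V} (p : G.Walk x y) {f : V ⊕ Sym2 V} (hy : f ∈ ρ.R y)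
    (hx : f ∉ ρ.R x) (hne : f ≠ Sum.inl x) : f ∈ elems p := by
  rw [← elems_reverse]
  exact mem_elems_of_mem_R p.reverse hy hx hne

theorem R_subset_elems {x y : V} (p : G.Walk x y) (h : ρ.idx x ≠ ρ.idx y) :
    ρ.R x ⊆ elems p := fun f hf =>
  mem_elems_of_mem_R p hf (fun h' => h (idx_eq_of_mem hf h')) (by
    rintro rfl
    exact h (inl_mem_R.mp hf).1.idx.symm)

theorem R_subset_elems' {x y : V} (p : G.Walk x y) (h : ρ.idx x ≠ ρ.idx y) :
    ρ.R y ⊆ elems p := by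
  rw [← elems_reverse]
  exact R_subset_elems p.reverse h.symm

/-- Edges `k` and `l` lie on different arcs between the two roots. Removing both separates the
graph, the side of `x` being the trees with indices from `l + 1` up to `k`; the walk must cross
over. -/
theorem cyc_mem_elems_or {x y : V} (p : G.Walk x y) {k l : Fin 4}
    (hk : k - ρ.idx x < ρ.idx y - ρ.idx x) (hl : l - ρ.idx y < ρ.idx x - ρ.idx y) :
    s(u k, u (k + 1)) ∈ p.edges ∨ s(u l, u (l + 1)) ∈ p.edges := by
  have h1 : ρ.idx x - (l + 1) ≤ k - (l + 1) := by
    revert hk hl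
    generalize ρ.idx x = i
    generalize ρ.idx y = j
    clear * -
    revert i j k l
    decide
  have h2 : ¬ ρ.idx y - (l + 1) ≤ k - (l + 1) := by
    revert hk hl
    generalize ρ.idx x = i
    generalize ρ.idx y = j
    clear * -
    revert i j k l
    decide
  obtain ⟨d, hd, h3, h4⟩ := p.exists_boundary_dart {z | ρ.idx z - (l + 1) ≤ k - (l + 1)} h1 h2
  have h3 : ρ.idx d.fst - (l + 1) ≤ k - (l + 1) := h3
  have h4 : ¬ ρ.idx d.snd - (l + 1) ≤ k - (l + 1) := h4
  have he : s(d.fst, d.snd) ∈ p.edges := List.mem_map_of_mem hd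
  rcases (ρ.adj_iff _ _).mp d.adj with ⟨i, hi⟩ | ⟨-, h⟩ | ⟨-, h⟩
  · rw [hi] at he
    have : i = k ∨ i = l := by
      rcases Sym2.eq_iff.mp hi with ⟨h5, h6⟩ | ⟨h5, h6⟩
      all_goals
        rw [h5, ρ.idx_root] at h3
        rw [h6, ρ.idx_root] at h4
        revert h3 h4
        clear * -
        revert i k l
        decide
    rcases this with rfl | rfl
    · exact Or.inl he
    · exact Or.inr he
  · rw [← h, ρ.idx_par] at h4
    exact absurd h3 h4
  · rw [← h, ρ.idx_par] at h3
    exact absurd h3 h4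

theorem arc_subset_of_edges {x y : V} (p : G.Walk x y) {i j : Fin 4}
    (hij : ρ.idx x = i ∧ ρ.idx y = j ∨ ρ.idx x = j ∧ ρ.idx y = i)
    (h : ∀ k, k - i < j - i → s(u k, u (k + 1)) ∈ p.edges) :
    ∀ f ∈ arc u i j, f ∈ elems p := by
  intro f hf
  rcases mem_arcL.mp hf with ⟨k, hk, rfl⟩ | ⟨k, ⟨hk, hk'⟩, rfl⟩
  · exact Or.inr ⟨_, h k hk, rfl⟩
  · have hki : k ≠ i ∧ k ≠ j := by
      revert hk hk'
      clear * -
      revert i j k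
      decide
    refine Or.inl ⟨_, p.fst_mem_support_of_mem_edges (h k hk'), ?_, ?_, rfl⟩
    all_goals
      rintro rfl
      rw [ρ.idx_root] at hij
      rcases hij with h | h
      · simp [h.1, h.2] at hki
      · simp [h.1, h.2] at hki

/-- If an edge of one arc is missed, `cyc_mem_elems_or` pairs it with each edge of the other arc, so
that arc is traversed completely. -/
theorem arc_subset_elems_or {x y : V} (p : G.Walk x y) :
    (∀ f ∈ arc u (ρ.idx x) (ρ.idx y), f ∈ elems p) ∨
      ∀ f ∈ arc u (ρ.idx y) (ρ.idx x), f ∈ elems p := by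
  by_cases h : ∀ k, k - ρ.idx x < ρ.idx y - ρ.idx x → s(u k, u (k + 1)) ∈ p.edges
  · exact Or.inl (arc_subset_of_edges p (Or.inl ⟨rfl, rfl⟩) h)
  · push Not at h
    obtain ⟨k, hk, hk'⟩ := h
    exact Or.inr (arc_subset_of_edges p (Or.inr ⟨rfl, rfl⟩)
      fun l hl => (cyc_mem_elems_or p hk hl).resolve_left hk')

theorem notMem_R_of_mem_arc {x : V} {i j : Fin 4} {f : V ⊕ Sym2 V} (hf : f ∈ arc u i j)
    (hx : ρ.idx x = i ∨ ρ.idx x = j) : f ∉ ρ.R x := by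
  rcases mem_arcL.mp hf with ⟨k, hk, rfl⟩ | ⟨k, ⟨hk, hk'⟩, rfl⟩
  · exact cyc_notMem_R
  · intro h
    have := (inl_mem_R.mp h).1.idx
    rw [ρ.idx_root] at this
    rw [← this] at hx
    revert hx hk hk'
    clear * -
    revert i j k
    decide

/-- The colors in `l` are pairwise distinct and do not occur in `P` and `Q`. -/
def _root_.TRC.Avoids {C : Type*} (P Q : Set C) (l : List C) : Prop :=
  l.Nodup ∧ ∀ a ∈ l, a ∉ P ∧ a ∉ Q

/-- Root paths consist of elements of `Forced`, where `c` is injective already. Only collisions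
within the arc, or between the arc and the root paths, have to be excluded. -/
theorem injOn_arc_iff {C : Type*} {c : V ⊕ Sym2 V → C} (hc : Set.InjOn c ρ.Forced) {x y : V}
    {i j : Fin 4} (hij : ρ.idx x = i ∧ ρ.idx y = j ∨ ρ.idx x = j ∧ ρ.idx y = i) :
    Set.InjOn c (ρ.R x ∪ ρ.R y ∪ {f | f ∈ arc u i j}) ↔
      Avoids (c '' ρ.R x) (c '' ρ.R y) (arcL (fun k => c (Sum.inl (u k))) (fun k => c (cyc u k)) i j)
      := by
  have hx : ρ.idx x = i ∨ ρ.idx x = j := hij.imp And.left And.left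
  have hy : ρ.idx y = i ∨ ρ.idx y = j := hij.symm.imp And.right And.right
  rw [← arcL_map]
  change _ ↔ Avoids _ _ ((arc u i j).map c)
  rw [Avoids, List.nodup_map_iff_inj_on (arc_nodup ρ.inj i j)]
  constructor
  · intro h
    refine ⟨fun a ha b hb hab => h (Or.inr ha) (Or.inr hb) hab, fun a ha => ?_⟩
    obtain ⟨f, hf, rfl⟩ := List.mem_map.mp ha
    constructor
    · rintro ⟨g, hg, hgf⟩
      have := h (Or.inl (Or.inl hg)) (Or.inr hf) hgf
      exact notMem_R_of_mem_arc hf hx (this ▸ hg)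
    · rintro ⟨g, hg, hgf⟩
      have := h (Or.inl (Or.inr hg)) (Or.inr hf) hgf
      exact notMem_R_of_mem_arc hf hy (this ▸ hg)
  · rintro ⟨h1, h2⟩
    have hF : ρ.R x ∪ ρ.R y ⊆ ρ.Forced :=
      Set.union_subset (ρ.R_subset_Forced x) (ρ.R_subset_Forced y)
    have hcross : ∀ f ∈ ρ.R x ∪ ρ.R y, ∀ g ∈ arc u i j, c f ≠ c g := by
      rintro f (hf | hf) g hg hfg
      · exact (h2 _ (List.mem_map_of_mem hg)).1 ⟨f, hf, hfg⟩
      · exact (h2 _ (List.mem_map_of_mem hg)).2 ⟨f, hf, hfg⟩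
    rintro f (hf | hf) g (hg | hg) hfg
    · exact hc (hF hf) (hF hg) hfg
    · exact absurd hfg (hcross f hf g hg)
    · exact absurd hfg.symm (hcross g hg f hf)
    · exact h1 f hf g hg hfg

variable (ρ) in
theorem idx_root_succ_ne (x : V) : ρ.idx x ≠ ρ.idx (u (ρ.idx x + 1)) := by
  rw [ρ.idx_root]
  simp

/-- A total-rainbow connecting coloring is injective on the bridges and cut vertices, and for any two
vertices of different trees one of the two arcs avoids the colors of their root paths. -/
theorem exists_of_hasTRCColoring [Fintype V] {k : ℕ} (h : HasTRCColoring G k) :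
    ∃ c : V ⊕ Sym2 V → Fin k, Set.InjOn c ρ.Forced ∧ ∀ x y, ρ.idx x ≠ ρ.idx y →
      Avoids (c '' ρ.R x) (c '' ρ.R y)
        (arcL (fun k => c (Sum.inl (u k))) (fun k => c (cyc u k)) (ρ.idx x) (ρ.idx y)) ∨
      Avoids (c '' ρ.R x) (c '' ρ.R y)
        (arcL (fun k => c (Sum.inl (u k))) (fun k => c (cyc u k)) (ρ.idx y) (ρ.idx x)) := by
  obtain ⟨cV, cE, hp⟩ := h
  set c : V ⊕ Sym2 V → Fin k := Sum.elim cV cE with hcdef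
  have hpath : ∀ x y, x ≠ y → ∃ p : G.Walk x y, Set.InjOn c (elems p) := fun x y hxy => by
    obtain ⟨p, hp⟩ := hp x y hxy
    exact ⟨p, (isTotalRainbowPath_iff (c := c).mp hp).2⟩
  have hpath' : ∀ x y, ρ.idx x ≠ ρ.idx y → ∃ p : G.Walk x y, Set.InjOn c (elems p) :=
    fun x y hxy => hpath x y fun h => hxy (h ▸ rfl)
  have hc : Set.InjOn c ρ.Forced := by
    have hR : ∀ x, Set.InjOn c (ρ.R x) := fun x => by
      obtain ⟨p, hp⟩ := hpath' x _ (ρ.idx_root_succ_ne x)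
      exact hp.mono (R_subset_elems p (ρ.idx_root_succ_ne x))
    intro f hf g hg hfg
    -- Childless vertices are chosen because they are never cut vertices: neither `f` nor `g` can
    -- then be an end of the path from `x` to `y`, and both are inner elements of it.
    obtain ⟨x, hx, hfx⟩ := exists_end_of_mem_Forced hf
    obtain ⟨y, hy, hgy⟩ := exists_end_of_mem_Forced hg
    by_cases hfy : f ∈ ρ.R y
    · exact hR y hfy hgy hfg
    by_cases hgx : g ∈ ρ.R x
    · exact hR x hfx hgx hfg
    obtain ⟨p, hp⟩ := hpath x y (by rintro rfl; exact hfy hfx)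
    have hne : ∀ {z z' f}, ρ.IsEnd z → f ∈ ρ.R z' → f ≠ Sum.inl z := by
      rintro z z' _ hz hf rfl
      obtain ⟨h1, h2⟩ := inl_mem_R.mp hf
      exact h2 (hz.eq_of_anc h1)
    exact hp (mem_elems_of_mem_R p hfx hfy (hne hy hfx))
      (mem_elems_of_mem_R' p hgy hgx (hne hx hgy)) hfg
  refine ⟨c, hc, fun x y hxy => ?_⟩
  obtain ⟨p, hp⟩ := hpath' x y hxy
  rw [← injOn_arc_iff hc (Or.inl ⟨rfl, rfl⟩), ← injOn_arc_iff hc (Or.inr ⟨rfl, rfl⟩)]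
  have hR := Set.union_subset (R_subset_elems p hxy) (R_subset_elems' p hxy)
  rcases arc_subset_elems_or (ρ := ρ) p with h | h
  · exact Or.inl (hp.mono (Set.union_subset hR h))
  · exact Or.inr (hp.mono (Set.union_subset hR h))

/-! ### From colors on the arcs back to total-rainbow paths. -/

theorem exists_arc_walk (ρ : Rooting G u) {i j : Fin 4} (hij : i ≠ j) : ∃ p : G.Walk (u i) (u j),
    (∀ w ∈ p.support, ∃ k, k - i ≤ j - i ∧ w = u k) ∧
    ∀ e ∈ p.edges, ∃ k, k - i < j - i ∧ e = s(u k, u (k + 1)) := by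
  have h0 : ∀ k, G.Adj (u k) (u (k + 1)) := adj_root ρ
  have h : j = i + 1 ∨ j = i + 1 + 1 ∨ j = i + 1 + 1 + 1 := by
    revert hij
    clear * -
    revert i j
    decide
  rcases h with rfl | rfl | rfl
  · refine ⟨.cons (h0 _) .nil, ?_, ?_⟩
    · simp only [Walk.support_cons, Walk.support_nil, List.mem_cons, List.not_mem_nil, or_false]
      rintro w (rfl | rfl)
      all_goals refine ⟨_, ?_, rfl⟩; clear * -; revert i; decide
    · simp only [Walk.edges_cons, Walk.edges_nil, List.mem_cons, List.not_mem_nil, or_false]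
      rintro w rfl
      all_goals refine ⟨_, ?_, rfl⟩; clear * -; revert i; decide
  · refine ⟨.cons (h0 _) (.cons (h0 _) .nil), ?_, ?_⟩
    · simp only [Walk.support_cons, Walk.support_nil, List.mem_cons, List.not_mem_nil, or_false]
      rintro w (rfl | rfl | rfl)
      all_goals refine ⟨_, ?_, rfl⟩; clear * -; revert i; decide
    · simp only [Walk.edges_cons, Walk.edges_nil, List.mem_cons, List.not_mem_nil, or_false]
      rintro w (rfl | rfl)
      all_goals refine ⟨_, ?_, rfl⟩; clear * -; revert i; decide
  · refine ⟨.cons (h0 _) (.cons (h0 _) (.cons (h0 _) .nil)), ?_, ?_⟩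
    · simp only [Walk.support_cons, Walk.support_nil, List.mem_cons, List.not_mem_nil, or_false]
      rintro w (rfl | rfl | rfl | rfl)
      all_goals refine ⟨_, ?_, rfl⟩; clear * -; revert i; decide
    · simp only [Walk.edges_cons, Walk.edges_nil, List.mem_cons, List.not_mem_nil, or_false]
      rintro w (rfl | rfl | rfl)
      all_goals refine ⟨_, ?_, rfl⟩; clear * -; revert i; decide

theorem elems_bypass [DecidableEq V] {x y : V} (p : G.Walk x y) : elems p.bypass ⊆ elems p := by
  rintro f (⟨w, h1, h2⟩ | ⟨e, h1, h2⟩)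
  · exact Or.inl ⟨w, p.support_bypass_subset_support h1, h2⟩
  · exact Or.inr ⟨e, p.edges_bypass_subset_edges h1, h2⟩

/-- Joining two vertices through a walk between their roots. -/
theorem exists_path_of_walk {x y : V} (q : G.Walk (u (ρ.idx x)) (u (ρ.idx y)))
    (S : Set (V ⊕ Sym2 V)) (hS : ∀ w ∈ q.support, w ≠ u (ρ.idx x) → w ≠ u (ρ.idx y) →
      Sum.inl w ∈ S) (hE : ∀ e ∈ q.edges, Sum.inr e ∈ S) :
    ∃ p : G.Walk x y, p.IsPath ∧ elems p ⊆ ρ.R x ∪ ρ.R y ∪ S := by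
  classical
  obtain ⟨a, ha1, ha2⟩ := ρ.exists_climb x
  obtain ⟨b, hb1, hb2⟩ := ρ.exists_climb y
  refine ⟨((a.mapLe (offCycle_le G u)).reverse.append (q.append (b.mapLe (offCycle_le G u)))).bypass,
    Walk.bypass_isPath _, (elems_bypass _).trans ?_⟩
  rintro f (⟨w, h1, hx, hy, rfl⟩ | ⟨e, h1, rfl⟩)
  · simp only [Walk.mem_support_append_iff, Walk.support_reverse, List.mem_reverse,
      Walk.support_mapLe_eq_support] at h1
    rcases h1 with h1 | h1 | h1
    · exact Or.inl (Or.inl (inl_mem_R.mpr ⟨ha1 w h1, hx⟩))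
    · by_cases h3 : w = u (ρ.idx x)
      · subst h3
        exact Or.inl (Or.inl (inl_mem_R.mpr ⟨root_anc x, hx⟩))
      by_cases h4 : w = u (ρ.idx y)
      · subst h4
        exact Or.inl (Or.inr (inl_mem_R.mpr ⟨root_anc y, hy⟩))
      exact Or.inr (hS w h1 h3 h4)
    · exact Or.inl (Or.inr (inl_mem_R.mpr ⟨hb1 w h1, hy⟩))
  · simp only [Walk.edges_append, Walk.edges_reverse, List.mem_append, List.mem_reverse,
      Walk.edges_mapLe_eq_edges] at h1
    rcases h1 with h1 | h1 | h1
    · obtain ⟨w, hw, h2, rfl⟩ := ha2 e h1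
      exact Or.inl (Or.inl ((bridge_mem_R hw).mpr h2))
    · exact Or.inr (hE e h1)
    · obtain ⟨w, hw, h2, rfl⟩ := hb2 e h1
      exact Or.inl (Or.inr ((bridge_mem_R hw).mpr h2))

theorem exists_path_through_arc {x y : V} {i j : Fin 4} (hne : ρ.idx x ≠ ρ.idx y)
    (hij : ρ.idx x = i ∧ ρ.idx y = j ∨ ρ.idx x = j ∧ ρ.idx y = i) :
    ∃ p : G.Walk x y, p.IsPath ∧ elems p ⊆ ρ.R x ∪ ρ.R y ∪ {f | f ∈ arc u i j} := by
  have hs : ∀ k, k - i ≤ j - i → u k ≠ u i → u k ≠ u j →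
      (Sum.inl (u k) : V ⊕ Sym2 V) ∈ arc u i j := by
    intro k h1 h2 h3
    refine mem_arcL.mpr (Or.inr ⟨k, ?_, rfl⟩)
    have h2 : k ≠ i := fun h => h2 (h ▸ rfl)
    have h3 : k ≠ j := fun h => h3 (h ▸ rfl)
    revert h1 h2 h3
    clear * -
    revert i j k
    decide
  rcases hij with ⟨rfl, rfl⟩ | ⟨rfl, rfl⟩
  · obtain ⟨q, h1, h2⟩ := ρ.exists_arc_walk hne
    refine exists_path_of_walk q _ ?_ ?_
    · intro w hw h3 h4
      obtain ⟨k, hk, rfl⟩ := h1 w hw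
      exact hs k hk h3 h4
    · intro e he
      obtain ⟨k, hk, rfl⟩ := h2 e he
      exact mem_arcL.mpr (Or.inl ⟨k, hk, rfl⟩)
  · obtain ⟨q, h1, h2⟩ := ρ.exists_arc_walk hne.symm
    refine exists_path_of_walk q.reverse _ ?_ ?_
    · intro w hw h3 h4
      rw [Walk.support_reverse, List.mem_reverse] at hw
      obtain ⟨k, hk, rfl⟩ := h1 w hw
      exact hs k hk h4 h3
    · intro e he
      rw [Walk.edges_reverse, List.mem_reverse] at he
      obtain ⟨k, hk, rfl⟩ := h2 e he
      exact mem_arcL.mpr (Or.inl ⟨k, hk, rfl⟩)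

theorem exists_path_same {x y : V} (h : ρ.idx x = ρ.idx y) :
    ∃ p : G.Walk x y, p.IsPath ∧ elems p ⊆ ρ.Forced := by
  obtain ⟨p, hp, hs⟩ := exists_path_of_walk (ρ := ρ) (x := x) (y := y)
    ((Walk.nil : G.Walk (u (ρ.idx x)) _).copy rfl (by rw [h])) ∅ (by
      simp only [Walk.support_copy, Walk.support_nil, List.mem_singleton]
      exact fun w hw h1 => absurd hw h1) (by simp)
  refine ⟨p, hp, hs.trans ?_⟩
  rw [Set.union_empty]
  exact Set.union_subset (ρ.R_subset_Forced x) (ρ.R_subset_Forced y)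

/-- A criterion for a coloring to be total-rainbow connecting. -/
theorem hasTRCColoring_of_injOn [Fintype V] (c : V ⊕ Sym2 V → V ⊕ Sym2 V)
    (T : Finset (V ⊕ Sym2 V)) (hT : ∀ f, c f ∈ T) (hc : Set.InjOn c ρ.Forced)
    (h : ∀ x y, ρ.IsEnd x → ρ.IsEnd y → ρ.idx x < ρ.idx y →
      Set.InjOn c (ρ.R x ∪ ρ.R y ∪ {f | f ∈ arc u (ρ.idx x) (ρ.idx y)}) ∨
      Set.InjOn c (ρ.R x ∪ ρ.R y ∪ {f | f ∈ arc u (ρ.idx y) (ρ.idx x)})) :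
    HasTRCColoring G T.card := by
  have h' : ∀ x y, ρ.idx x ≠ ρ.idx y →
      Set.InjOn c (ρ.R x ∪ ρ.R y ∪ {f | f ∈ arc u (ρ.idx x) (ρ.idx y)}) ∨
      Set.InjOn c (ρ.R x ∪ ρ.R y ∪ {f | f ∈ arc u (ρ.idx y) (ρ.idx x)}) := by
    intro x y hxy
    obtain ⟨x', hx', hxx'⟩ := ρ.exists_end x
    obtain ⟨y', hy', hyy'⟩ := ρ.exists_end y
    -- Descending to a childless vertex only enlarges the root path, so the hypothesis on such pairs
    -- covers all pairs.
    have hm : ∀ S, ρ.R x ∪ ρ.R y ∪ S ⊆ ρ.R x' ∪ ρ.R y' ∪ S := fun S =>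
      Set.union_subset_union_left _ (Set.union_subset_union hxx'.R_subset hyy'.R_subset)
    have hm' : ∀ S, ρ.R x ∪ ρ.R y ∪ S ⊆ ρ.R y' ∪ ρ.R x' ∪ S := fun S => by
      rw [Set.union_comm (ρ.R y')]
      exact hm S
    rw [hxx'.idx, hyy'.idx] at hxy ⊢
    rcases lt_or_gt_of_ne hxy with hlt | hlt
    · exact (h x' y' hx' hy' hlt).imp (fun h => h.mono (hm _)) fun h => h.mono (hm _)
    · exact ((h y' x' hy' hx' hlt).imp (fun h => h.mono (hm' _)) fun h => h.mono (hm' _)).symm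
  let d : V ⊕ Sym2 V → Fin T.card := fun f => T.equivFin ⟨c f, hT f⟩
  have hd : ∀ {S}, Set.InjOn c S → Set.InjOn d S := fun hS f hf g hg hfg =>
    hS hf hg (congrArg Subtype.val (T.equivFin.injective hfg))
  refine ⟨fun w => d (Sum.inl w), fun e => d (Sum.inr e), fun x y _ => ?_⟩
  suffices ∃ p : G.Walk x y, p.IsPath ∧ Set.InjOn d (elems p) by
    obtain ⟨p, hp⟩ := this
    exact ⟨p, isTotalRainbowPath_iff.mpr hp⟩
  by_cases hxy : ρ.idx x = ρ.idx y
  · obtain ⟨p, hp, hs⟩ := exists_path_same hxy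
    exact ⟨p, hp, (hd hc).mono hs⟩
  · rcases h' x y hxy with h | h
    · obtain ⟨p, hp, hs⟩ := exists_path_through_arc hxy (Or.inl ⟨rfl, rfl⟩)
      exact ⟨p, hp, (hd h).mono hs⟩
    · obtain ⟨p, hp, hs⟩ := exists_path_through_arc hxy (Or.inr ⟨rfl, rfl⟩)
      exact ⟨p, hp, (hd h).mono hs⟩

/-- Extending the coloring of the bridges and cut vertices to the cycle. The colors are the bridges
and cut vertices and the elements of `N`; `γ` and `δ` are the colors of the vertices and edges of the
cycle. -/
theorem hasTRCColoring_of_cycle [Fintype V] (ρ : Rooting G u) (γ δ : Fin 4 → V ⊕ Sym2 V)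
    (N : Finset (V ⊕ Sym2 V))
    (hγ : ∀ k, γ k ∈ ρ.Forced ∨ γ k ∈ N) (hδ : ∀ k, δ k ∈ ρ.Forced ∨ δ k ∈ N)
    (hγu : ∀ k, ¬ ρ.IsEnd (u k) → γ k = Sum.inl (u k))
    (h : ∀ x y, ρ.IsEnd x → ρ.IsEnd y → ρ.idx x < ρ.idx y →
      Avoids (ρ.R x) (ρ.R y) (arcL γ δ (ρ.idx x) (ρ.idx y)) ∨
      Avoids (ρ.R x) (ρ.R y) (arcL γ δ (ρ.idx y) (ρ.idx x))) :
    HasTRCColoring G (ρ.Forced.ncard + N.card) := by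
  classical
  -- Forced elements are their own colors. The last value `δ 0` goes to leaves and non-edges, whose
  -- colors do not matter.
  let c : V ⊕ Sym2 V → V ⊕ Sym2 V := fun f =>
    if f ∈ ρ.Forced then f else if h : ∃ k, cyc u k = f then δ h.choose else
    if h : ∃ k, Sum.inl (u k) = f then γ h.choose else δ 0
  have hcF : ∀ f ∈ ρ.Forced, c f = f := fun f hf => by simp only [c, if_pos hf]
  have hcδ : ∀ k, c (cyc u k) = δ k := fun k => by
    have hex : ∃ l, cyc u l = cyc u k := ⟨k, rfl⟩
    simp only [c, if_neg cyc_notMem_Forced, dif_pos hex]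
    rw [cyc_injective ρ.inj hex.choose_spec]
  have hcγ : ∀ k, c (Sum.inl (u k)) = γ k := fun k => by
    by_cases hk : ρ.IsEnd (u k)
    · have h1 : Sum.inl (u k) ∉ ρ.Forced := by
        rintro ⟨x, hx⟩
        obtain ⟨h2, h3⟩ := inl_mem_R.mp hx
        exact h3 (hk.eq_of_anc h2)
      have h2 : ¬ ∃ l, cyc u l = Sum.inl (u k) := by simp [cyc]
      have hex : ∃ l, (Sum.inl (u l) : V ⊕ Sym2 V) = Sum.inl (u k) := ⟨k, rfl⟩
      simp only [c, if_neg h1, dif_neg h2, dif_pos hex]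
      rw [ρ.inj (Sum.inl_injective hex.choose_spec)]
    · rw [hγu k hk]
      refine hcF _ ?_
      rw [forced_eq]
      exact Or.inl ⟨_, hk, rfl⟩
  have hcard : ((Set.toFinite ρ.Forced).toFinset ∪ N).card ≤ ρ.Forced.ncard + N.card := by
    rw [Set.ncard_eq_toFinset_card ρ.Forced]
    exact Finset.card_union_le _ _
  have hc : Set.InjOn c ρ.Forced := fun f hf g hg hfg => by
    rwa [hcF f hf, hcF g hg] at hfg
  have himg : ∀ x, c '' ρ.R x = ρ.R x := fun x =>
    (Set.image_congr fun f hf => hcF f ⟨x, hf⟩).trans (Set.image_id' _)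
  have hcol : HasTRCColoring G ((Set.toFinite ρ.Forced).toFinset ∪ N).card := by
    refine hasTRCColoring_of_injOn (ρ := ρ) c _ ?_ hc ?_
    · intro f
      simp only [Finset.mem_union, Set.Finite.mem_toFinset, c]
      split_ifs with h1 h2 h3
      · exact Or.inl h1
      · exact hδ _
      · exact hγ _
      · exact hδ _
    · intro x y hx hy hxy
      rw [injOn_arc_iff hc (Or.inl ⟨rfl, rfl⟩), injOn_arc_iff hc (Or.inr ⟨rfl, rfl⟩)]
      simp only [hcδ, hcγ, himg]
      exact h x y hx hy hxy
  obtain ⟨cV, cE, hp⟩ := hcol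
  refine ⟨fun w => Fin.castLE hcard (cV w), fun e => Fin.castLE hcard (cE e), fun x y hxy => ?_⟩
  obtain ⟨p, hp, hnd⟩ := hp x y hxy
  refine ⟨p, hp, ?_⟩
  have := hnd.map (Fin.castLE_injective hcard)
  rw [List.map_append, List.map_map, List.map_map] at this
  exact this

end Rooting
end TRC

/-! ### Explicit arcs and counting of colors. -/

namespace TRC

variable {V : Type*}

section arcs

variable {C : Type*} (γ δ : Fin 4 → C)

/-- In these lists edges precede vertices and each kind is ordered by index, not along the arc;
hence the order in `arcL_three_one`. -/
theorem arcL_zero_one : arcL γ δ 0 1 = [δ 0] := rfl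
theorem arcL_three_zero : arcL γ δ 3 0 = [δ 3] := rfl
theorem arcL_zero_two : arcL γ δ 0 2 = [δ 0, δ 1, γ 1] := rfl
theorem arcL_one_three : arcL γ δ 1 3 = [δ 1, δ 2, γ 2] := rfl
theorem arcL_two_zero : arcL γ δ 2 0 = [δ 2, δ 3, γ 3] := rfl
theorem arcL_three_one : arcL γ δ 3 1 = [δ 0, δ 3, γ 0] := rfl
theorem arcL_zero_three : arcL γ δ 0 3 = [δ 0, δ 1, δ 2, γ 1, γ 2] := rfl
theorem arcL_one_zero : arcL γ δ 1 0 = [δ 1, δ 2, δ 3, γ 2, γ 3] := rfl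

theorem avoids_singleton {P Q : Set C} {a : C} : Avoids P Q [a] ↔ a ∉ P ∧ a ∉ Q := by
  simp [Avoids]

theorem avoids_triple {P Q : Set C} {a b c : C} : Avoids P Q [a, b, c] ↔
    (a ≠ b ∧ a ≠ c ∧ b ≠ c) ∧ (a ∉ P ∧ a ∉ Q) ∧ (b ∉ P ∧ b ∉ Q) ∧ c ∉ P ∧ c ∉ Q := by
  simp [Avoids, and_assoc]

theorem Avoids.all {P Q : Set C} {a b c d e : C} (h : Avoids P Q [a, b, c, d, e]) :
    (a ∉ P ∧ a ∉ Q) ∧ (b ∉ P ∧ b ∉ Q) ∧ (c ∉ P ∧ c ∉ Q) ∧ (d ∉ P ∧ d ∉ Q) ∧ e ∉ P ∧ e ∉ Q := by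
  simpa using h.2

end arcs

/-- Three distinct colors outside `P ∪ Q` are `p`, `q` and the only new color. -/
theorem Avoids.mem_and_mem {C : Type*} {p q : C} {P Q F : Set C} {l : List C}
    (hF : ∀ x y, x ∉ F → y ∉ F → x = y) (hc : ∀ a ∈ F, a = p ∨ a = q ∨ a ∈ P ∨ a ∈ Q)
    (hl : Avoids P Q l) (h3 : l.length = 3) : p ∈ l ∧ q ∈ l := by
  obtain ⟨a, b, d, rfl⟩ := List.length_eq_three.mp h3
  rw [avoids_triple] at hl
  have key : ∀ e, e ∉ P ∧ e ∉ Q → e = p ∨ e = q ∨ e ∉ F := fun e he => by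
    by_cases h : e ∈ F
    · exact (hc e h).imp_right (Or.imp_right fun h => (h.elim he.1 he.2).elim)
    · exact Or.inr (Or.inr h)
  have h1 := hF a b
  have h2 := hF a d
  have h3 := hF b d
  obtain ⟨⟨hab, had, hbd⟩, ha, hb, hd⟩ := hl
  have ha := key a ha
  have hb := key b hb
  have hd := key d hd
  clear key hc hF
  simp only [List.mem_cons, List.not_mem_nil, or_false]
  rcases ha with rfl | rfl | ha <;> rcases hb with rfl | rfl | hb <;>
    rcases hd with rfl | rfl | hd <;> simp_all

theorem card_add_length_le {E : Type*} [Finite E] {k : ℕ} {c : E → Fin k} {F : Set E}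
    (hc : Set.InjOn c F) (l : List (Fin k)) (hl : l.Nodup) (h : ∀ a ∈ l, a ∉ c '' F) :
    F.ncard + l.length ≤ k := by
  rw [← hc.ncard_image, ← List.toFinset_card_of_nodup hl, ← Set.ncard_coe_finset,
    ← Set.ncard_union_eq]
  · exact (Set.ncard_le_card _).trans (by simp)
  · rw [Set.disjoint_right]
    intro a ha
    exact h a (by simpa using ha)

theorem mem_image_of_lt {E : Type*} [Finite E] {k : ℕ} {c : E → Fin k} {F : Set E}
    (hc : Set.InjOn c F) (h : k < F.ncard + 1) (a : Fin k) : a ∈ c '' F := by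
  by_contra ha
  have := card_add_length_le hc [a] (by simp) (by simpa using ha)
  simp at this
  omega

theorem eq_of_notMem_image {E : Type*} [Finite E] {k : ℕ} {c : E → Fin k} {F : Set E}
    (hc : Set.InjOn c F) (h : k < F.ncard + 2) {a b : Fin k} (ha : a ∉ c '' F)
    (hb : b ∉ c '' F) : a = b := by
  by_contra hab
  have := card_add_length_le hc [a, b] (by simpa using hab) (by
    intro x hx
    simp only [List.mem_cons, List.not_mem_nil, or_false] at hx
    rcases hx with rfl | rfl <;> assumption)
  simp at this
  omega

namespace Rooting

variable {G : SimpleGraph V} {u : Fin 4 → V}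

theorem notMem_image_R {ρ : Rooting G u} {k : ℕ} {c : V ⊕ Sym2 V → Fin k}
    (hc : Set.InjOn c ρ.Forced) {x y : V} (h : ρ.idx x ≠ ρ.idx y) {a : Fin k}
    (ha : a ∈ c '' ρ.R x) : a ∉ c '' ρ.R y := by
  rintro ⟨g, hg, hga⟩
  obtain ⟨f, hf, rfl⟩ := ha
  have := hc ⟨y, hg⟩ ⟨x, hf⟩ hga
  subst this
  exact h (idx_eq_of_mem hf hg)

section roots

variable (ρ : Rooting G u)

theorem inl_root_mem_R {i : Fin 4} {x : V} (h : Sum.inl (u i) ∈ ρ.R x) : ρ.idx x = i := by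
  rw [← (inl_mem_R.mp h).1.idx, ρ.idx_root]

theorem exists_root_mem_R {i : Fin 4} (h : ¬ ρ.IsEnd (u i)) :
    ∃ x, ρ.idx x = i ∧ Sum.inl (u i) ∈ ρ.R x := by
  simp only [IsEnd] at h
  push Not at h
  obtain ⟨w, hw, h⟩ := h
  refine ⟨w, by rw [← ρ.idx_par, h, ρ.idx_root], inl_mem_R.mpr ⟨h ▸ ρ.anc_par w, ?_⟩⟩
  rintro rfl
  exact hw ⟨i, rfl⟩

theorem root_mem_forced {i : Fin 4} (h : ¬ ρ.IsEnd (u i)) : Sum.inl (u i) ∈ ρ.Forced := by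
  obtain ⟨x, -, hx⟩ := exists_root_mem_R ρ h
  exact ⟨x, hx⟩

theorem lt_cases {i j : Fin 4} (h : i < j) : (i = 0 ∧ j = 1) ∨ (i = 0 ∧ j = 2) ∨ (i = 0 ∧ j = 3) ∨
    (i = 1 ∧ j = 2) ∨ (i = 1 ∧ j = 3) ∨ (i = 2 ∧ j = 3) := by
  revert i j
  decide

theorem R_eq_empty {x : V} {i : Fin 4} (h : ρ.IsEnd (u i)) (hx : ρ.idx x = i) : ρ.R x = ∅ := by
  rw [isEnd_root_iff.mp h x hx, R_root]

end roots

/-! ### Lower bounds for the number of new colors. -/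

section lower

variable [Fintype V] (ρ : Rooting G u) {k : ℕ}

/-- Both arcs between opposite roots have three elements. When the two root paths exhaust `Forced`,
the three distinct colors on the chosen arc are all new. -/
theorem forced_add_three_le (h : HasTRCColoring G k) {x z : V} (hx : ρ.idx x = 0)
    (hz : ρ.idx z = 2) (hcov : ∀ f ∈ ρ.Forced, f ∈ ρ.R x ∨ f ∈ ρ.R z) :
    ρ.Forced.ncard + 3 ≤ k := by
  obtain ⟨c, hc, hp⟩ := exists_of_hasTRCColoring (ρ := ρ) h
  have key : ∀ l, Avoids (c '' ρ.R x) (c '' ρ.R z) l → l.length = 3 →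
      ρ.Forced.ncard + 3 ≤ k := by
    intro l hl hl3
    rw [← hl3]
    refine card_add_length_le hc l hl.1 ?_
    rintro _ ha ⟨f, hf, rfl⟩
    rcases hcov f hf with h | h
    · exact (hl.2 _ ha).1 ⟨f, h, rfl⟩
    · exact (hl.2 _ ha).2 ⟨f, h, rfl⟩
  have h1 := hp x z (by rw [hx, hz]; decide)
  rw [hx, hz] at h1
  rcases h1 with h1 | h1
  · exact key _ h1 rfl
  · exact key _ h1 rfl

/-- As for three new colors, except that one of the three colors on the arc may be that of the
single element `p` outside the two root paths. -/
theorem forced_add_two_le (h : HasTRCColoring G k) {x z : V} (hx : ρ.idx x = 0)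
    (hz : ρ.idx z = 2) {p : V ⊕ Sym2 V} (hcov : ∀ f ∈ ρ.Forced, f = p ∨ f ∈ ρ.R x ∨ f ∈ ρ.R z) :
    ρ.Forced.ncard + 2 ≤ k := by
  obtain ⟨c, hc, hp⟩ := exists_of_hasTRCColoring (ρ := ρ) h
  have key : ∀ l, Avoids (c '' ρ.R x) (c '' ρ.R z) l → l.length = 3 →
      ρ.Forced.ncard + 2 ≤ k := by
    intro l hl hl3
    have h1 : ρ.Forced.ncard + (l.erase (c p)).length ≤ k := by
      refine card_add_length_le hc _ (hl.1.erase _) ?_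
      rintro _ ha ⟨f, hf, rfl⟩
      rw [hl.1.mem_erase_iff] at ha
      rcases hcov f hf with h | h | h
      · exact ha.1 (by rw [h])
      · exact (hl.2 _ ha.2).1 ⟨f, h, rfl⟩
      · exact (hl.2 _ ha.2).2 ⟨f, h, rfl⟩
    have h2 : l.length - 1 ≤ (l.erase (c p)).length := List.le_length_erase
    omega
  have h1 := hp x z (by rw [hx, hz]; decide)
  rw [hx, hz] at h1
  rcases h1 with h1 | h1
  · exact key _ h1 rfl
  · exact key _ h1 rfl

/-- Three end vertices of the tree at `u 0`, each of which has just one private color. -/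
theorem forced_add_two_le_of_three (h : HasTRCColoring G k) {x₁ x₂ x₃ z : V} (hx₁ : ρ.idx x₁ = 0)
    (hx₂ : ρ.idx x₂ = 0) (hx₃ : ρ.idx x₃ = 0) (hz : ρ.idx z = 2) {p₁ p₂ p₃ : V ⊕ Sym2 V}
    (hp₁ : p₁ ∈ ρ.R x₁) (hp₂ : p₂ ∈ ρ.R x₂) (hp₃ : p₃ ∈ ρ.R x₃)
    (hcov₁ : ∀ f ∈ ρ.Forced, f = p₂ ∨ f = p₃ ∨ f ∈ ρ.R x₁ ∨ f ∈ ρ.R z)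
    (hcov₂ : ∀ f ∈ ρ.Forced, f = p₁ ∨ f = p₃ ∨ f ∈ ρ.R x₂ ∨ f ∈ ρ.R z) :
    ρ.Forced.ncard + 2 ≤ k := by
  obtain ⟨c, hc, hp⟩ := exists_of_hasTRCColoring (ρ := ρ) h
  by_contra hk
  have hnew : ∀ a b, a ∉ c '' ρ.Forced → b ∉ c '' ρ.Forced → a = b := fun a b =>
    eq_of_notMem_image hc (by omega)
  have hc₁ : ∀ a ∈ c '' ρ.Forced, a = c p₂ ∨ a = c p₃ ∨ a ∈ c '' ρ.R x₁ ∨ a ∈ c '' ρ.R z := by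
    rintro _ ⟨f, hf, rfl⟩
    rcases hcov₁ f hf with rfl | rfl | h | h
    exacts [Or.inl rfl, Or.inr (Or.inl rfl), Or.inr (Or.inr (Or.inl ⟨f, h, rfl⟩)),
      Or.inr (Or.inr (Or.inr ⟨f, h, rfl⟩))]
  have hc₂ : ∀ a ∈ c '' ρ.Forced, a = c p₁ ∨ a = c p₃ ∨ a ∈ c '' ρ.R x₂ ∨ a ∈ c '' ρ.R z := by
    rintro _ ⟨f, hf, rfl⟩
    rcases hcov₂ f hf with rfl | rfl | h | h
    exacts [Or.inl rfl, Or.inr (Or.inl rfl), Or.inr (Or.inr (Or.inl ⟨f, h, rfl⟩)),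
      Or.inr (Or.inr (Or.inr ⟨f, h, rfl⟩))]
  have hq₁ : c p₁ ∈ c '' ρ.R x₁ := ⟨_, hp₁, rfl⟩
  have hq₂ : c p₂ ∈ c '' ρ.R x₂ := ⟨_, hp₂, rfl⟩
  have hq₃ : c p₃ ∈ c '' ρ.R x₃ := ⟨_, hp₃, rfl⟩
  have h1 := hp x₁ z (by rw [hx₁, hz]; decide)
  have h2 := hp x₂ z (by rw [hx₂, hz]; decide)
  have h3 := hp x₃ z (by rw [hx₃, hz]; decide)
  rw [hx₁, hz] at h1
  rw [hx₂, hz] at h2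
  rw [hx₃, hz] at h3
  -- three distinct colors outside `R x₁ ∪ R z` are `p₂`, `p₃` and the new color
  have key₁ : ∀ {l}, Avoids (c '' ρ.R x₁) (c '' ρ.R z) l → l.length = 3 → c p₂ ∈ l ∧ c p₃ ∈ l :=
    Avoids.mem_and_mem hnew hc₁
  have key₂ : ∀ {l}, Avoids (c '' ρ.R x₂) (c '' ρ.R z) l → l.length = 3 → c p₁ ∈ l ∧ c p₃ ∈ l :=
    Avoids.mem_and_mem hnew hc₂
  -- Pigeonhole on the two arcs: the arc used by `x₁` is closed to `x₂` and `x₃`, and the arc used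
  -- by `x₂` is closed to `x₃`. No cover by the root path of `x₃` is required.
  rcases h1 with h1 | h1 <;> rcases h2 with h2 | h2
  · exact (h2.2 _ (key₁ h1 rfl).1).1 hq₂
  · rcases h3 with h3 | h3
    · exact (h3.2 _ (key₁ h1 rfl).2).1 hq₃
    · exact (h3.2 _ (key₂ h2 rfl).2).1 hq₃
  · rcases h3 with h3 | h3
    · exact (h3.2 _ (key₂ h2 rfl).2).1 hq₃
    · exact (h3.2 _ (key₁ h1 rfl).2).1 hq₃
  · exact (h2.2 _ (key₁ h1 rfl).1).1 hq₂

/-- Two opposite trees with two end vertices each, one of which has just one private color. -/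
theorem forced_add_two_le_of_two_two (h : HasTRCColoring G k) {x₁ x₂ z₁ z₂ : V}
    (hx₁ : ρ.idx x₁ = 0) (hx₂ : ρ.idx x₂ = 0) (hz₁ : ρ.idx z₁ = 2) (hz₂ : ρ.idx z₂ = 2)
    {p r : V ⊕ Sym2 V} (hp : p ∈ ρ.R x₁) (hr : r ∈ ρ.R z₁)
    (hcov : ∀ f ∈ ρ.Forced, f = p ∨ f = r ∨ f ∈ ρ.R x₂ ∨ f ∈ ρ.R z₂) :
    ρ.Forced.ncard + 2 ≤ k := by
  obtain ⟨c, hc, hpath⟩ := exists_of_hasTRCColoring (ρ := ρ) h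
  by_contra hk
  have hnew : ∀ a b, a ∉ c '' ρ.Forced → b ∉ c '' ρ.Forced → a = b := fun a b =>
    eq_of_notMem_image hc (by omega)
  have hc' : ∀ a ∈ c '' ρ.Forced, a = c p ∨ a = c r ∨ a ∈ c '' ρ.R x₂ ∨ a ∈ c '' ρ.R z₂ := by
    rintro _ ⟨f, hf, rfl⟩
    rcases hcov f hf with rfl | rfl | h | h
    exacts [Or.inl rfl, Or.inr (Or.inl rfl), Or.inr (Or.inr (Or.inl ⟨f, h, rfl⟩)),
      Or.inr (Or.inr (Or.inr ⟨f, h, rfl⟩))]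
  have hp' : c p ∈ c '' ρ.R x₁ := ⟨_, hp, rfl⟩
  have hr' : c r ∈ c '' ρ.R z₁ := ⟨_, hr, rfl⟩
  have hd : ∀ a, a ∈ c '' ρ.R x₂ → a ∉ c '' ρ.R z₂ := fun a =>
    notMem_image_R hc (by rw [hx₂, hz₂]; decide)
  have h22 := hpath x₂ z₂ (by rw [hx₂, hz₂]; decide)
  have h12 := hpath x₁ z₂ (by rw [hx₁, hz₂]; decide)
  have h21 := hpath x₂ z₁ (by rw [hx₂, hz₁]; decide)
  rw [hx₂, hz₂] at h22
  rw [hx₁, hz₂] at h12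
  rw [hx₂, hz₁] at h21
  have key₁ : ∀ {l}, Avoids (c '' ρ.R x₂) (c '' ρ.R z₂) l → l.length = 3 → c p ∈ l ∧ c r ∈ l :=
    Avoids.mem_and_mem hnew hc'
  -- An arc serving both mixed pairs would avoid all four root paths, so its three distinct colors
  -- would all be new, although at most one new color exists.
  have key₂ : ∀ {l}, Avoids (c '' ρ.R x₁) (c '' ρ.R z₂) l → Avoids (c '' ρ.R x₂) (c '' ρ.R z₁) l →
      l.length = 3 → False := by
    intro l hl hl' hl3
    obtain ⟨a, b, d, rfl⟩ := List.length_eq_three.mp hl3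
    rw [avoids_triple] at hl hl'
    have hn : ∀ e, e ∉ c '' ρ.R x₁ → e ∉ c '' ρ.R z₂ → e ∉ c '' ρ.R x₂ → e ∉ c '' ρ.R z₁ →
        e ∉ c '' ρ.Forced := by
      intro e h1 h2 h3 h4 he
      rcases hc' e he with rfl | rfl | h | h
      exacts [h1 hp', h4 hr', h3 h, h2 h]
    exact hl.1.1 (hnew a b (hn a hl.2.1.1 hl.2.1.2 hl'.2.1.1 hl'.2.1.2)
      (hn b hl.2.2.1.1 hl.2.2.1.2 hl'.2.2.1.1 hl'.2.2.1.2))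
  -- The arc for `x₂`, `z₂` carries the colors of `p` and `r`, so it is closed to both mixed pairs;
  -- these are forced onto the other arc together.
  rcases h22 with h22 | h22
  · rcases h12 with h12 | h12
    · exact (h12.2 _ (key₁ h22 rfl).1).1 hp'
    · rcases h21 with h21 | h21
      · exact (h21.2 _ (key₁ h22 rfl).2).2 hr'
      · exact key₂ h12 h21 rfl
  · rcases h12 with h12 | h12
    · rcases h21 with h21 | h21
      · exact key₂ h12 h21 rfl
      · exact (h21.2 _ (key₁ h22 rfl).2).2 hr'
    · exact (h12.2 _ (key₁ h22 rfl).1).1 hp'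

/-- Two end vertices in the tree at `u 0`, at most one in the opposite tree. -/
theorem forced_add_one_le_of_opposite (h : HasTRCColoring G k) {x x' z : V} (hx : ρ.idx x = 0)
    (hx' : ρ.idx x' = 0) (hz : ρ.idx z = 2)
    (hcov : ∀ f ∈ ρ.Forced, f ∈ ρ.R x ∨ f ∈ ρ.R x' ∨ f ∈ ρ.R z) :
    ρ.Forced.ncard + 1 ≤ k := by
  obtain ⟨c, hc, hp⟩ := exists_of_hasTRCColoring (ρ := ρ) h
  by_contra hk
  have hall : ∀ a, a ∈ c '' ρ.R x ∨ a ∈ c '' ρ.R x' ∨ a ∈ c '' ρ.R z := by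
    intro a
    obtain ⟨f, hf, rfl⟩ := mem_image_of_lt hc (by omega) a
    exact (hcov f hf).imp (fun h => ⟨f, h, rfl⟩)
      (Or.imp (fun h => ⟨f, h, rfl⟩) fun h => ⟨f, h, rfl⟩)
  have h1 := hp x z (by rw [hx, hz]; decide)
  have h2 := hp x' z (by rw [hx', hz]; decide)
  have h3 := hp x (u 3) (by rw [hx, ρ.idx_root]; decide)
  have h4 := hp x' (u 3) (by rw [hx', ρ.idx_root]; decide)
  simp only [hx, hx', hz, ρ.idx_root, arcL_zero_two, arcL_two_zero, arcL_zero_three,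
    arcL_three_zero, avoids_triple, avoids_singleton] at h1 h2 h3 h4
  have h3 := h3.imp_left Avoids.all
  have h4 := h4.imp_left Avoids.all
  have a0 := hall (c (cyc u 0))
  have a1 := hall (c (cyc u 1))
  have a2 := hall (c (cyc u 2))
  have a3 := hall (c (cyc u 3))
  clear * - h1 h2 h3 h4 a0 a1 a2 a3
  generalize c '' ρ.R x = S₁ at *
  generalize c '' ρ.R x' = S₂ at *
  generalize c '' ρ.R z = S₃ at *
  generalize c '' ρ.R (u 3) = S₄ at *
  -- Without a new color, the arc for `x`, `z` carries only colors of `R x'` and the arc for `x'`,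
  -- `z` only colors of `R x`. So the arcs differ, and edges 2 and 3 both carry colors of the same
  -- one of `x`, `x'`, which then cannot reach `u 3`.
  grind

/-- At most two end vertices in the tree at `u 0`, at most one in that at `u 1`. -/
theorem forced_add_one_le_of_adjacent (h : HasTRCColoring G k) {x x' y : V} (hx : ρ.idx x = 0)
    (hx' : ρ.idx x' = 0) (hy : ρ.idx y = 1)
    (hcov : ∀ f ∈ ρ.Forced, f ∈ ρ.R x ∨ f ∈ ρ.R x' ∨ f ∈ ρ.R y) :
    ρ.Forced.ncard + 1 ≤ k := by
  obtain ⟨c, hc, hp⟩ := exists_of_hasTRCColoring (ρ := ρ) h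
  by_contra hk
  have hall : ∀ a, a ∈ c '' ρ.R x ∨ a ∈ c '' ρ.R x' ∨ a ∈ c '' ρ.R y := by
    intro a
    obtain ⟨f, hf, rfl⟩ := mem_image_of_lt hc (by omega) a
    exact (hcov f hf).imp (fun h => ⟨f, h, rfl⟩)
      (Or.imp (fun h => ⟨f, h, rfl⟩) fun h => ⟨f, h, rfl⟩)
  have h1 := hp x y (by rw [hx, hy]; decide)
  have h2 := hp x' y (by rw [hx', hy]; decide)
  have h3 := hp x (u 3) (by rw [hx, ρ.idx_root]; decide)
  have h4 := hp x' (u 3) (by rw [hx', ρ.idx_root]; decide)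
  simp only [hx, hx', hy, ρ.idx_root, arcL_zero_one, arcL_one_zero, arcL_zero_three,
    arcL_three_zero, avoids_singleton] at h1 h2 h3 h4
  have h1 := h1.imp_right Avoids.all
  have h2 := h2.imp_right Avoids.all
  have h3 := h3.imp_left Avoids.all
  have h4 := h4.imp_left Avoids.all
  have a0 := hall (c (cyc u 0))
  have a1 := hall (c (cyc u 1))
  have a2 := hall (c (cyc u 2))
  have a3 := hall (c (cyc u 3))
  clear * - h1 h2 h3 h4 a0 a1 a2 a3
  generalize c '' ρ.R x = S₁ at *
  generalize c '' ρ.R x' = S₂ at *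
  generalize c '' ρ.R y = S₃ at *
  generalize c '' ρ.R (u 3) = S₄ at *
  -- If edge 0 has a color of `R y`, both `x` and `x'` take the long arc to `y`, and its edges are
  -- left without a color. If it has a color of `R x`, then edges 1, 2, 3 carry colors of `R x'`,
  -- and `x'` cannot reach `u 3`; symmetrically with `x` and `x'` exchanged.
  grind

/-- At most two end vertices in the tree at `u 0`, one in those at `u 1` and `u 2`. -/
theorem forced_add_one_le_of_three_trees (h : HasTRCColoring G k) {x x' y z : V}
    (hx : ρ.idx x = 0) (hx' : ρ.idx x' = 0) (hy : ρ.idx y = 1) (hz : ρ.idx z = 2)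
    (hcov : ∀ f ∈ ρ.Forced, f ∈ ρ.R x ∨ f ∈ ρ.R x' ∨ f ∈ ρ.R y ∨ f ∈ ρ.R z) :
    ρ.Forced.ncard + 1 ≤ k := by
  obtain ⟨c, hc, hp⟩ := exists_of_hasTRCColoring (ρ := ρ) h
  by_contra hk
  have hall : ∀ a, a ∈ c '' ρ.R x ∨ a ∈ c '' ρ.R x' ∨ a ∈ c '' ρ.R y ∨ a ∈ c '' ρ.R z := by
    intro a
    obtain ⟨f, hf, rfl⟩ := mem_image_of_lt hc (by omega) a
    rcases hcov f hf with h | h | h | h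
    exacts [Or.inl ⟨f, h, rfl⟩, Or.inr (Or.inl ⟨f, h, rfl⟩), Or.inr (Or.inr (Or.inl ⟨f, h, rfl⟩)),
      Or.inr (Or.inr (Or.inr ⟨f, h, rfl⟩))]
  have h1 := hp x y (by rw [hx, hy]; decide)
  have h2 := hp x' y (by rw [hx', hy]; decide)
  have h3 := hp x z (by rw [hx, hz]; decide)
  have h4 := hp x' z (by rw [hx', hz]; decide)
  have h5 := hp y (u 3) (by rw [hy, ρ.idx_root]; decide)
  simp only [hx, hx', hy, hz, ρ.idx_root, arcL_zero_one, arcL_one_zero, arcL_zero_two,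
    arcL_two_zero, arcL_one_three, arcL_three_one, avoids_singleton, avoids_triple]
    at h1 h2 h3 h4 h5
  have h1 := h1.imp_right Avoids.all
  have h2 := h2.imp_right Avoids.all
  have a0 := hall (c (cyc u 0))
  have a1 := hall (c (cyc u 1))
  have a2 := hall (c (cyc u 2))
  have a3 := hall (c (cyc u 3))
  clear * - h1 h2 h3 h4 h5 a0 a1 a2 a3
  generalize c '' ρ.R x = S₁ at *
  generalize c '' ρ.R x' = S₂ at *
  generalize c '' ρ.R y = S₃ at *
  generalize c '' ρ.R z = S₄ at *
  generalize c '' ρ.R (u 3) = S₅ at *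
  -- Comparing the pairs `x`, `y` and `x`, `z`, and likewise for `x'`, shows that edge 0 carries a
  -- color of `R z`. Then edges 2 and 3 serve both `x` and `x'` on the way to `z`, so they have
  -- colors of `R y`, and `y` cannot reach `u 3`.
  grind

/-- One end vertex in each of the four trees. -/
theorem forced_add_one_le_of_four_trees (h : HasTRCColoring G k) {x : Fin 4 → V}
    (hx : ∀ i, ρ.idx (x i) = i) (hcov : ∀ f ∈ ρ.Forced, ∃ i, f ∈ ρ.R (x i)) :
    ρ.Forced.ncard + 1 ≤ k := by
  obtain ⟨c, hc, hp⟩ := exists_of_hasTRCColoring (ρ := ρ) h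
  by_contra hk
  have hall : ∀ a, ∃ i, a ∈ c '' ρ.R (x i) := by
    intro a
    obtain ⟨f, hf, rfl⟩ := mem_image_of_lt hc (by omega) a
    exact (hcov f hf).imp fun i h => ⟨f, h, rfl⟩
  have hd : ∀ i j a, a ∈ c '' ρ.R (x i) → a ∈ c '' ρ.R (x j) → i = j := by
    intro i j a hi hj
    by_contra hne
    exact notMem_image_R hc (by rwa [hx, hx]) hi hj
  have h1 := hp (x 0) (x 2) (by rw [hx, hx]; decide)
  have h2 := hp (x 1) (x 3) (by rw [hx, hx]; decide)
  simp only [hx, arcL_zero_two, arcL_two_zero, arcL_one_three, arcL_three_one, avoids_triple]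
    at h1 h2
  have key : ∀ a, a ∉ c '' ρ.R (x 0) → a ∉ c '' ρ.R (x 2) → a ∉ c '' ρ.R (x 1) →
      a ∉ c '' ρ.R (x 3) → False := by
    intro a h0 h2 h1 h3
    obtain ⟨i, hi⟩ := hall a
    fin_cases i <;> contradiction
  -- An arc between roots 0 and 2 and an arc between roots 1 and 3 always share an edge, whose color
  -- avoids all four root paths.
  rcases h1 with h1 | h1 <;> rcases h2 with h2 | h2
  · exact key _ h1.2.2.1.1 h1.2.2.1.2 h2.2.1.1 h2.2.1.2
  · exact key _ h1.2.1.1 h1.2.1.2 h2.2.1.1 h2.2.1.2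
  · exact key _ h1.2.1.1 h1.2.1.2 h2.2.2.1.1 h2.2.2.1.2
  · exact key _ h1.2.2.1.1 h1.2.2.1.2 h2.2.2.1.1 h2.2.2.1.2

end lower

/-! ### Colorings of the cycle. -/

section upper

variable [Fintype V] (ρ : Rooting G u)

/-- The trees at `u 1` and `u 3` are trivial. -/
theorem hasTRCColoring_of_opposite (h1 : ρ.IsEnd (u 1)) (h3 : ρ.IsEnd (u 3))
    {n c₁ c₂ d₁ d₂ : V ⊕ Sym2 V} {N : Finset (V ⊕ Sym2 V)} (hn : n ∈ N) (hnF : n ∉ ρ.Forced)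
    (hF : ∀ f ∈ [c₁, c₂, d₁, d₂], (f ∈ ρ.Forced ∨ f ∈ N) ∧ f ≠ n ∧ ∀ z, ρ.idx z = 2 → f ∉ ρ.R z)
    (hc : c₁ ≠ c₂) (hd : d₁ ≠ d₂) (hcd : c₂ ≠ d₂)
    (h : ∀ x, ρ.IsEnd x → ρ.idx x = 0 → (c₁ ∉ ρ.R x ∧ c₂ ∉ ρ.R x) ∨ (d₁ ∉ ρ.R x ∧ d₂ ∉ ρ.R x)) :
    HasTRCColoring G (ρ.Forced.ncard + N.card) := by
  classical
  simp only [List.mem_cons, List.not_mem_nil, or_false, forall_eq_or_imp, forall_eq] at hF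
  obtain ⟨⟨m1, n1, r1⟩, ⟨m2, n2, r2⟩, ⟨m3, n3, r3⟩, ⟨m4, n4, r4⟩⟩ := hF
  have hnR : ∀ x, n ∉ ρ.R x := fun x hx => hnF ⟨x, hx⟩
  -- Besides `n`, the arc through `u 1` carries `c₁`, `c₂` and the arc through `u 3` carries `d₁`,
  -- `d₂`; each childless vertex over `u 0` can use one of them. The edges at `u 0` are both colored
  -- `n`. The pair `u 1`, `u 3` goes through `u 2`, which needs `c₂ ≠ d₂`.
  let γ : Fin 4 → V ⊕ Sym2 V := fun k =>
    if ρ.IsEnd (u k) then ![n, c₁, n, d₁] k else Sum.inl (u k)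
  have g1 : γ 1 = c₁ := if_pos h1
  have g3 : γ 3 = d₁ := if_pos h3
  have g2 : c₂ ≠ γ 2 ∧ d₂ ≠ γ 2 := by
    by_cases h2 : ρ.IsEnd (u 2)
    · have : γ 2 = n := if_pos h2
      rw [this]
      exact ⟨n2, n4⟩
    · have : γ 2 = Sum.inl (u 2) := if_neg h2
      rw [this]
      obtain ⟨z, hz, hz'⟩ := exists_root_mem_R ρ h2
      exact ⟨fun h => r2 z hz (h ▸ hz'), fun h => r4 z hz (h ▸ hz')⟩
  refine hasTRCColoring_of_cycle ρ γ ![n, c₂, d₂, n] N ?_ ?_ (fun k hk => if_neg hk) ?_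
  · intro k
    by_cases hk : ρ.IsEnd (u k)
    · have : γ k = ![n, c₁, n, d₁] k := if_pos hk
      rw [this]
      clear * - hn m1 m3
      fin_cases k
      exacts [Or.inr hn, m1, Or.inr hn, m3]
    · have : γ k = Sum.inl (u k) := if_neg hk
      rw [this]
      exact Or.inl (root_mem_forced ρ hk)
  · intro k
    clear * - hn m2 m4
    fin_cases k
    exacts [Or.inr hn, m2, m4, Or.inr hn]
  · intro x y hx hy hxy
    rcases lt_cases hxy with ⟨i, j⟩ | ⟨i, j⟩ | ⟨i, j⟩ | ⟨i, j⟩ | ⟨i, j⟩ | ⟨i, j⟩ <;> rw [i, j]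
    · exact Or.inl (avoids_singleton.mpr ⟨hnR x, hnR y⟩)
    · rw [arcL_zero_two, arcL_two_zero, avoids_triple, avoids_triple, g1, g3]
      rcases h x hx i with ⟨h4, h5⟩ | ⟨h4, h5⟩
      · exact Or.inl ⟨⟨n2.symm, n1.symm, hc.symm⟩, ⟨hnR x, hnR y⟩, ⟨h5, r2 y j⟩, h4, r1 y j⟩
      · exact Or.inr ⟨⟨n4, hd.symm, n3.symm⟩, ⟨h5, r4 y j⟩, ⟨hnR x, hnR y⟩, h4, r3 y j⟩
    · exact Or.inr (avoids_singleton.mpr ⟨hnR x, hnR y⟩)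
    · rw [R_eq_empty ρ h1 i]
      exact Or.inl (avoids_singleton.mpr ⟨id, r2 y j⟩)
    · rw [R_eq_empty ρ h1 i, R_eq_empty ρ h3 j, arcL_one_three, avoids_triple]
      exact Or.inl ⟨⟨hcd, g2⟩, ⟨id, id⟩, ⟨id, id⟩, id, id⟩
    · rw [R_eq_empty ρ h3 j]
      exact Or.inl (avoids_singleton.mpr ⟨r4 x i, id⟩)

/-- The trees at `u 2` and `u 3` are trivial, those at `u 0` and `u 1` are not. -/
theorem hasTRCColoring_of_adjacent (h0 : ¬ ρ.IsEnd (u 0)) (h1 : ¬ ρ.IsEnd (u 1))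
    (h2 : ρ.IsEnd (u 2)) (h3 : ρ.IsEnd (u 3)) {n p q : V ⊕ Sym2 V} (hnF : n ∉ ρ.Forced)
    (hp : p ∈ ρ.Forced) (hp' : ∀ x, ρ.idx x ≠ 0 → p ∉ ρ.R x) (hpu : p ≠ Sum.inl (u 0))
    (hq : q ∈ ρ.Forced) (hq' : ∀ x, ρ.idx x ≠ 1 → q ∉ ρ.R x) (hqu : q ≠ Sum.inl (u 1)) :
    HasTRCColoring G (ρ.Forced.ncard + 1) := by
  classical
  have hnR : ∀ x, n ∉ ρ.R x := fun x hx => hnF ⟨x, hx⟩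
  have hnf : ∀ f ∈ ρ.Forced, n ≠ f := fun f hf h => hnF (h ▸ hf)
  -- Opposite edges 0 and 2 share the new color. The arc from `u 1` to `u 3` through `u 2` is filled
  -- from the tree at `u 0`, and the arc from `u 2` to `u 0` through `u 3` from the tree at `u 1`.
  let γ : Fin 4 → V ⊕ Sym2 V := ![Sum.inl (u 0), Sum.inl (u 1), Sum.inl (u 0), Sum.inl (u 1)]
  have f0 := root_mem_forced ρ h0
  have f1 := root_mem_forced ρ h1
  have hu : ∀ {k x}, ρ.idx x ≠ k → (Sum.inl (u k) : V ⊕ Sym2 V) ∉ ρ.R x :=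
    fun hne h => hne (inl_root_mem_R ρ h)
  refine hasTRCColoring_of_cycle ρ γ ![n, p, n, q] {n} ?_ ?_ ?_ ?_
  · intro k
    clear * - f0 f1
    fin_cases k
    exacts [Or.inl f0, Or.inl f1, Or.inl f0, Or.inl f1]
  · intro k
    clear * - hp hq
    fin_cases k
    exacts [Or.inr (by simp), Or.inl hp, Or.inr (by simp), Or.inl hq]
  · intro k hk
    fin_cases k
    exacts [rfl, rfl, absurd h2 hk, absurd h3 hk]
  · intro x y hx hy hxy
    rcases lt_cases hxy with ⟨i, j⟩ | ⟨i, j⟩ | ⟨i, j⟩ | ⟨i, j⟩ | ⟨i, j⟩ | ⟨i, j⟩ <;> rw [i, j]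
    · exact Or.inl (avoids_singleton.mpr ⟨hnR x, hnR y⟩)
    · rw [arcL_two_zero, avoids_triple]
      exact Or.inr ⟨⟨hnf q hq, hnf _ f1, hqu⟩, ⟨hnR x, hnR y⟩,
        ⟨hq' x (by simp [i]), hq' y (by simp [j])⟩, hu (by simp [i]), hu (by simp [j])⟩
    · exact Or.inr (avoids_singleton.mpr ⟨hq' x (by simp [i]), hq' y (by simp [j])⟩)
    · exact Or.inl (avoids_singleton.mpr ⟨hp' x (by simp [i]), hp' y (by simp [j])⟩)
    · rw [arcL_one_three, avoids_triple]
      exact Or.inl ⟨⟨(hnf p hp).symm, hpu, hnf _ f0⟩, ⟨hp' x (by simp [i]), hp' y (by simp [j])⟩,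
        ⟨hnR x, hnR y⟩, hu (by simp [i]), hu (by simp [j])⟩
    · exact Or.inl (avoids_singleton.mpr ⟨hnR x, hnR y⟩)

/-- The trees at `u 0`, `u 1` and `u 2` are not trivial. -/
theorem hasTRCColoring_of_three_trees (h0 : ¬ ρ.IsEnd (u 0)) (h1 : ¬ ρ.IsEnd (u 1))
    (h2 : ¬ ρ.IsEnd (u 2)) {b q : V ⊕ Sym2 V} {N : Finset (V ⊕ Sym2 V)}
    (hb : b ∈ ρ.Forced ∨ b ∈ N) (hb' : ∀ x, ρ.idx x ≠ 1 → b ∉ ρ.R x)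
    (hbu : ∀ k, b ≠ Sum.inl (u k))
    (hq : q ∈ ρ.Forced) (hq' : ∀ x, ρ.idx x ≠ 1 → q ∉ ρ.R x)
    (hqu : ∀ k, q ≠ Sum.inl (u k)) (hbq : b ≠ q)
    (h : ∀ x, ρ.IsEnd x → ρ.idx x = 1 → q ∉ ρ.R x ∨ b ∉ ρ.R x) :
    HasTRCColoring G (ρ.Forced.ncard + N.card) := by
  classical
  -- Edges 0 and 1 get the colors of the roots `u 2` and `u 0`, each harmless for the pair it has to
  -- connect; edges 2 and 3 get `b` and `q`, which occur at most in the tree at `u 1`. A vertex over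
  -- `u 1` goes to the tree at `u 3` along whichever of `b`, `q` it avoids.
  let γ : Fin 4 → V ⊕ Sym2 V :=
    ![Sum.inl (u 0), Sum.inl (u 1), Sum.inl (u 2), Sum.inl (u (if ρ.IsEnd (u 3) then 1 else 3))]
  have f0 := root_mem_forced ρ h0
  have f1 := root_mem_forced ρ h1
  have f2 := root_mem_forced ρ h2
  have hu : ∀ {k x}, ρ.idx x ≠ k → (Sum.inl (u k) : V ⊕ Sym2 V) ∉ ρ.R x :=
    fun hne h => hne (inl_root_mem_R ρ h)
  have h20 : (Sum.inl (u 2) : V ⊕ Sym2 V) ≠ Sum.inl (u 0) := by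
    simp [ρ.inj.eq_iff]
  refine hasTRCColoring_of_cycle ρ γ ![Sum.inl (u 2), Sum.inl (u 0), b, q] N ?_ ?_ ?_ ?_
  · intro k
    fin_cases k
    · exact Or.inl f0
    · exact Or.inl f1
    · exact Or.inl f2
    · change Sum.inl (u (if ρ.IsEnd (u 3) then 1 else 3)) ∈ _ ∨ _
      split_ifs with h3
      · exact Or.inl f1
      · exact Or.inl (root_mem_forced ρ h3)
  · intro k
    clear * - f0 f2 hb hq
    fin_cases k
    exacts [Or.inl f2, Or.inl f0, hb, Or.inl hq]
  · intro k hk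
    fin_cases k
    · rfl
    · rfl
    · rfl
    · change Sum.inl (u (if ρ.IsEnd (u 3) then 1 else 3)) = _
      exact congrArg (fun k => Sum.inl (u k)) (if_neg hk)
  · intro x y hx hy hxy
    rcases lt_cases hxy with ⟨i, j⟩ | ⟨i, j⟩ | ⟨i, j⟩ | ⟨i, j⟩ | ⟨i, j⟩ | ⟨i, j⟩ <;> rw [i, j]
    · exact Or.inl (avoids_singleton.mpr ⟨hu (by simp [i]), hu (by simp [j])⟩)
    · rw [arcL_two_zero, avoids_triple]
      refine Or.inr ⟨⟨hbq, hbu _, hqu _⟩, ⟨hb' x (by simp [i]), hb' y (by simp [j])⟩,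
        ⟨hq' x (by simp [i]), hq' y (by simp [j])⟩, ?_, ?_⟩
      · exact hu (by rw [i]; split_ifs <;> decide)
      · exact hu (by rw [j]; split_ifs <;> decide)
    · exact Or.inr (avoids_singleton.mpr ⟨hq' x (by simp [i]), hq' y (by simp [j])⟩)
    · exact Or.inl (avoids_singleton.mpr ⟨hu (by simp [i]), hu (by simp [j])⟩)
    · rw [arcL_one_three, arcL_three_one, avoids_triple, avoids_triple]
      rcases h x hx i with h | h
      · exact Or.inr ⟨⟨(hqu 2).symm, h20, hqu 0⟩, ⟨hu (by simp [i]), hu (by simp [j])⟩,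
          ⟨h, hq' y (by simp [j])⟩, hu (by simp [i]), hu (by simp [j])⟩
      · exact Or.inl ⟨⟨(hbu 0).symm, h20.symm, hbu 2⟩, ⟨hu (by simp [i]), hu (by simp [j])⟩,
          ⟨h, hb' y (by simp [j])⟩, hu (by simp [i]), hu (by simp [j])⟩
    · exact Or.inl (avoids_singleton.mpr ⟨hb' x (by simp [i]), hb' y (by simp [j])⟩)

end upper

end Rooting
end TRC

/-! ### Leaves, root paths and the shapes of types I and II. -/

namespace TRC

variable {V : Type*}

open SimpleGraph

namespace Rooting

variable {G : SimpleGraph V} {u : Fin 4 → V} {ρ : Rooting G u}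

theorem onRootPath_iff {i : Fin 4} {x w : V} :
    OnRootPath G u i x w ↔ ρ.idx w = i ∧ ρ.Anc x w := by
  classical
  constructor
  · rintro ⟨p, hp, hx⟩
    have hw : ρ.idx w = i := mem_tree_iff.mp ⟨p⟩
    refine ⟨hw, ?_⟩
    have hxi : ρ.idx x = i := mem_tree_iff.mp ⟨p.takeUntil x hx⟩
    by_contra hxw
    have hxu : x ∉ Set.range u := by
      rintro ⟨j, rfl⟩
      rw [ρ.idx_root] at hxi
      subst hxi
      exact hxw (hw ▸ root_anc w)
    -- If `x` is not an ancestor of `w`, the path crosses the bridge of `x` once on the way to `x`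
    -- and again after it.
    have h1 := bridge_mem_edges (ρ := ρ) ((p.takeUntil x hx).mapLe (offCycle_le G u)).reverse hxu
      (ρ.anc_refl x) fun h => hxu ⟨i, (anc_root h).symm⟩
    have h2 := bridge_mem_edges (ρ := ρ) ((p.dropUntil x hx).mapLe (offCycle_le G u)) hxu
      (ρ.anc_refl x) hxw
    rw [Walk.edges_reverse, List.mem_reverse, Walk.edges_mapLe_eq_edges] at h1
    rw [Walk.edges_mapLe_eq_edges] at h2
    exact hp.isTrail.disjoint_edges_takeUntil_dropUntil hx h1 h2
  · rintro ⟨rfl, hx⟩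
    obtain ⟨p, -, -⟩ := ρ.exists_climb w
    refine ⟨p.bypass, p.bypass_isPath, ?_⟩
    by_cases hxu : x ∈ Set.range u
    · rw [anc_mem_root hx hxu]
      exact Walk.start_mem_support _
    · have h1 := bridge_mem_edges (p.bypass.mapLe (offCycle_le G u)).reverse hxu hx
        fun h => hxu ⟨_, (anc_root h).symm⟩
      rw [Walk.edges_reverse, List.mem_reverse, Walk.edges_mapLe_eq_edges] at h1
      exact Walk.fst_mem_support_of_mem_edges _ h1

theorem notMem_range_of_leaf (ρ : Rooting G u) {i : Fin 4} {x : V} (hx : x ∈ treeLeaves G u i) :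
    x ∉ Set.range u := by
  rw [mem_treeLeaves_iff (ρ := ρ)] at hx
  exact hx.2.1

theorem idx_leaf {i : Fin 4} {x : V} (hx : x ∈ treeLeaves G u i) : ρ.idx x = i :=
  (mem_treeLeaves_iff.mp hx).1

theorem bridge_mem_R_self {i : Fin 4} {x : V} (hx : x ∈ treeLeaves G u i) :
    ρ.bridge x ∈ ρ.R x :=
  (bridge_mem_R (mem_treeLeaves_iff (ρ := ρ).mp hx).2.1).mpr (ρ.anc_refl x)

theorem eq_of_bridge_mem_R {i : Fin 4} {x w : V} (hx : x ∈ treeLeaves G u i)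
    (h : ρ.bridge x ∈ ρ.R w) : x = w := by
  obtain ⟨-, h1, h2⟩ := mem_treeLeaves_iff (ρ := ρ).mp hx
  exact h2.eq_of_anc ((bridge_mem_R h1).mp h)

theorem par_ne_leaf {i : Fin 4} {x y : V} (hx : x ∈ treeLeaves G u i)
    {j : Fin 4} (hy : y ∈ treeLeaves G u j) : ρ.par x ≠ y :=
  (mem_treeLeaves_iff.mp hy).2.2 x (mem_treeLeaves_iff (ρ := ρ).mp hx).2.1

/-- The pendent edge is the only private color of a leaf whose neighbour lies on the root path of
another leaf. -/
theorem R_leaf_subset {i : Fin 4} {x y : V} (hx : x ∈ treeLeaves G u i)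
    {j : Fin 4} (hy : y ∈ treeLeaves G u j) (h : ρ.Anc (ρ.par x) y) :
    ρ.R x ⊆ insert (ρ.bridge x) (ρ.R y) :=
  R_subset_of_anc_par h (par_ne_leaf hx hy)

theorem IsEnd.mem_treeLeaves {x : V} {i : Fin 4} (hx : ρ.IsEnd x) (hi : ρ.idx x = i)
    (h : ¬ ρ.IsEnd (u i)) : x ∈ treeLeaves G u i := by
  refine mem_treeLeaves_iff.mpr ⟨hi, ?_, hx⟩
  rintro ⟨j, rfl⟩
  rw [ρ.idx_root] at hi
  exact h (hi ▸ hx)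

theorem exists_leaf_of_mem_Forced [Fintype V] {f : V ⊕ Sym2 V} (hf : f ∈ ρ.Forced) :
    ∃ i, ∃ x ∈ treeLeaves G u i, f ∈ ρ.R x := by
  obtain ⟨x, hx, hfx⟩ := exists_end_of_mem_Forced hf
  refine ⟨ρ.idx x, x, mem_treeLeaves_iff.mpr ⟨rfl, ?_, hx⟩, hfx⟩
  rintro ⟨j, rfl⟩
  rw [R_root] at hfx
  exact hfx

theorem exists_of_twoLeafShape {i : Fin 4} (ρ : Rooting G u) (h : TwoLeafShape G u i) :
    ∃ x y, x ≠ y ∧ treeLeaves G u i = {x, y} ∧ ρ.Anc (ρ.par x) y := by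
  obtain ⟨v, x, y, hne, hl, hadj, hroot⟩ := h
  have hx : x ∈ treeLeaves G u i := by simp [hl]
  rw [adj_leaf (ρ := ρ) hx.2 hadj] at hroot
  exact ⟨x, y, hne, hl, (onRootPath_iff.mp hroot).2⟩

theorem twoLeafShape_of_anc {i : Fin 4} {x y : V} (hne : x ≠ y)
    (hl : treeLeaves G u i = {x, y}) (h : ρ.Anc (ρ.par x) y) : TwoLeafShape G u i := by
  have hx : x ∈ treeLeaves G u i := by simp [hl]
  have hy : y ∈ treeLeaves G u i := by simp [hl]
  exact ⟨ρ.par x, x, y, hne, hl, (adj_par (notMem_range_of_leaf ρ hx)).symm,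
    onRootPath_iff.mpr ⟨idx_leaf hy, h⟩⟩

theorem exists_of_threeLeafShape {i : Fin 4} (ρ : Rooting G u) (h : ThreeLeafShape G u i) :
    ∃ x y z, x ≠ y ∧ x ≠ z ∧ y ≠ z ∧ treeLeaves G u i = {x, y, z} ∧
      ρ.par x = ρ.par y ∧ ρ.Anc (ρ.par z) (ρ.par x) := by
  obtain ⟨v, v', x, y, z, hxy, hxz, hyz, hl, hx', hy', hz', hroot⟩ := h
  have hx : x ∈ treeLeaves G u i := by simp [hl]
  have hy : y ∈ treeLeaves G u i := by simp [hl]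
  have hz : z ∈ treeLeaves G u i := by simp [hl]
  have e1 := adj_leaf (ρ := ρ) hx.2 hx'
  have e2 := adj_leaf (ρ := ρ) hy.2 hy'
  have e3 := adj_leaf (ρ := ρ) hz.2 hz'
  refine ⟨x, y, z, hxy, hxz, hyz, hl, e1.symm.trans e2, ?_⟩
  rw [← e1, ← e3]
  exact (onRootPath_iff.mp hroot).2

theorem threeLeafShape_of_anc {i : Fin 4} {x y z : V} (hxy : x ≠ y) (hxz : x ≠ z) (hyz : y ≠ z)
    (hl : treeLeaves G u i = {x, y, z}) (h : ρ.par x = ρ.par y)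
    (h' : ρ.Anc (ρ.par z) (ρ.par x)) : ThreeLeafShape G u i := by
  have hx : x ∈ treeLeaves G u i := by simp [hl]
  have hy : y ∈ treeLeaves G u i := by simp [hl]
  have hz : z ∈ treeLeaves G u i := by simp [hl]
  have ha : ∀ {w}, w ∈ treeLeaves G u i → G.Adj (ρ.par w) w := fun hw =>
    (adj_par (notMem_range_of_leaf ρ hw)).symm
  refine ⟨ρ.par x, ρ.par z, x, y, z, hxy, hxz, hyz, hl, ha hx, h ▸ ha hy, ha hz,
    onRootPath_iff.mpr ⟨?_, h'⟩⟩
  rw [ρ.idx_par]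
  exact idx_leaf hx

/-- If in a tree with three leaves the neighbour of each leaf lies on the root path of another leaf,
the tree has the shape `ThreeLeafShape`. -/
theorem threeLeafShape_of_forall {i : Fin 4} {x y z : V} (hxy : x ≠ y) (hxz : x ≠ z) (hyz : y ≠ z)
    (hl : treeLeaves G u i = {x, y, z})
    (h : ∀ a ∈ treeLeaves G u i, ∃ b ∈ treeLeaves G u i, a ≠ b ∧ ρ.Anc (ρ.par a) b) :
    ThreeLeafShape G u i := by
  have hpar : ∀ a ∈ treeLeaves G u i, ∃ b ∈ treeLeaves G u i, a ≠ b ∧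
      ρ.Anc (ρ.par a) (ρ.par b) := by
    intro a ha
    obtain ⟨b, hb, hab, hanc⟩ := h a ha
    refine ⟨b, hb, hab, ?_⟩
    rcases hanc.eq_or with h1 | h1
    · exact absurd h1 (par_ne_leaf ha hb)
    · exact h1.2
  -- Take `x` with the deepest parent. That parent is an ancestor of the parent of another leaf, and
  -- by depth the two coincide; the parent of the third leaf is then above this common parent.
  have key : ∀ x y z, x ≠ y → x ≠ z → y ≠ z → treeLeaves G u i = {x, y, z} →
      ρ.dep (ρ.par y) ≤ ρ.dep (ρ.par x) → ρ.dep (ρ.par z) ≤ ρ.dep (ρ.par x) →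
      ThreeLeafShape G u i := by
    intro x y z hxy hxz hyz hl h1 h2
    have hmem : ∀ b, b ∈ treeLeaves G u i ↔ b = x ∨ b = y ∨ b = z := by
      intro b
      rw [hl]
      simp
    have hsame : ∀ y z, x ≠ y → x ≠ z → y ≠ z → treeLeaves G u i = {x, y, z} →
        (∀ b, b ∈ treeLeaves G u i ↔ b = x ∨ b = y ∨ b = z) →
        ρ.dep (ρ.par y) ≤ ρ.dep (ρ.par x) → ρ.Anc (ρ.par x) (ρ.par y) → ThreeLeafShape G u i := by
      intro y z hxy hxz hyz hl hmem h1 hanc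
      have he : ρ.par x = ρ.par y := by
        by_contra hne
        exact absurd (hanc.dep_lt hne) (not_lt.mpr h1)
      refine threeLeafShape_of_anc hxy hxz hyz hl he ?_
      obtain ⟨b, hb, hzb, hb'⟩ := hpar z ((hmem z).mpr (Or.inr (Or.inr rfl)))
      rcases (hmem b).mp hb with rfl | rfl | rfl
      · exact hb'
      · exact he ▸ hb'
      · exact absurd rfl hzb
    obtain ⟨b, hb, hxb, hb'⟩ := hpar x ((hmem x).mpr (Or.inl rfl))
    rcases (hmem b).mp hb with rfl | rfl | rfl
    · exact absurd rfl hxb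
    · exact hsame b z hxy hxz hyz hl hmem h1 hb'
    · refine hsame b y hxz hxy hyz.symm ?_ ?_ h2 hb'
      · rw [hl, Set.pair_comm]
      · intro c
        rw [hmem, or_comm (a := c = y)]
  rcases le_total (ρ.dep (ρ.par x)) (ρ.dep (ρ.par y)) with h1 | h1
  · rcases le_total (ρ.dep (ρ.par y)) (ρ.dep (ρ.par z)) with h2 | h2
    · exact key z x y hxz.symm hyz.symm hxy (by rw [hl]; ext; simp; tauto) (h1.trans h2) h2
    · exact key y x z hxy.symm hyz hxz (by rw [hl]; ext; simp; tauto) h1 h2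
  · rcases le_total (ρ.dep (ρ.par x)) (ρ.dep (ρ.par z)) with h2 | h2
    · exact key z x y hxz.symm hyz.symm hxy (by rw [hl]; ext; simp; tauto) h2 (h1.trans h2)
    · exact key x y z hxy hxz hyz hl h1 h2

theorem exists_unique_leaf [Fintype V] (ρ : Rooting G u) {i : Fin 4}
    (h : (treeLeaves G u i).ncard ≤ 1) : ∃ z, ρ.idx z = i ∧ ∀ x ∈ treeLeaves G u i, x = z := by
  rcases (treeLeaves G u i).eq_empty_or_nonempty with h0 | ⟨z, hz⟩
  · exact ⟨u i, ρ.idx_root i, by simp [h0]⟩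
  · exact ⟨z, idx_leaf hz, fun x hx => (Set.ncard_le_one (Set.toFinite _)).mp h x hx z hz⟩

/-! ### New colors when the trees at `u 1` and `u 3` are trivial. -/

section opposite

variable [Fintype V] (ρ)

theorem mem_Forced_opposite (h1 : ρ.IsEnd (u 1)) (h3 : ρ.IsEnd (u 3))
    {f : V ⊕ Sym2 V} (hf : f ∈ ρ.Forced) :
    (∃ x ∈ treeLeaves G u 0, f ∈ ρ.R x) ∨ ∃ x ∈ treeLeaves G u 2, f ∈ ρ.R x := by
  obtain ⟨i, x, hx, hfx⟩ := exists_leaf_of_mem_Forced hf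
  fin_cases i
  · exact Or.inl ⟨x, hx, hfx⟩
  · simp [treeLeaves_eq_empty h1] at hx
  · exact Or.inr ⟨x, hx, hfx⟩
  · simp [treeLeaves_eq_empty h3] at hx

theorem lower_one (h1 : ρ.IsEnd (u 1)) (h3 : ρ.IsEnd (u 3))
    {k : ℕ} (hk : HasTRCColoring G k) (h0 : (treeLeaves G u 0).ncard = 1)
    (h2 : (treeLeaves G u 2).ncard ≤ 1) : ρ.Forced.ncard + 3 ≤ k := by
  obtain ⟨x, hx⟩ := Set.ncard_eq_one.mp h0
  obtain ⟨z, hz, hz'⟩ := exists_unique_leaf ρ h2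
  refine forced_add_three_le ρ hk (x := x) (idx_leaf (by simp [hx])) hz fun f hf => ?_
  rcases mem_Forced_opposite ρ h1 h3 hf with ⟨y, hy, hfy⟩ | ⟨y, hy, hfy⟩
  · rw [hx] at hy
    exact Or.inl (hy ▸ hfy)
  · exact Or.inr (hz' y hy ▸ hfy)

theorem lower_twoLeafShape (h1 : ρ.IsEnd (u 1)) (h3 : ρ.IsEnd (u 3))
    {k : ℕ} (hk : HasTRCColoring G k) (h0 : TwoLeafShape G u 0)
    (h2 : (treeLeaves G u 2).ncard ≤ 1) : ρ.Forced.ncard + 2 ≤ k := by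
  obtain ⟨x, y, hxy, hl, hanc⟩ := exists_of_twoLeafShape ρ h0
  have hx : x ∈ treeLeaves G u 0 := by simp [hl]
  have hy : y ∈ treeLeaves G u 0 := by simp [hl]
  obtain ⟨z, hz, hz'⟩ := exists_unique_leaf ρ h2
  refine forced_add_two_le ρ hk (x := y) (idx_leaf hy) hz (p := ρ.bridge x) fun f hf => ?_
  rcases mem_Forced_opposite ρ h1 h3 hf with ⟨w, hw, hfw⟩ | ⟨w, hw, hfw⟩
  · rw [hl] at hw
    rcases hw with rfl | rfl
    · rcases R_leaf_subset hx hy hanc hfw with h | h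
      · exact Or.inl h
      · exact Or.inr (Or.inl h)
    · exact Or.inr (Or.inl hfw)
  · exact Or.inr (Or.inr (hz' w hw ▸ hfw))

theorem lower_two (h1 : ρ.IsEnd (u 1)) (h3 : ρ.IsEnd (u 3))
    {k : ℕ} (hk : HasTRCColoring G k) (h0 : (treeLeaves G u 0).ncard = 2)
    (h2 : (treeLeaves G u 2).ncard ≤ 1) : ρ.Forced.ncard + 1 ≤ k := by
  obtain ⟨x, y, hxy, hl⟩ := Set.ncard_eq_two.mp h0
  have hx : x ∈ treeLeaves G u 0 := by simp [hl]
  have hy : y ∈ treeLeaves G u 0 := by simp [hl]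
  obtain ⟨z, hz, hz'⟩ := exists_unique_leaf ρ h2
  refine forced_add_one_le_of_opposite ρ hk (idx_leaf hx) (idx_leaf hy) hz fun f hf => ?_
  rcases mem_Forced_opposite ρ h1 h3 hf with ⟨w, hw, hfw⟩ | ⟨w, hw, hfw⟩
  · rw [hl] at hw
    rcases hw with rfl | rfl
    · exact Or.inl hfw
    · exact Or.inr (Or.inl hfw)
  · exact Or.inr (Or.inr (hz' w hw ▸ hfw))

theorem lower_threeLeafShape (h1 : ρ.IsEnd (u 1)) (h3 : ρ.IsEnd (u 3))
    {k : ℕ} (hk : HasTRCColoring G k) (h0 : ThreeLeafShape G u 0)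
    (h2 : (treeLeaves G u 2).ncard ≤ 1) : ρ.Forced.ncard + 2 ≤ k := by
  obtain ⟨x, y, w, hxy, hxw, hyw, hl, hpar, hanc⟩ := exists_of_threeLeafShape ρ h0
  have hx : x ∈ treeLeaves G u 0 := by simp [hl]
  have hy : y ∈ treeLeaves G u 0 := by simp [hl]
  have hw : w ∈ treeLeaves G u 0 := by simp [hl]
  obtain ⟨z, hz, hz'⟩ := exists_unique_leaf ρ h2
  have hyx := R_leaf_subset (ρ := ρ) hy hx (hpar ▸ ρ.anc_par x)
  have hxy' := R_leaf_subset (ρ := ρ) hx hy (hpar ▸ ρ.anc_par y)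
  have hwx := R_leaf_subset (ρ := ρ) hw hx (hanc.trans (ρ.anc_par x))
  have hwy := R_leaf_subset (ρ := ρ) hw hy ((hpar ▸ hanc).trans (ρ.anc_par y))
  refine forced_add_two_le_of_three ρ hk (idx_leaf hx) (idx_leaf hy) (idx_leaf hw) hz
    (bridge_mem_R_self hx) (bridge_mem_R_self hy) (bridge_mem_R_self hw)
    (fun f hf => ?_) fun f hf => ?_
  · rcases mem_Forced_opposite ρ h1 h3 hf with ⟨v, hv, hfv⟩ | ⟨v, hv, hfv⟩
    · rw [hl] at hv
      rcases hv with rfl | rfl | rfl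
      · exact Or.inr (Or.inr (Or.inl hfv))
      · rcases hyx hfv with h | h
        exacts [Or.inl h, Or.inr (Or.inr (Or.inl h))]
      · rcases hwx hfv with h | h
        exacts [Or.inr (Or.inl h), Or.inr (Or.inr (Or.inl h))]
    · exact Or.inr (Or.inr (Or.inr (hz' v hv ▸ hfv)))
  · rcases mem_Forced_opposite ρ h1 h3 hf with ⟨v, hv, hfv⟩ | ⟨v, hv, hfv⟩
    · rw [hl] at hv
      rcases hv with rfl | rfl | rfl
      · rcases hxy' hfv with h | h
        exacts [Or.inl h, Or.inr (Or.inr (Or.inl h))]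
      · exact Or.inr (Or.inr (Or.inl hfv))
      · rcases hwy hfv with h | h
        exacts [Or.inr (Or.inl h), Or.inr (Or.inr (Or.inl h))]
    · exact Or.inr (Or.inr (Or.inr (hz' v hv ▸ hfv)))

theorem lower_twoLeafShape_twoLeafShape (h1 : ρ.IsEnd (u 1)) (h3 : ρ.IsEnd (u 3))
    {k : ℕ} (hk : HasTRCColoring G k)
    (h0 : TwoLeafShape G u 0) (h2 : TwoLeafShape G u 2) : ρ.Forced.ncard + 2 ≤ k := by
  obtain ⟨x, y, hxy, hl, hanc⟩ := exists_of_twoLeafShape ρ h0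
  have hx : x ∈ treeLeaves G u 0 := by simp [hl]
  have hy : y ∈ treeLeaves G u 0 := by simp [hl]
  obtain ⟨x', y', hxy', hl', hanc'⟩ := exists_of_twoLeafShape ρ h2
  have hx' : x' ∈ treeLeaves G u 2 := by simp [hl']
  have hy' : y' ∈ treeLeaves G u 2 := by simp [hl']
  refine forced_add_two_le_of_two_two ρ hk (idx_leaf hx) (idx_leaf hy) (idx_leaf hx')
    (idx_leaf hy') (bridge_mem_R_self hx) (bridge_mem_R_self hx') fun f hf => ?_
  rcases mem_Forced_opposite ρ h1 h3 hf with ⟨w, hw, hfw⟩ | ⟨w, hw, hfw⟩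
  · rw [hl] at hw
    rcases hw with rfl | rfl
    · rcases R_leaf_subset hx hy hanc hfw with h | h
      · exact Or.inl h
      · exact Or.inr (Or.inr (Or.inl h))
    · exact Or.inr (Or.inr (Or.inl hfw))
  · rw [hl'] at hw
    rcases hw with rfl | rfl
    · rcases R_leaf_subset hx' hy' hanc' hfw with h | h
      · exact Or.inr (Or.inl h)
      · exact Or.inr (Or.inr (Or.inr h))
    · exact Or.inr (Or.inr (Or.inr hfw))

theorem upper_three (h1 : ρ.IsEnd (u 1)) (h3 : ρ.IsEnd (u 3))
    : HasTRCColoring G (ρ.Forced.ncard + 3) := by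
  classical
  have hne : ∀ {i j : Fin 4}, i ≠ j → cyc u i ≠ cyc u j := fun h h' => h (cyc_injective ρ.inj h')
  have hcard : ({cyc u 0, cyc u 1, cyc u 2} : Finset (V ⊕ Sym2 V)).card = 3 := by
    rw [Finset.card_eq_three]
    exact ⟨_, _, _, hne (by decide), hne (by decide), hne (by decide), rfl⟩
  rw [← hcard]
  -- Both arcs carry the same three new colors; two are exchanged on the second arc to keep `c₂ ≠
  -- d₂`.
  refine hasTRCColoring_of_opposite ρ h1 h3 (n := cyc u 0) (c₁ := cyc u 1) (c₂ := cyc u 2)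
    (d₁ := cyc u 2) (d₂ := cyc u 1) (by simp) cyc_notMem_Forced ?_ (hne (by decide))
    (hne (by decide)) (hne (by decide)) fun x _ _ => Or.inl ⟨cyc_notMem_R, cyc_notMem_R⟩
  intro f hf
  simp only [List.mem_cons, List.not_mem_nil, or_false] at hf
  rcases hf with rfl | rfl | rfl | rfl
  all_goals exact ⟨Or.inr (by simp), hne (by decide), fun z _ => cyc_notMem_R⟩

theorem upper_two (h1 : ρ.IsEnd (u 1)) (h3 : ρ.IsEnd (u 3))
    {x y : V} (hx : x ∈ treeLeaves G u 0) (hy : y ∈ treeLeaves G u 0)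
    (hxy : x ≠ y) : HasTRCColoring G (ρ.Forced.ncard + 2) := by
  classical
  have hne : ∀ {i j : Fin 4}, i ≠ j → cyc u i ≠ cyc u j := fun h h' => h (cyc_injective ρ.inj h')
  have hcard : ({cyc u 0, cyc u 1} : Finset (V ⊕ Sym2 V)).card = 2 :=
    Finset.card_pair (hne (by decide))
  have hxu := notMem_range_of_leaf ρ hx
  have hyu := notMem_range_of_leaf ρ hy
  have hR : ∀ {w}, w ∈ treeLeaves G u 0 → ∀ z, ρ.idx z = 2 → ρ.bridge w ∉ ρ.R z := by
    intro w hw z hz h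
    rw [← eq_of_bridge_mem_R hw h, idx_leaf hw] at hz
    exact absurd hz (by decide)
  rw [← hcard]
  -- The two pendent edges are put on different arcs; every childless vertex avoids at least one of
  -- them.
  refine hasTRCColoring_of_opposite ρ h1 h3 (n := cyc u 0) (c₁ := cyc u 1) (c₂ := ρ.bridge x)
    (d₁ := cyc u 1) (d₂ := ρ.bridge y) (by simp) cyc_notMem_Forced ?_ (cyc_ne_bridge hxu)
    (cyc_ne_bridge hyu) (fun h => hxy (bridge_inj hxu hyu h)) fun w _ _ => ?_
  · intro f hf
    simp only [List.mem_cons, List.not_mem_nil, or_false] at hf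
    rcases hf with rfl | rfl | rfl | rfl
    · exact ⟨Or.inr (by simp), hne (by decide), fun z _ => cyc_notMem_R⟩
    · exact ⟨Or.inl ⟨_, bridge_mem_R_self hx⟩, (cyc_ne_bridge hxu).symm, hR hx⟩
    · exact ⟨Or.inr (by simp), hne (by decide), fun z _ => cyc_notMem_R⟩
    · exact ⟨Or.inl ⟨_, bridge_mem_R_self hy⟩, (cyc_ne_bridge hyu).symm, hR hy⟩
  · by_cases h : w = x
    · subst h
      exact Or.inr ⟨cyc_notMem_R, fun h => hxy (eq_of_bridge_mem_R hy h).symm⟩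
    · exact Or.inl ⟨cyc_notMem_R, fun h' => h (eq_of_bridge_mem_R hx h').symm⟩

/-- Four colors of the tree at `u 0` suffice besides one new color. -/
theorem upper_one_of_forced (h1 : ρ.IsEnd (u 1)) (h3 : ρ.IsEnd (u 3))
    (h0 : ¬ ρ.IsEnd (u 0)) {c₁ c₂ d₁ d₂ : V ⊕ Sym2 V}
    (hF : ∀ f ∈ [c₁, c₂, d₁, d₂], ∃ w ∈ treeLeaves G u 0, f ∈ ρ.R w)
    (hc : c₁ ≠ c₂) (hd : d₁ ≠ d₂) (hcd : c₂ ≠ d₂)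
    (h : ∀ x ∈ treeLeaves G u 0,
      (c₁ ∉ ρ.R x ∧ c₂ ∉ ρ.R x) ∨ (d₁ ∉ ρ.R x ∧ d₂ ∉ ρ.R x)) :
    HasTRCColoring G (ρ.Forced.ncard + 1) := by
  refine hasTRCColoring_of_opposite ρ h1 h3 (n := cyc u 0) (N := {cyc u 0}) (by simp)
    cyc_notMem_Forced ?_ hc hd hcd fun x hx hi => h x (hx.mem_treeLeaves hi h0)
  intro f hf
  obtain ⟨w, hw, hfw⟩ := hF f hf
  refine ⟨Or.inl ⟨w, hfw⟩, ?_, fun z hz hfz => ?_⟩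
  · rintro rfl
    exact cyc_notMem_R hfw
  · rw [← idx_eq_of_mem hfw hfz, idx_leaf hw] at hz
    exact absurd hz (by decide)

theorem upper_one_of_two (h1 : ρ.IsEnd (u 1)) (h3 : ρ.IsEnd (u 3))
    (h2 : (treeLeaves G u 0).ncard = 2) (hnot : ¬ TwoLeafShape G u 0) :
    HasTRCColoring G (ρ.Forced.ncard + 1) := by
  obtain ⟨x, y, hxy, hl⟩ := Set.ncard_eq_two.mp h2
  have hx : x ∈ treeLeaves G u 0 := by simp [hl]
  have hy : y ∈ treeLeaves G u 0 := by simp [hl]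
  have hxu := notMem_range_of_leaf ρ hx
  have hyu := notMem_range_of_leaf ρ hy
  have hpx : ¬ ρ.Anc (ρ.par x) y := fun h => hnot (twoLeafShape_of_anc hxy hl h)
  have hpy : ¬ ρ.Anc (ρ.par y) x := fun h =>
    hnot (twoLeafShape_of_anc hxy.symm (hl.trans (Set.pair_comm _ _)) h)
  -- Outside type I each leaf has two private colors, its pendent edge and its neighbor; the arc for
  -- one leaf is filled with those of the other.
  refine upper_one_of_forced ρ h1 h3 ?_ (c₁ := Sum.inl (ρ.par y)) (c₂ := ρ.bridge y)
    (d₁ := Sum.inl (ρ.par x)) (d₂ := ρ.bridge x) ?_ Sum.inl_ne_inr Sum.inl_ne_inr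
    (fun h => hxy (bridge_inj hyu hxu h).symm) fun w hw => ?_
  · intro h
    rw [treeLeaves_eq_empty h] at hx
    exact hx
  · have hm : ∀ w, w ∉ Set.range u → Sum.inl (ρ.par w) ∈ ρ.R w := fun w hw =>
      inl_mem_R.mpr ⟨ρ.anc_par w, par_ne hw⟩
    intro f hf
    simp only [List.mem_cons, List.not_mem_nil, or_false] at hf
    rcases hf with rfl | rfl | rfl | rfl
    exacts [⟨y, hy, hm y hyu⟩, ⟨y, hy, bridge_mem_R_self hy⟩, ⟨x, hx, hm x hxu⟩,
      ⟨x, hx, bridge_mem_R_self hx⟩]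
  · rw [hl] at hw
    rcases hw with rfl | rfl
    · exact Or.inl ⟨fun h => hpy (inl_mem_R.mp h).1, fun h => hxy (eq_of_bridge_mem_R hy h).symm⟩
    · exact Or.inr ⟨fun h => hpx (inl_mem_R.mp h).1, fun h => hxy (eq_of_bridge_mem_R hx h)⟩

theorem upper_one_of_three (h1 : ρ.IsEnd (u 1)) (h3 : ρ.IsEnd (u 3))
    (h2 : (treeLeaves G u 0).ncard = 3) (hnot : ¬ ThreeLeafShape G u 0) :
    HasTRCColoring G (ρ.Forced.ncard + 1) := by
  have hex : ∃ x ∈ treeLeaves G u 0, ∀ b ∈ treeLeaves G u 0, x ≠ b → ¬ ρ.Anc (ρ.par x) b := by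
    obtain ⟨x, y, z, hxy, hxz, hyz, hl⟩ := Set.ncard_eq_three.mp h2
    by_contra hno
    push Not at hno
    exact hnot (threeLeafShape_of_forall hxy hxz hyz hl hno)
  obtain ⟨x, hx, hxp⟩ := hex
  have h2' : (treeLeaves G u 0 \ {x}).ncard = 2 := by
    rw [Set.ncard_sdiff_singleton_of_mem hx, h2]
  obtain ⟨y, z, hyz, hl⟩ := Set.ncard_eq_two.mp h2'
  obtain ⟨hy, hyx⟩ : y ∈ treeLeaves G u 0 \ {x} := by simp [hl]
  obtain ⟨hz, hzx⟩ : z ∈ treeLeaves G u 0 \ {x} := by simp [hl]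
  have hxu := notMem_range_of_leaf ρ hx
  have hyu := notMem_range_of_leaf ρ hy
  have hzu := notMem_range_of_leaf ρ hz
  -- The neighbor of `x` is on no other root path. So `x` uses the arc with the pendent edges of `y`
  -- and `z`, while `y` and `z` use the arc with the two private colors of `x`.
  refine upper_one_of_forced ρ h1 h3 ?_ (c₁ := ρ.bridge y) (c₂ := ρ.bridge z)
    (d₁ := Sum.inl (ρ.par x)) (d₂ := ρ.bridge x) ?_ (fun h => hyz (bridge_inj hyu hzu h))
    Sum.inl_ne_inr (fun h => hzx (bridge_inj hzu hxu h)) fun w hw => ?_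
  · intro h
    rw [treeLeaves_eq_empty h] at hx
    exact hx
  · intro f hf
    simp only [List.mem_cons, List.not_mem_nil, or_false] at hf
    rcases hf with rfl | rfl | rfl | rfl
    exacts [⟨y, hy, bridge_mem_R_self hy⟩, ⟨z, hz, bridge_mem_R_self hz⟩,
      ⟨x, hx, inl_mem_R.mpr ⟨ρ.anc_par x, par_ne hxu⟩⟩, ⟨x, hx, bridge_mem_R_self hx⟩]
  · by_cases hwx : w = x
    · subst hwx
      exact Or.inl ⟨fun h => hyx (eq_of_bridge_mem_R hy h), fun h => hzx (eq_of_bridge_mem_R hz h)⟩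
    · exact Or.inr ⟨fun h => hxp w hw (Ne.symm hwx) (inl_mem_R.mp h).1,
        fun h => hwx (eq_of_bridge_mem_R hx h).symm⟩

end opposite

theorem bridge_leaf_notMem_R (ρ : Rooting G u) {i : Fin 4} {x w : V} (hx : x ∈ treeLeaves G u i)
    (hw : ρ.idx w ≠ i) : ρ.bridge x ∉ ρ.R w := by
  intro h
  rw [← eq_of_bridge_mem_R hx h, idx_leaf hx] at hw
  exact hw rfl

/-- A set with one or two elements. -/
theorem exists_pair_of_ncard {S : Set V} (h : S.ncard = 1 ∨ S.ncard = 2) :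
    ∃ x ∈ S, ∃ y ∈ S, ∀ w ∈ S, w = x ∨ w = y := by
  rcases h with h | h
  · obtain ⟨x, rfl⟩ := Set.ncard_eq_one.mp h
    exact ⟨x, by simp, x, by simp, by simp⟩
  · obtain ⟨x, y, -, rfl⟩ := Set.ncard_eq_two.mp h
    exact ⟨x, by simp, y, by simp, by simp⟩

/-! ### New colors when two adjacent trees are nontrivial. -/

section others

variable [Fintype V] (ρ)

theorem upper_one_adjacent (h0 : ¬ ρ.IsEnd (u 0)) (h1 : ¬ ρ.IsEnd (u 1)) (h2 : ρ.IsEnd (u 2))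
    (h3 : ρ.IsEnd (u 3)) : HasTRCColoring G (ρ.Forced.ncard + 1) := by
  obtain ⟨x, hx⟩ := treeLeaves_nonempty h0
  obtain ⟨y, hy⟩ := treeLeaves_nonempty h1
  exact hasTRCColoring_of_adjacent ρ h0 h1 h2 h3 (cyc_notMem_Forced (k := 0))
    ⟨x, bridge_mem_R_self hx⟩ (fun w hw => bridge_leaf_notMem_R ρ hx hw) Sum.inr_ne_inl
    ⟨y, bridge_mem_R_self hy⟩ (fun w hw => bridge_leaf_notMem_R ρ hy hw) Sum.inr_ne_inl

theorem upper_one_three_trees (h0 : ¬ ρ.IsEnd (u 0)) (h1 : ¬ ρ.IsEnd (u 1))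
    (h2 : ¬ ρ.IsEnd (u 2)) : HasTRCColoring G (ρ.Forced.ncard + 1) := by
  obtain ⟨y, hy⟩ := treeLeaves_nonempty h1
  exact hasTRCColoring_of_three_trees ρ h0 h1 h2 (b := cyc u 0) (N := {cyc u 0})
    (Or.inr (by simp)) (fun _ _ => cyc_notMem_R) (fun _ => Sum.inr_ne_inl)
    ⟨y, bridge_mem_R_self hy⟩ (fun w hw => bridge_leaf_notMem_R ρ hy hw) (fun _ => Sum.inr_ne_inl)
    (cyc_ne_bridge (notMem_range_of_leaf ρ hy)) fun _ _ _ => Or.inr cyc_notMem_R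

/-- The two pendent edges over `u 1` play the roles of `b` and `q`: each childless vertex there
avoids one of them, so the new color is saved. -/
theorem upper_zero_three_trees (h0 : ¬ ρ.IsEnd (u 0)) (h1 : ¬ ρ.IsEnd (u 1))
    (h2 : ¬ ρ.IsEnd (u 2)) (h : (treeLeaves G u 1).ncard = 2) :
    HasTRCColoring G ρ.Forced.ncard := by
  obtain ⟨x, y, hxy, hl⟩ := Set.ncard_eq_two.mp h
  have hx : x ∈ treeLeaves G u 1 := by simp [hl]
  have hy : y ∈ treeLeaves G u 1 := by simp [hl]
  refine hasTRCColoring_of_three_trees ρ h0 h1 h2 (b := ρ.bridge x) (N := ∅)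
    (Or.inl ⟨x, bridge_mem_R_self hx⟩) (fun w hw => bridge_leaf_notMem_R ρ hx hw)
    (fun _ => Sum.inr_ne_inl)
    ⟨y, bridge_mem_R_self hy⟩ (fun w hw => bridge_leaf_notMem_R ρ hy hw) (fun _ => Sum.inr_ne_inl)
    (fun h => hxy (bridge_inj (notMem_range_of_leaf ρ hx) (notMem_range_of_leaf ρ hy) h))
    fun w _ _ => ?_
  by_cases hw : y = w
  · exact Or.inr fun h => hxy ((eq_of_bridge_mem_R hx h).trans hw.symm)
  · exact Or.inl fun h => hw (eq_of_bridge_mem_R hy h)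

theorem lower_adjacent {k : ℕ} (hk : HasTRCColoring G k) (h2 : ρ.IsEnd (u 2))
    (h3 : ρ.IsEnd (u 3)) (h0 : (treeLeaves G u 0).ncard = 1 ∨ (treeLeaves G u 0).ncard = 2)
    (h1 : (treeLeaves G u 1).ncard = 1) : ρ.Forced.ncard + 1 ≤ k := by
  obtain ⟨x, hx, x', hx', hl⟩ := exists_pair_of_ncard h0
  obtain ⟨y, hy⟩ := Set.ncard_eq_one.mp h1
  refine forced_add_one_le_of_adjacent ρ hk (idx_leaf hx) (idx_leaf hx') (y := y)
    (idx_leaf (by simp [hy])) fun f hf => ?_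
  obtain ⟨i, w, hw, hfw⟩ := exists_leaf_of_mem_Forced hf
  fin_cases i
  · rcases hl w hw with rfl | rfl
    exacts [Or.inl hfw, Or.inr (Or.inl hfw)]
  · obtain rfl : w = y := by simpa [hy] using hw
    exact Or.inr (Or.inr hfw)
  · simp [treeLeaves_eq_empty h2] at hw
  · simp [treeLeaves_eq_empty h3] at hw

theorem lower_three_trees {k : ℕ} (hk : HasTRCColoring G k) (h3 : ρ.IsEnd (u 3))
    (h0 : (treeLeaves G u 0).ncard = 1 ∨ (treeLeaves G u 0).ncard = 2)
    (h1 : (treeLeaves G u 1).ncard = 1) (h2 : (treeLeaves G u 2).ncard = 1) :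
    ρ.Forced.ncard + 1 ≤ k := by
  obtain ⟨x, hx, x', hx', hl⟩ := exists_pair_of_ncard h0
  obtain ⟨y, hy⟩ := Set.ncard_eq_one.mp h1
  obtain ⟨z, hz⟩ := Set.ncard_eq_one.mp h2
  refine forced_add_one_le_of_three_trees ρ hk (idx_leaf hx) (idx_leaf hx') (y := y)
    (idx_leaf (by simp [hy])) (z := z) (idx_leaf (by simp [hz])) fun f hf => ?_
  obtain ⟨i, w, hw, hfw⟩ := exists_leaf_of_mem_Forced hf
  fin_cases i
  · rcases hl w hw with rfl | rfl
    exacts [Or.inl hfw, Or.inr (Or.inl hfw)]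
  · obtain rfl : w = y := by simpa [hy] using hw
    exact Or.inr (Or.inr (Or.inl hfw))
  · obtain rfl : w = z := by simpa [hz] using hw
    exact Or.inr (Or.inr (Or.inr hfw))
  · simp [treeLeaves_eq_empty h3] at hw

theorem lower_four_trees {k : ℕ} (hk : HasTRCColoring G k)
    (h : ∀ i, (treeLeaves G u i).ncard = 1) : ρ.Forced.ncard + 1 ≤ k := by
  have h' := fun i => Set.ncard_eq_one.mp (h i)
  choose x hx using h'
  refine forced_add_one_le_of_four_trees ρ hk (x := x) (fun i => idx_leaf (by simp [hx i]))
    fun f hf => ?_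
  obtain ⟨i, w, hw, hfw⟩ := exists_leaf_of_mem_Forced hf
  rw [hx i] at hw
  exact ⟨i, hw ▸ hfw⟩

/-- The number of bridges and cut vertices in terms of the numbers of leaves of the trees and of the
trivial trees. -/
theorem ncard_forced_add_sum (t : Fin 4 → ℕ) (ht : ∀ i, t i = 1 ↔ ρ.IsEnd (u i))
    (ht' : ∀ i, t i ≤ 1) :
    ρ.Forced.ncard + numLeaves G + (t 0 + t 1 + t 2 + t 3) + 4 = 2 * Fintype.card V := by
  classical
  rw [← ρ.ncard_forced]
  congr 2
  rw [Set.ncard_eq_toFinset_card', Set.toFinset_ofPred, Finset.card_filter, Fin.sum_univ_four]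
  have : ∀ i, (if ρ.IsEnd (u i) then 1 else 0) = t i := by
    intro i
    have h1 := ht i
    have h2 := ht' i
    split_ifs with h
    · exact (h1.mpr h).symm
    · have : t i ≠ 1 := fun h' => h (h1.mp h')
      omega
  simp only [this]

end others

end Rooting
end TRC

namespace TRC

variable {V : Type*} {G : SimpleGraph V} {u : Fin 4 → V}

open SimpleGraph

/-! ### Relabelling the cycle -/

theorem offCycle_congr {σ : Fin 4 → Fin 4}
    (h : ∃ τ : Equiv.Perm (Fin 4), ∀ i, s(u (σ i), u (σ (i + 1))) = s(u (τ i), u (τ i + 1))) :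
    offCycle G (u ∘ σ) = offCycle G u := by
  obtain ⟨τ, h⟩ := h
  rw [offCycle, offCycle]
  congr 1
  ext e
  constructor
  · rintro ⟨i, rfl⟩
    exact ⟨τ i, (h i).symm⟩
  · rintro ⟨i, rfl⟩
    refine ⟨τ.symm i, (h _).trans ?_⟩
    simp

theorem tree_congr {σ : Fin 4 → Fin 4} (h : offCycle G (u ∘ σ) = offCycle G u) (i : Fin 4) :
    tree G (u ∘ σ) i = tree G u (σ i) := by
  rw [tree, tree, h]
  rfl

theorem treeLeaves_congr {σ : Fin 4 → Fin 4} (h : offCycle G (u ∘ σ) = offCycle G u)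
    (i : Fin 4) : treeLeaves G (u ∘ σ) i = treeLeaves G u (σ i) := by
  rw [treeLeaves, treeLeaves, tree_congr h]

theorem HasPattern.congr {σ : Fin 4 → Fin 4} (h : offCycle G (u ∘ σ) = offCycle G u)
    (hσ : Function.Injective σ) (hadj : ∀ i, G.Adj (u (σ i)) (u (σ (i + 1)))) {S S' : Set (Fin 4)}
    (hS : ∀ i, i ∈ S' ↔ σ i ∈ S) (hp : HasPattern G u S) : HasPattern G (u ∘ σ) S' := by
  refine ⟨hp.1, ⟨hp.2.1.1.comp hσ, hadj⟩, fun i => ?_⟩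
  rw [hS, ← hp.2.2, TreeNontrivial, TreeNontrivial, tree_congr h, h]

theorem offCycle_rotate (a : Fin 4) : offCycle G (u ∘ (a + ·)) = offCycle G u :=
  offCycle_congr ⟨Equiv.addLeft a, fun i => by simp [add_assoc]⟩

theorem HasPattern.rotate (a : Fin 4) {S S' : Set (Fin 4)} (hS : ∀ i, i ∈ S' ↔ a + i ∈ S)
    (hp : HasPattern G u S) : HasPattern G (u ∘ (a + ·)) S' :=
  hp.congr (offCycle_rotate a) (add_right_injective a)
    (fun i => by rw [← add_assoc]; exact hp.2.1.2 _) hS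

theorem offCycle_reflect (a : Fin 4) : offCycle G (u ∘ (a - ·)) = offCycle G u :=
  -- A reflection reverses edges: the image of edge `i` joins `a - i` to `a - (i + 1)`, so its index
  -- is `a - 1 - i`.
  offCycle_congr ⟨Equiv.subLeft (a - 1), fun i => by
    have h1 : a - 1 - i = a - (i + 1) := by rw [sub_sub, add_comm]
    have h2 : a - (i + 1) + 1 = a - i := by rw [← sub_sub, sub_add_cancel]
    rw [Equiv.subLeft_apply, h1, h2, Sym2.eq_swap]⟩

theorem HasPattern.reflect (a : Fin 4) {S S' : Set (Fin 4)} (hS : ∀ i, i ∈ S' ↔ a - i ∈ S)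
    (hp : HasPattern G u S) : HasPattern G (u ∘ (a - ·)) S' :=
  hp.congr (offCycle_reflect a) sub_right_injective
    (fun i => by
      have := (hp.2.1.2 (a - (i + 1))).symm
      rwa [show a - (i + 1) + 1 = a - i by rw [← sub_sub, sub_add_cancel]] at this) hS

/-! ### The total-rainbow connection number -/

theorem trc_le {k : ℕ} (h : HasTRCColoring G k) : trc G ≤ k := Nat.sInf_le h

/-- The existing coloring makes the set of admissible numbers nonempty, so its infimum is attained
and not the default 0. -/
theorem trc_eq {k : ℕ} (h : HasTRCColoring G k) (h' : ∀ l, HasTRCColoring G l → k ≤ l) :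
    trc G = k :=
  le_antisymm (trc_le h) (h' _ (Nat.sInf_mem (s := {k | HasTRCColoring G k}) ⟨k, h⟩))

/-! ### The classification -/

theorem HasPattern.exists_rooting {S : Set (Fin 4)} (hp : HasPattern G u S) :
    ∃ ρ : Rooting G u, ∀ i, ρ.IsEnd (u i) ↔ i ∉ S := by
  obtain ⟨ρ⟩ := TRC.exists_rooting hp.1.1 hp.1.2.1 hp.2.1
  refine ⟨ρ, fun i => ?_⟩
  rw [← hp.2.2, Rooting.treeNontrivial_iff (ρ := ρ), not_not]

theorem HasPattern.treeLeaves_nonempty [Fintype V] {S : Set (Fin 4)} (hp : HasPattern G u S)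
    {i : Fin 4} (hi : i ∈ S) : 1 ≤ (treeLeaves G u i).ncard := by
  obtain ⟨ρ, hρ⟩ := hp.exists_rooting
  rw [Nat.one_le_iff_ne_zero, Ne, Set.ncard_eq_zero, ← Ne, ← Set.nonempty_iff_ne_empty]
  exact Rooting.treeLeaves_nonempty (ρ := ρ) (by rwa [hρ, not_not])

theorem HasPattern.treeLeaves_ncard [Fintype V] {S : Set (Fin 4)} (hp : HasPattern G u S)
    {i : Fin 4} (hi : i ∉ S) : (treeLeaves G u i).ncard = 0 := by
  obtain ⟨ρ, hρ⟩ := hp.exists_rooting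
  rw [Rooting.treeLeaves_eq_empty ((hρ i).mpr hi), Set.ncard_empty]

theorem HasPattern.numLeaves_eq [Fintype V] {S : Set (Fin 4)} (hp : HasPattern G u S) :
    numLeaves G = (treeLeaves G u 0).ncard + (treeLeaves G u 1).ncard +
      (treeLeaves G u 2).ncard + (treeLeaves G u 3).ncard := by
  obtain ⟨ρ, -⟩ := hp.exists_rooting
  rw [Rooting.numLeaves_eq_sum ρ, Fin.sum_univ_four]

/-- The tree at `u 0` is nontrivial, those at `u 1` and `u 3` are trivial. -/
theorem HasPattern.opposite [Fintype V] {t : ℕ}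
    (hp : (HasPattern G u {0} ∧ t = 3) ∨ (HasPattern G u {0, 2} ∧ t = 2)) :
    ∃ ρ : Rooting G u, ρ.IsEnd (u 1) ∧ ρ.IsEnd (u 3) ∧
      ρ.Forced.ncard + numLeaves G + t + 4 = 2 * Fintype.card V := by
  rcases hp with ⟨hp, rfl⟩ | ⟨hp, rfl⟩
  · obtain ⟨ρ, hρ⟩ := hp.exists_rooting
    refine ⟨ρ, by simp [hρ], by simp [hρ],
      ρ.ncard_forced_add_sum ![0, 1, 1, 1] (fun i => ?_) fun i => ?_⟩
    · rw [hρ]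
      fin_cases i <;> simp
    · fin_cases i <;> simp
  · obtain ⟨ρ, hρ⟩ := hp.exists_rooting
    refine ⟨ρ, by simp [hρ], by simp [hρ],
      ρ.ncard_forced_add_sum ![0, 1, 0, 1] (fun i => ?_) fun i => ?_⟩
    · rw [hρ]
      fin_cases i <;> simp
    · fin_cases i <;> simp

theorem HasPattern.adjacent [Fintype V] (hp : HasPattern G u {0, 1}) :
    ∃ ρ : Rooting G u, ¬ ρ.IsEnd (u 0) ∧ ¬ ρ.IsEnd (u 1) ∧ ρ.IsEnd (u 2) ∧ ρ.IsEnd (u 3) ∧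
      ρ.Forced.ncard + numLeaves G + 2 + 4 = 2 * Fintype.card V := by
  obtain ⟨ρ, hρ⟩ := hp.exists_rooting
  refine ⟨ρ, by simp [hρ], by simp [hρ], by simp [hρ], by simp [hρ],
    ρ.ncard_forced_add_sum ![0, 0, 1, 1] (fun i => ?_) fun i => ?_⟩
  · rw [hρ]
    fin_cases i <;> simp
  · fin_cases i <;> simp

theorem HasPattern.three_trees [Fintype V] (hp : HasPattern G u {0, 1, 2}) :
    ∃ ρ : Rooting G u, ¬ ρ.IsEnd (u 0) ∧ ¬ ρ.IsEnd (u 1) ∧ ¬ ρ.IsEnd (u 2) ∧ ρ.IsEnd (u 3) ∧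
      ρ.Forced.ncard + numLeaves G + 1 + 4 = 2 * Fintype.card V := by
  obtain ⟨ρ, hρ⟩ := hp.exists_rooting
  refine ⟨ρ, by simp [hρ], by simp [hρ], by simp [hρ], by simp [hρ],
    ρ.ncard_forced_add_sum ![0, 0, 0, 1] (fun i => ?_) fun i => ?_⟩
  · rw [hρ]
    fin_cases i <;> simp
  · fin_cases i <;> simp

theorem HasPattern.four_trees [Fintype V] (hp : HasPattern G u Set.univ) :
    ∃ ρ : Rooting G u, ¬ ρ.IsEnd (u 0) ∧ ¬ ρ.IsEnd (u 1) ∧ ¬ ρ.IsEnd (u 2) ∧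
      ρ.Forced.ncard + numLeaves G + 0 + 4 = 2 * Fintype.card V := by
  obtain ⟨ρ, hρ⟩ := hp.exists_rooting
  exact ⟨ρ, by simp [hρ], by simp [hρ], by simp [hρ],
    ρ.ncard_forced_add_sum ![0, 0, 0, 0] (fun i => by rw [hρ]; fin_cases i <;> simp)
      fun i => by fin_cases i <;> simp⟩

/-- With one nontrivial tree, `B₄` is the case of one leaf. -/
theorem isB4_iff [Fintype V] : IsB4 G ↔ H1 1 G := by
  constructor
  · rintro ⟨u, hp, v, p, hpath, hsup, -⟩
    refine ⟨⟨u, hp⟩, ?_⟩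
    obtain ⟨ρ, hρ⟩ := hp.exists_rooting
    have h1 : (treeLeaves G u 0).ncard ≤ 1 := by
      refine (Set.ncard_le_one (Set.toFinite _)).mpr ?_
      have key : ∀ x ∈ treeLeaves G u 0, x = v := by
        intro x hx
        have := (Rooting.onRootPath_iff (ρ := ρ).mp ⟨p, hpath, hsup x hx.1⟩).2
        exact (Rooting.mem_treeLeaves_iff.mp hx).2.2.eq_of_anc this
      exact fun x hx y hy => (key x hx).trans (key y hy).symm
    have h0 := hp.treeLeaves_nonempty (i := 0) (by simp)
    have h2 := hp.treeLeaves_ncard (i := 1) (by simp)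
    have h3 := hp.treeLeaves_ncard (i := 2) (by simp)
    have h4 := hp.treeLeaves_ncard (i := 3) (by simp)
    rw [hp.numLeaves_eq]
    omega
  · rintro ⟨⟨u, hp⟩, hl⟩
    classical
    obtain ⟨ρ, hρ⟩ := hp.exists_rooting
    have h0 : (treeLeaves G u 0).ncard = 1 := by
      have h0 := hp.treeLeaves_nonempty (i := 0) (by simp)
      rw [hp.numLeaves_eq] at hl
      have h2 := hp.treeLeaves_ncard (i := 1) (by simp)
      have h3 := hp.treeLeaves_ncard (i := 2) (by simp)
      have h4 := hp.treeLeaves_ncard (i := 3) (by simp)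
      omega
    obtain ⟨v, hv⟩ := Set.ncard_eq_one.mp h0
    have hanc : ∀ x ∈ tree G u 0, ρ.Anc x v := by
      intro x hx
      obtain ⟨y, hy, hxy⟩ := ρ.exists_end x
      have : y ∈ treeLeaves G u 0 := hy.mem_treeLeaves
        (by rw [← hxy.idx]; exact Rooting.mem_tree_iff.mp hx) (by simp [hρ])
      rw [hv] at this
      exact this ▸ hxy
    have hvi : ρ.idx v = 0 := Rooting.idx_leaf (i := 0) (by simp [hv])
    obtain ⟨p, hpath, -⟩ : ∃ p : (offCycle G u).Walk (u 0) v, p.IsPath ∧ v ∈ p.support :=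
      Rooting.onRootPath_iff (ρ := ρ).mpr ⟨hvi, ρ.anc_refl v⟩
    have hedge : ∀ x, x ∉ Set.range u → x ∈ tree G u 0 → s(x, ρ.par x) ∈ p.edges := by
      intro x hx hx0
      have h1 := Rooting.bridge_mem_edges (p.mapLe (offCycle_le G u)).reverse hx (hanc x hx0)
        fun h => hx ⟨_, (Rooting.anc_root h).symm⟩
      rwa [Walk.edges_reverse, List.mem_reverse, Walk.edges_mapLe_eq_edges] at h1
    refine ⟨u, hp, v, p, hpath, fun x hx => ?_, fun x hx y hy hxy => ?_⟩
    · by_cases hxu : x ∈ Set.range u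
      · rw [Rooting.anc_mem_root (hanc x hx) hxu, hvi]
        exact p.start_mem_support
      · exact p.fst_mem_support_of_mem_edges (hedge x hxu hx)
    · rcases (Rooting.offCycle_adj (ρ := ρ)).mp hxy with ⟨h, rfl⟩ | ⟨h, rfl⟩
      · exact hedge x h hx
      · rw [Sym2.eq_swap]
        exact hedge y h hy

/-- A set of indices of the four-cycle is empty or, up to rotation, one of five standard ones. -/
theorem exists_rotate (S : Set (Fin 4)) : S = ∅ ∨ ∃ a : Fin 4, ∃ S' : Set (Fin 4),
    (S' = {0} ∨ S' = {0, 1} ∨ S' = {0, 2} ∨ S' = {0, 1, 2} ∨ S' = Set.univ) ∧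
      ∀ i, i ∈ S' ↔ a + i ∈ S := by
  classical
  obtain ⟨T, rfl⟩ : ∃ T : Finset (Fin 4), S = T := ⟨S.toFinset, by simp⟩
  have key : ∀ T : Finset (Fin 4), T = ∅ ∨ ∃ a : Fin 4, ∃ T' : Finset (Fin 4),
      (T' = {0} ∨ T' = {0, 1} ∨ T' = {0, 2} ∨ T' = {0, 1, 2} ∨ T' = Finset.univ) ∧
        ∀ i, i ∈ T' ↔ a + i ∈ T := by
    decide
  rcases key T with rfl | ⟨a, T', h, h'⟩
  · simp
  · refine Or.inr ⟨a, T', ?_, by simpa using h'⟩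
    rcases h with rfl | rfl | rfl | rfl | rfl <;> simp

/-- If all trees are trivial the graph is a cycle. -/
theorem nonempty_iso_cycleGraph [Fintype V] (hp : HasPattern G u ∅) :
    Nonempty (G ≃g cycleGraph (Fintype.card V)) := by
  obtain ⟨ρ, hρ⟩ := hp.exists_rooting
  have hsurj : Function.Surjective u := fun x =>
    ⟨ρ.idx x, (Rooting.isEnd_root_iff.mp ((hρ (ρ.idx x)).mpr (by simp)) x rfl).symm⟩
  have hcard : Fintype.card V = 4 := by
    rw [← Fintype.card_of_bijective ⟨ρ.inj, hsurj⟩, Fintype.card_fin]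
  rw [hcard]
  refine ⟨(RelIso.mk (Equiv.ofBijective u ⟨ρ.inj, hsurj⟩) fun {i j} => ?_ :
    cycleGraph 4 ≃g G).symm⟩
  have : G.Adj (u i) (u j) ↔ ∃ k, s(u i, u j) = s(u k, u (k + 1)) := by
    rw [ρ.adj_iff]
    simp
  change G.Adj (u i) (u j) ↔ _
  rw [this, cycleGraph_adj]
  simp only [Sym2.eq_iff, ρ.inj.eq_iff]
  clear * -
  revert i j
  decide

end TRC

/-! ### Symmetries and leaf counts of the patterns. -/

namespace TRC

variable {V : Type*} {G : SimpleGraph V} {u : Fin 4 → V}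

theorem twoLeafShape_congr {σ : Fin 4 → Fin 4} (h : offCycle G (u ∘ σ) = offCycle G u)
    (i : Fin 4) : TwoLeafShape G (u ∘ σ) i ↔ TwoLeafShape G u (σ i) := by
  have hr : ∀ x w, OnRootPath G (u ∘ σ) i x w ↔ OnRootPath G u (σ i) x w := fun x w => by
    rw [OnRootPath, OnRootPath, h]
    rfl
  simp only [TwoLeafShape, treeLeaves_congr h, hr]

theorem HasPattern.swap_opposite (hp : HasPattern G u {0, 2}) :
    ∃ v : Fin 4 → V, HasPattern G v {0, 2} ∧ treeLeaves G v 0 = treeLeaves G u 2 ∧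
      treeLeaves G v 2 = treeLeaves G u 0 ∧ (TwoLeafShape G v 0 ↔ TwoLeafShape G u 2) :=
  ⟨_, hp.rotate 2 (S' := {0, 2}) (by intro i; fin_cases i <;> simp),
    treeLeaves_congr (offCycle_rotate 2) 0, treeLeaves_congr (offCycle_rotate 2) 2,
    twoLeafShape_congr (offCycle_rotate 2) 0⟩

theorem HasPattern.exists_opposite_le (hp : HasPattern G u {0, 2}) :
    ∃ v : Fin 4 → V, HasPattern G v {0, 2} ∧
      (treeLeaves G v 2).ncard ≤ (treeLeaves G v 0).ncard := by
  rcases le_total (treeLeaves G u 2).ncard (treeLeaves G u 0).ncard with h | h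
  · exact ⟨u, hp, h⟩
  · obtain ⟨v, hv, h0, h2, -⟩ := hp.swap_opposite
    exact ⟨v, hv, by rwa [h0, h2]⟩

theorem HasPattern.exists_adjacent_le (hp : HasPattern G u {0, 1}) :
    ∃ v : Fin 4 → V, HasPattern G v {0, 1} ∧
      (treeLeaves G v 1).ncard ≤ (treeLeaves G v 0).ncard := by
  rcases le_total (treeLeaves G u 1).ncard (treeLeaves G u 0).ncard with h | h
  · exact ⟨u, hp, h⟩
  · refine ⟨_, hp.reflect 1 (S' := {0, 1}) (by intro i; fin_cases i <;> simp), ?_⟩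
    rw [treeLeaves_congr (offCycle_reflect 1), treeLeaves_congr (offCycle_reflect 1)]
    exact h

theorem TwoLeafShape.ncard {i : Fin 4} (h : TwoLeafShape G u i) :
    (treeLeaves G u i).ncard = 2 := by
  obtain ⟨v, x, y, hne, hl, -⟩ := h
  rw [hl, Set.ncard_pair hne]

theorem ThreeLeafShape.ncard {i : Fin 4} (h : ThreeLeafShape G u i) :
    (treeLeaves G u i).ncard = 3 := by
  obtain ⟨v, v', x, y, z, hxy, hxz, hyz, hl, -⟩ := h
  exact Set.ncard_eq_three.mpr ⟨x, y, z, hxy, hxz, hyz, hl⟩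

variable [Fintype V]

theorem HasPattern.count_one (hp : HasPattern G u {0}) :
    numLeaves G = (treeLeaves G u 0).ncard ∧ (treeLeaves G u 2).ncard = 0 ∧
      1 ≤ (treeLeaves G u 0).ncard := by
  have h0 := hp.treeLeaves_nonempty (i := 0) (by simp)
  have h1 := hp.treeLeaves_ncard (i := 1) (by simp)
  have h2 := hp.treeLeaves_ncard (i := 2) (by simp)
  have h3 := hp.treeLeaves_ncard (i := 3) (by simp)
  have := hp.numLeaves_eq
  omega

theorem HasPattern.count_opposite (hp : HasPattern G u {0, 2}) :
    numLeaves G = (treeLeaves G u 0).ncard + (treeLeaves G u 2).ncard ∧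
      1 ≤ (treeLeaves G u 0).ncard ∧ 1 ≤ (treeLeaves G u 2).ncard := by
  have h0 := hp.treeLeaves_nonempty (i := 0) (by simp)
  have h1 := hp.treeLeaves_ncard (i := 1) (by simp)
  have h2 := hp.treeLeaves_nonempty (i := 2) (by simp)
  have h3 := hp.treeLeaves_ncard (i := 3) (by simp)
  have := hp.numLeaves_eq
  omega

theorem HasPattern.count_adjacent (hp : HasPattern G u {0, 1}) :
    numLeaves G = (treeLeaves G u 0).ncard + (treeLeaves G u 1).ncard ∧
      1 ≤ (treeLeaves G u 0).ncard ∧ 1 ≤ (treeLeaves G u 1).ncard := by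
  have h0 := hp.treeLeaves_nonempty (i := 0) (by simp)
  have h1 := hp.treeLeaves_nonempty (i := 1) (by simp)
  have h2 := hp.treeLeaves_ncard (i := 2) (by simp)
  have h3 := hp.treeLeaves_ncard (i := 3) (by simp)
  have := hp.numLeaves_eq
  omega

theorem HasPattern.count_three_trees (hp : HasPattern G u {0, 1, 2}) :
    numLeaves G = (treeLeaves G u 0).ncard + (treeLeaves G u 1).ncard + (treeLeaves G u 2).ncard ∧
      1 ≤ (treeLeaves G u 0).ncard ∧ 1 ≤ (treeLeaves G u 1).ncard ∧
      1 ≤ (treeLeaves G u 2).ncard := by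
  have h0 := hp.treeLeaves_nonempty (i := 0) (by simp)
  have h1 := hp.treeLeaves_nonempty (i := 1) (by simp)
  have h2 := hp.treeLeaves_nonempty (i := 2) (by simp)
  have h3 := hp.treeLeaves_ncard (i := 3) (by simp)
  have := hp.numLeaves_eq
  omega

theorem exists_ne_of_two_le {i : Fin 4} (h : 2 ≤ (treeLeaves G u i).ncard) :
    ∃ x ∈ treeLeaves G u i, ∃ y ∈ treeLeaves G u i, x ≠ y :=
  (Set.one_lt_ncard (Set.toFinite _)).mp h

/-! ### Exact values in the three families. -/

theorem trc_of_family5 (h : Family5 G) : trc G + 5 = 2 * Fintype.card V := by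
  -- In both classes the leaves and the trivial trees number 4 together, so |F| = 2n - 8 and three
  -- new colors are added.
  obtain ⟨u, t, hp, h0, h2, hl⟩ : ∃ (u : Fin 4 → V) (t : ℕ),
      ((HasPattern G u {0} ∧ t = 3) ∨ (HasPattern G u {0, 2} ∧ t = 2)) ∧
      (treeLeaves G u 0).ncard = 1 ∧ (treeLeaves G u 2).ncard ≤ 1 ∧ numLeaves G + t = 4 := by
    rcases h with h | ⟨⟨u, hp⟩, hl⟩
    · obtain ⟨⟨u, hp⟩, hl⟩ := isB4_iff.mp h
      have := hp.count_one
      exact ⟨u, 3, Or.inl ⟨hp, rfl⟩, by omega, by omega, by omega⟩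
    · have := hp.count_opposite
      exact ⟨u, 2, Or.inr ⟨hp, rfl⟩, by omega, by omega, by omega⟩
  obtain ⟨ρ, h1, h3, hF⟩ := HasPattern.opposite hp
  have := trc_eq (ρ.upper_three h1 h3) fun _ hk => ρ.lower_one h1 h3 hk h0 h2
  omega

theorem trc_of_twoLeafShape {t : ℕ}
    (hp : (HasPattern G u {0} ∧ t = 3) ∨ (HasPattern G u {0, 2} ∧ t = 2))
    (h0 : TwoLeafShape G u 0) (h2 : (treeLeaves G u 2).ncard ≤ 1) :
    trc G + numLeaves G + t + 2 = 2 * Fintype.card V := by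
  obtain ⟨ρ, h1, h3, hF⟩ := HasPattern.opposite hp
  obtain ⟨x, hx, y, hy, hxy⟩ := exists_ne_of_two_le h0.ncard.ge
  have := trc_eq (ρ.upper_two h1 h3 hx hy hxy) fun _ hk => ρ.lower_twoLeafShape h1 h3 hk h0 h2
  omega

theorem trc_of_not_twoLeafShape {t : ℕ}
    (hp : (HasPattern G u {0} ∧ t = 3) ∨ (HasPattern G u {0, 2} ∧ t = 2))
    (h0 : (treeLeaves G u 0).ncard = 2) (hnot : ¬ TwoLeafShape G u 0)
    (h2 : (treeLeaves G u 2).ncard ≤ 1) :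
    trc G + numLeaves G + t + 3 = 2 * Fintype.card V := by
  obtain ⟨ρ, h1, h3, hF⟩ := HasPattern.opposite hp
  have := trc_eq (ρ.upper_one_of_two h1 h3 h0 hnot) fun _ hk => ρ.lower_two h1 h3 hk h0 h2
  omega

theorem trc_of_threeLeafShape {t : ℕ}
    (hp : (HasPattern G u {0} ∧ t = 3) ∨ (HasPattern G u {0, 2} ∧ t = 2))
    (h0 : ThreeLeafShape G u 0) (h2 : (treeLeaves G u 2).ncard ≤ 1) :
    trc G + numLeaves G + t + 2 = 2 * Fintype.card V := by
  obtain ⟨ρ, h1, h3, hF⟩ := HasPattern.opposite hp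
  obtain ⟨x, hx, y, hy, hxy⟩ := exists_ne_of_two_le (i := 0) (by rw [h0.ncard]; decide)
  have := trc_eq (ρ.upper_two h1 h3 hx hy hxy) fun _ hk => ρ.lower_threeLeafShape h1 h3 hk h0 h2
  omega

theorem trc_of_adjacent (hp : HasPattern G u {0, 1}) (hl : numLeaves G ≤ 3) :
    trc G + numLeaves G + 5 = 2 * Fintype.card V := by
  obtain ⟨v, hv, hle⟩ := hp.exists_adjacent_le
  obtain ⟨ρ, h0, h1, h2, h3, hF⟩ := hv.adjacent
  have hc := hv.count_adjacent
  have := trc_eq (ρ.upper_one_adjacent h0 h1 h2 h3) fun _ hk =>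
    ρ.lower_adjacent hk h2 h3 (by omega) (by omega)
  omega

theorem trc_of_three_trees (hp : HasPattern G u {0, 1, 2}) (h0 : (treeLeaves G u 0).ncard ≤ 2)
    (hl : numLeaves G = (treeLeaves G u 0).ncard + 2) :
    trc G + numLeaves G + 4 = 2 * Fintype.card V := by
  obtain ⟨ρ, e0, e1, e2, e3, hF⟩ := hp.three_trees
  have hc := hp.count_three_trees
  have := trc_eq (ρ.upper_one_three_trees e0 e1 e2) fun _ hk =>
    ρ.lower_three_trees hk e3 (by omega) (by omega) (by omega)
  omega

theorem trc_of_family7 (h : Family7 G) : trc G + 7 = 2 * Fintype.card V := by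
  rcases h with ⟨⟨-, hl⟩, u, hp, h0⟩ | ⟨⟨u, hp⟩, hl⟩ | ⟨⟨-, hl⟩, u, hp, h0⟩ | ⟨⟨u, hp⟩, hl⟩ |
    ⟨⟨u, hp⟩, hl⟩
  · have hc := hp.count_one
    have := trc_of_twoLeafShape (Or.inl ⟨hp, rfl⟩) h0 (by omega)
    omega
  · have := trc_of_adjacent hp (by omega)
    omega
  · have hc := hp.count_opposite
    have hn := h0.ncard
    have := trc_of_twoLeafShape (Or.inr ⟨hp, rfl⟩) h0 (by omega)
    omega
  · have hc := hp.count_three_trees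
    have := trc_of_three_trees hp (by omega) (by omega)
    omega
  · have hn := hp.numLeaves_eq
    have h1 := fun i => hp.treeLeaves_nonempty (i := i) (Set.mem_univ i)
    have h10 := h1 0
    have h11 := h1 1
    have h12 := h1 2
    have h13 := h1 3
    obtain ⟨ρ, e0, e1, e2, hF⟩ := hp.four_trees
    have := trc_eq (ρ.upper_one_three_trees e0 e1 e2) fun _ hk =>
      ρ.lower_four_trees hk fun i => by
        have hi : i = 0 ∨ i = 1 ∨ i = 2 ∨ i = 3 := by
          clear * -
          revert i
          decide
        rcases hi with rfl | rfl | rfl | rfl <;> omega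
    omega

theorem trc_of_family8 (h : Family8 G) : trc G + 8 = 2 * Fintype.card V := by
  rcases h with ⟨⟨⟨u, hp⟩, hl⟩, h0⟩ | ⟨⟨-, hl⟩, u, hp, h0⟩ | ⟨⟨u, hp⟩, hl⟩ | ⟨⟨⟨v, hv⟩, hl⟩, h0⟩ |
    ⟨⟨-, hl⟩, u, hp, h0⟩ | ⟨⟨-, hl⟩, u, hp, h0, h2⟩ | ⟨⟨-, hl⟩, u, hp, h0⟩
  · have hc := hp.count_one
    have := trc_of_not_twoLeafShape (Or.inl ⟨hp, rfl⟩) (by omega)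
      (fun h => h0 ⟨⟨⟨u, hp⟩, hl⟩, u, hp, h⟩) (by omega)
    omega
  · have hc := hp.count_one
    have := trc_of_threeLeafShape (Or.inl ⟨hp, rfl⟩) h0 (by omega)
    omega
  · have := trc_of_adjacent hp (by omega)
    omega
  -- With three leaves over two opposite roots, the tree with two leaves is moved to `u 0`.
  · obtain ⟨u, hp, hle⟩ := hv.exists_opposite_le
    have hc := hp.count_opposite
    have := trc_of_not_twoLeafShape (Or.inr ⟨hp, rfl⟩) (by omega)
      (fun h => h0 ⟨⟨⟨u, hp⟩, hl⟩, u, hp, h⟩) (by omega)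
    omega
  · have hc := hp.count_opposite
    have hn := h0.ncard
    have := trc_of_threeLeafShape (Or.inr ⟨hp, rfl⟩) h0 (by omega)
    omega
  · obtain ⟨ρ, h1, h3, hF⟩ := HasPattern.opposite (Or.inr ⟨hp, rfl⟩)
    obtain ⟨x, hx, y, hy, hxy⟩ := exists_ne_of_two_le h0.ncard.ge
    have := trc_eq (ρ.upper_two h1 h3 hx hy hxy) fun _ hk =>
      ρ.lower_twoLeafShape_twoLeafShape h1 h3 hk h0 h2
    omega
  · have hc := hp.count_three_trees
    have := trc_of_three_trees hp (by omega) (by omega)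
    omega

/-! ### The bound outside the families. -/

theorem trc_le_of_one (hp : HasPattern G u {0}) (h5 : ¬ Family5 G) (h7 : ¬ Family7 G)
    (h8 : ¬ Family8 G) : trc G + 9 ≤ 2 * Fintype.card V := by
  have hc := hp.count_one
  obtain ⟨ρ, e1, e3, hF⟩ := HasPattern.opposite (Or.inl ⟨hp, rfl⟩)
  have n1 : numLeaves G ≠ 1 := fun h => h5 (Or.inl (isB4_iff.mpr ⟨⟨u, hp⟩, h⟩))
  have n2 : numLeaves G ≠ 2 := fun h => by
    by_cases h' : H1_2' G
    · exact h7 (Or.inl h')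
    · exact h8 (Or.inl ⟨⟨⟨u, hp⟩, h⟩, h'⟩)
  by_cases n3 : numLeaves G = 3
  · have := trc_le (ρ.upper_one_of_three e1 e3 (by omega) fun h =>
      h8 (Or.inr (Or.inl ⟨⟨⟨u, hp⟩, n3⟩, u, hp, h⟩)))
    omega
  -- With at least four leaves |F| ≤ 2n - 11, so even two new colors are affordable.
  · obtain ⟨x, hx, y, hy, hxy⟩ := exists_ne_of_two_le (u := u) (G := G) (i := 0) (by omega)
    have := trc_le (ρ.upper_two e1 e3 hx hy hxy)
    omega

theorem trc_le_of_opposite (hp : HasPattern G u {0, 2}) (h5 : ¬ Family5 G) (h7 : ¬ Family7 G)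
    (h8 : ¬ Family8 G) : trc G + 9 ≤ 2 * Fintype.card V := by
  obtain ⟨u, hp, hle⟩ := hp.exists_opposite_le
  have hc := hp.count_opposite
  obtain ⟨ρ, e1, e3, hF⟩ := HasPattern.opposite (Or.inr ⟨hp, rfl⟩)
  have n2 : numLeaves G ≠ 2 := fun h => h5 (Or.inr ⟨⟨u, hp⟩, h⟩)
  have n3 : numLeaves G ≠ 3 := fun h => by
    by_cases h' : H3_3' G
    · exact h7 (Or.inr (Or.inr (Or.inl h')))
    · exact h8 (Or.inr (Or.inr (Or.inr (Or.inl ⟨⟨⟨u, hp⟩, h⟩, h'⟩))))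
  by_cases n4 : numLeaves G = 4
  · by_cases h0 : (treeLeaves G u 0).ncard = 3
    · have := trc_le (ρ.upper_one_of_three e1 e3 h0 fun h =>
        h8 (Or.inr (Or.inr (Or.inr (Or.inr (Or.inl ⟨⟨⟨u, hp⟩, n4⟩, u, hp, h⟩))))))
      omega
    · by_cases hs : TwoLeafShape G u 0
      · have hs' : ¬ TwoLeafShape G u 2 := fun hs' => h8 (Or.inr (Or.inr (Or.inr (Or.inr
          (Or.inr (Or.inl ⟨⟨⟨u, hp⟩, n4⟩, u, hp, hs, hs'⟩))))))
        -- With two leaves on each side, one tree not of type I suffices; it is moved to `u 0`.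
        obtain ⟨v, hv, hv0, -, hvs⟩ := hp.swap_opposite
        obtain ⟨ρ', e1', e3', hF'⟩ := HasPattern.opposite (Or.inr ⟨hv, rfl⟩)
        have := trc_le (ρ'.upper_one_of_two e1' e3' (by rw [hv0]; omega) (by rwa [hvs]))
        omega
      · have := trc_le (ρ.upper_one_of_two e1 e3 (by omega) hs)
        omega
  · obtain ⟨x, hx, y, hy, hxy⟩ := exists_ne_of_two_le (u := u) (G := G) (i := 0) (by omega)
    have := trc_le (ρ.upper_two e1 e3 hx hy hxy)
    omega

theorem trc_le_of_adjacent (hp : HasPattern G u {0, 1}) (h7 : ¬ Family7 G)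
    (h8 : ¬ Family8 G) : trc G + 9 ≤ 2 * Fintype.card V := by
  have hc := hp.count_adjacent
  obtain ⟨ρ, e0, e1, e2, e3, hF⟩ := hp.adjacent
  have n2 : numLeaves G ≠ 2 := fun h => h7 (Or.inr (Or.inl ⟨⟨u, hp⟩, h⟩))
  have n3 : numLeaves G ≠ 3 := fun h => h8 (Or.inr (Or.inr (Or.inl ⟨⟨u, hp⟩, h⟩)))
  have := trc_le (ρ.upper_one_adjacent e0 e1 e2 e3)
  omega

theorem trc_le_of_three_trees (hp : HasPattern G u {0, 1, 2}) (h7 : ¬ Family7 G)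
    (h8 : ¬ Family8 G) : trc G + 9 ≤ 2 * Fintype.card V := by
  have hc := hp.count_three_trees
  obtain ⟨ρ, e0, e1, e2, e3, hF⟩ := hp.three_trees
  have n3 : numLeaves G ≠ 3 := fun h => h7 (Or.inr (Or.inr (Or.inr (Or.inl ⟨⟨u, hp⟩, h⟩))))
  by_cases n4 : numLeaves G = 4
  · have h84 : ¬ H4_4' G := fun h =>
      h8 (Or.inr (Or.inr (Or.inr (Or.inr (Or.inr (Or.inr h))))))
    have h0 : (treeLeaves G u 0).ncard ≠ 2 := fun h => h84 ⟨⟨⟨u, hp⟩, n4⟩, u, hp, h⟩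
    -- The reflection exchanging `u 0` and `u 2` excludes the second neighbor of the trivial tree as
    -- well, so the two leaves are over `u 1`.
    have h2 : (treeLeaves G u 2).ncard ≠ 2 := fun h =>
      h84 ⟨⟨⟨u, hp⟩, n4⟩, _, hp.reflect 2 (S' := {0, 1, 2}) (by intro i; fin_cases i <;> simp), by
        rw [treeLeaves_congr (offCycle_reflect 2)]
        exact h⟩
    have := trc_le (ρ.upper_zero_three_trees e0 e1 e2 (by omega))
    omega
  · have := trc_le (ρ.upper_one_three_trees e0 e1 e2)
    omega

theorem trc_le_of_four_trees (hp : HasPattern G u Set.univ) (h7 : ¬ Family7 G) :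
    trc G + 9 ≤ 2 * Fintype.card V := by
  have hn := hp.numLeaves_eq
  have h1 := fun i => hp.treeLeaves_nonempty (i := i) (Set.mem_univ i)
  have h10 := h1 0
  have h11 := h1 1
  have h12 := h1 2
  have h13 := h1 3
  have n4 : numLeaves G ≠ 4 := fun h => h7 (Or.inr (Or.inr (Or.inr (Or.inr ⟨⟨u, hp⟩, h⟩))))
  by_cases n5 : numLeaves G = 5
  -- One of the four trees has two leaves; a rotation brings it to `u 1`, the middle of the three
  -- trees used for the coloring without new colors.
  · obtain ⟨a, ha⟩ : ∃ a : Fin 4, (treeLeaves G u (a + 1)).ncard = 2 := by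
      by_contra hno
      push Not at hno
      have m0 := hno 3
      have m1 := hno 0
      have m2 := hno 1
      have m3 := hno 2
      simp only [Fin.isValue, Fin.reduceAdd, zero_add] at m0 m1 m2 m3
      omega
    have hp' := hp.rotate a (S' := Set.univ) (by simp)
    obtain ⟨ρ, e0, e1, e2, hF⟩ := hp'.four_trees
    have := trc_le (ρ.upper_zero_three_trees e0 e1 e2 (by
      rw [treeLeaves_congr (offCycle_rotate a)]
      exact ha))
    omega
  · obtain ⟨ρ, e0, e1, e2, hF⟩ := hp.four_trees
    have := trc_le (ρ.upper_one_three_trees e0 e1 e2)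
    omega

theorem trc_le_of_not_family (hconn : G.Connected) (huni : IsUnicyclic G)
    (hfour : circumference G = 4)
    (hnot : ¬ Nonempty (G ≃g SimpleGraph.cycleGraph (Fintype.card V)))
    (h5 : ¬ Family5 G) (h7 : ¬ Family7 G) (h8 : ¬ Family8 G) :
    trc G + 9 ≤ 2 * Fintype.card V := by
  obtain ⟨u, hu⟩ := exists_isFourCycle hfour
  have hp : HasPattern G u {i | TreeNontrivial G u i} :=
    ⟨⟨hconn, huni, hfour⟩, hu, fun _ => Iff.rfl⟩
  rcases exists_rotate {i | TreeNontrivial G u i} with h | ⟨a, S', h, hS⟩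
  · rw [h] at hp
    exact absurd (nonempty_iso_cycleGraph hp) hnot
  · have hp' := hp.rotate a hS
    rcases h with rfl | rfl | rfl | rfl | rfl
    · exact trc_le_of_one hp' h5 h7 h8
    · exact trc_le_of_adjacent hp' h7 h8
    · exact trc_le_of_opposite hp' h5 h7 h8
    · exact trc_le_of_three_trees hp' h7 h8
    · exact trc_le_of_four_trees hp' h7

end TRC

theorem theorem3p2 {V : Type*} [Fintype V] (G : SimpleGraph V)
    (hconn : G.Connected) (huni : TRC.IsUnicyclic G) (hfour : TRC.circumference G = 4)
    (hnot : ¬ Nonempty (G ≃g SimpleGraph.cycleGraph (Fintype.card V))) :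
    (TRC.Family5 G → (TRC.trc G : ℤ) = 2 * (Fintype.card V : ℤ) - 5) ∧
    (TRC.Family7 G → (TRC.trc G : ℤ) = 2 * (Fintype.card V : ℤ) - 7) ∧
    (TRC.Family8 G → (TRC.trc G : ℤ) = 2 * (Fintype.card V : ℤ) - 8) ∧
    (¬ TRC.Family5 G → ¬ TRC.Family7 G → ¬ TRC.Family8 G →
      (TRC.trc G : ℤ) ≤ 2 * (Fintype.card V : ℤ) - 9) := by
  refine ⟨fun h => ?_, fun h => ?_, fun h => ?_, fun h5 h7 h8 => ?_⟩
  · have := TRC.trc_of_family5 h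
    omega
  · have := TRC.trc_of_family7 h
    omega
  · have := TRC.trc_of_family8 h
    omega
  · have := TRC.trc_le_of_not_family hconn huni hfour hnot h5 h7 h8
    omega
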